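/- **Setting.** A *looped ReLU network* $\theta$ consists of a state dimension $n\ge 3$ and a feedforward network $f_\theta:\mathbb R^n\to\mathbb R^n$ with any number $L\ge 1$ of affine layers (weight matrices and bias vectors), arbitrary hidden widths, and coordinatewise ReLU between consecutive layers. It is run in exact real arithmetic from $x_0=0$ by $x_{t+1}=f_\theta(x_t)$. At each time $t\ge 1$: if $(x_t)_1>0$ the network halts; otherwise, if $(x_t)_2>0$, the bit $\mathbf 1[(x_t)_3>0]$ is appended to the output. The network *outputs* $s\in\{0,1\}^*$ if it halts and the bits appended before halting form $s$. Write $\|\theta\|_0$ for the number of non-zero weights and biases of $\theta$ and $\|\theta\|_p=(\sum_i|\theta_i|^p)^{1/p}$. Fix a precision $(\delta,M)$, where $0<\delta\le M<\infty$ and $\delta$ is a computable real number, and let $\Theta_{\delta,M}$ be the set of looped ReLU networks all of whose weights and biases lie in $\delta\mathbb Z\cap[-M,M]$. For $s\in\{0,1\}^*$ and $p\in[1,\infty)$ let $$\mathcal N(s)=\inf\{\|\theta\|_0:\theta\in\Theta_{\delta,M},\ \theta\text{ outputs }s\},\qquad \mathcal N_p(s)=\inf\{\|\theta\|_p:\theta\in\Theta_{\delta,M},\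 \theta\text{ outputs }s\}.$$ Let $U$ be a universal self-delimiting machine, that is, a partial computable function $\{0,1\}^*\rightharpoonup\{0,1\}^*$ with prefix-free domain such that for every partial computable $\varphi$ with prefix-free domain there is a constant $c$ such that whenever $\varphi(p)=s$ there is $q$ with $U(q)=s$ and $|q|\le|p|+c$. Let $K(s)=\min\{|p|:U(p)=s\}$ be the prefix Kolmogorov complexity. **Theorem.** There are constants $c_U,c_d\ge 0$, depending only on $U$ and $(\delta,M)$, such that for every $s\in\{0,1\}^*$ both $K(s)$ and $\mathcal N(s)$ are finite and $$\mathcal N(s)\le K(s)+c_U,\qquad K(s)\le c_d\,\mathcal N(s)\log_2\mathcal N(s)+c_d .$$ Moreover, for every $p\in[1,\infty)$, every $\theta\in\Theta_{\delta,M}$ satisfies $\delta^p\|\theta\|_0\le\|\theta\|_p^p\le M^p\|\theta\|_0$, and, with the same constants, for every $s\in\{0,1\}^*$, $$\mathcal N_p(s)^p\le M^p\,(K(s)+c_U),\qquad K(s)\le \frac{c_d}{\delta^p}\,\mathcal N_p(s)^p\,\log_2\!\Big(\frac{\mathcal N_p(s)^p}{\delta^p}\Big)+c_d .$$ -/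

import Mathlib

noncomputable section

namespace LoopedReLU

/-! ### Feedforward ReLU networks -/

/-- The parameters (weight matrices and bias vectors) of a feedforward network `ℝᵐ → ℝⁿ` with
at least one layer. `last A b` is a single affine layer; `layer A b N` is an affine layer,
followed by ReLU, followed by the network `N`. The depth and the hidden widths are arbitrary. -/
inductive FFN : ℕ → ℕ → Type
  | last {m n : ℕ} (A : Matrix (Fin n) (Fin m) ℝ) (b : Fin n → ℝ) : FFN m n
  | layer {m h n : ℕ} (A : Matrix (Fin h) (Fin m) ℝ) (b : Fin h → ℝ) (N : FFN h n) : FFN m n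

/-- Coordinatewise `x ↦ max x 0`. -/
def relu {n : ℕ} (x : Fin n → ℝ) : Fin n → ℝ := fun i => max (x i) 0

/-- The function computed by a feedforward network. There is no ReLU after the last layer. -/
def FFN.eval : {m n : ℕ} → FFN m n → (Fin m → ℝ) → (Fin n → ℝ)
  | _, _, .last A b, x => A.mulVec x + b
  | _, _, .layer A b N, x => N.eval (relu (A.mulVec x + b))

/-- The entries of one weight matrix and one bias vector, with multiplicity. -/
def layerParams {m n : ℕ} (A : Matrix (Fin n) (Fin m) ℝ) (b : Fin n → ℝ) : Multiset ℝ :=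
  (Finset.univ : Finset (Fin n × Fin m)).val.map (fun ij => A ij.1 ij.2) +
    (Finset.univ : Finset (Fin n)).val.map b

/-- All entries of the parameter vector, with multiplicity. -/
def FFN.params : {m n : ℕ} → FFN m n → Multiset ℝ
  | _, _, .last A b => layerParams A b
  | _, _, .layer A b N => layerParams A b + N.params

/-! ### Looped networks -/

/-- A looped network: a feedforward block `ℝⁿ → ℝⁿ`, where `ℝⁿ` has the three channels. -/
structure LoopedNet where
  /-- the state dimension -/
  n : ℕ
  three_le : 3 ≤ n
  /-- the block that is iterated -/
  block : FFN n n

namespace LoopedNet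

variable (θ : LoopedNet)

/-- The state `x_t`, where `x_0 = 0` and `x_{t+1} = f_θ(x_t)`. -/
def state (t : ℕ) : Fin θ.n → ℝ := θ.block.eval^[t] 0

/-- First coordinate of the state at time `t`. -/
def haltCh (t : ℕ) : ℝ := θ.state t ⟨0, by have := θ.three_le; omega⟩

/-- Second coordinate of the state at time `t`. -/
def emitCh (t : ℕ) : ℝ := θ.state t ⟨1, by have := θ.three_le; omega⟩

/-- Third coordinate of the state at time `t`. -/
def bitCh (t : ℕ) : ℝ := θ.state t ⟨2, by have := θ.three_le; omega⟩

open Classical in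
/-- The bits (none or one) appended to the output at a time `t` at which the run goes on. -/
def emitted (t : ℕ) : List Bool :=
  if 0 < θ.emitCh t then [decide (0 < θ.bitCh t)] else []

/-- The network halts, at time `τ ≥ 1`, and the bits appended at the times `1, …, τ - 1`
form `s`. -/
def Outputs (s : List Bool) : Prop :=
  ∃ τ : ℕ, 1 ≤ τ ∧ 0 < θ.haltCh τ ∧ (∀ t, 1 ≤ t → t < τ → ¬ 0 < θ.haltCh t) ∧
    (List.range' 1 (τ - 1)).flatMap θ.emitted = s

/-- Every parameter lies in `δℤ ∩ [-M, M]`. -/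
def HasPrecision (δ M : ℝ) : Prop :=
  ∀ w ∈ θ.block.params, (∃ k : ℤ, w = δ * k) ∧ |w| ≤ M

open Classical in
/-- The number `‖θ‖₀` of non-zero parameters. -/
def l0 : ℕ := (θ.block.params.filter (fun w => w ≠ 0)).card

/-- The number `‖θ‖_p ^ p`, the sum of the `p`-th powers of the absolute values of the
parameters. -/
def lpPow (p : ℝ) : ℝ := (θ.block.params.map (fun w => |w| ^ p)).sum

/-- The `L_p` norm `‖θ‖_p` of the parameter vector. -/
def lpNorm (p : ℝ) : ℝ := θ.lpPow p ^ (1 / p)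

end LoopedNet

/-- Neural complexity: the least number of non-zero parameters of a network with precision
`(δ, M)` that outputs `s`, and `⊤` if there is none. -/
def neuralComplexity (δ M : ℝ) (s : List Bool) : ℕ∞ :=
  ⨅ θ : LoopedNet, ⨅ _ : θ.HasPrecision δ M ∧ θ.Outputs s, (θ.l0 : ℕ∞)

/-- The infimum of the `L_p` norms of the networks with precision `(δ, M)` that output `s`. -/
def lpComplexity (δ M p : ℝ) (s : List Bool) : ℝ :=
  sInf {r : ℝ | ∃ θ : LoopedNet, θ.HasPrecision δ M ∧ θ.Outputs s ∧ θ.lpNorm p = r}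

/-! ### Prefix Kolmogorov complexity -/

/-- No program on which the machine halts is a proper prefix of another one. -/
def IsPrefixFree (φ : List Bool →. List Bool) : Prop :=
  ∀ p q : List Bool, (φ p).Dom → (φ q).Dom → p <+: q → p = q

/-- A universal self-delimiting machine: a partial computable function with prefix-free domain
that simulates every other one with programs longer by at most a constant. (This is implied by
the existence, for each `φ`, of a string `w` with `U (w ++ p) = φ p` for all `p`.) -/
structure IsUniversalPrefixMachine (U : List Bool →. List Bool) : Prop where
  partrec : Partrec U
  prefixFree : IsPrefixFree U
  universal : ∀ φ : List Bool →. List Bool, Partrec φ → IsPrefixFree φ →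
    ∃ c : ℕ, ∀ p s : List Bool, s ∈ φ p → ∃ q : List Bool, s ∈ U q ∧ q.length ≤ p.length + c

/-- The length of a shortest program for `s` on the machine `U`. -/
def kolmogorov (U : List Bool →. List Bool) (s : List Bool) : ℕ∞ :=
  ⨅ p : List Bool, ⨅ _ : s ∈ U p, (p.length : ℕ∞)

/-- A real number is computable if dyadic approximations of it can be computed to any
precision. -/
def IsComputableReal (x : ℝ) : Prop :=
  ∃ f : ℕ → ℤ, Computable f ∧ ∀ k : ℕ, |x - (f k : ℝ) / 2 ^ k| ≤ 1 / 2 ^ k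

end LoopedReLU

end

/-! Bounding `N` by `K`. The machine `U` is partial computable, so a fixed machine with four stacks
runs it (`exists_stackMachine`), and a looped network simulates that machine
(`exists_net_of_machine`). A stack is a decimal fraction with digits 2, 4, 6, 8. The gaps between
these values let differences of two ReLUs read the top digit, and once that digit is known push and
pop are affine. Since small weights are not available, all values are kept relative to a unit `ref`
that grows by the factor 1000 per iteration, so that division by ten becomes multiplication by an
integer; only signs are ever observed. Integer weights become weights `±δ` by duplicating units,
which multiplies the trajectory by a harmless positive factor (`exists_net_traj`). All this takes a
number of parameters that does not depend on the program.

The program enters through a chain with about one unit per three bits, along which a pulse of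
constant size travels. As `ref` grows by 1000, what the pulse adds to the main stack at one step
lies three decimal places below what it added one step earlier. A link costs two parameters that
forward the pulse and at most one that tells which triple of bits it carries. Three parameters for
three bits: this is why `K` has coefficient one. When the pulse leaves the chain it sets a timer
that grows by 10000 per iteration; on catching up with `ref` it provides a signal of the right size
to start the machine.

Bounding `K` by `N`. A network with `N` non-zero parameters is a list of at most `⌊M/δ⌋ N` edges of
weight `±δ` (`LoopedNet.exists_program`). After renaming there are linearly many variables, so the
list has a self-delimiting code of `O(N log N)` bits up to an additive constant
(`exists_program_of_net`, `exists_code_bound`). Decoding it to the output requires an exact run.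
Every value is an integer polynomial in `δ`, so it suffices to compute the sign of such a polynomial
(`exists_computable_pos`). Non-zero signs show up in good approximations of `δ`. Vanishing also has
finite certificates: by Hilbert's basis theorem the polynomials vanishing at `δ` form a finitely
generated ideal, and a fixed list of generators can be built into the algorithm.

Norms. Non-zero parameters have absolute value between `δ` and `M`, so `‖θ‖_p ^ p` and `‖θ‖₀` agree
up to the factors `δ ^ p` and `M ^ p`; `x log x` is monotone on `[1, ∞)`. -/

noncomputable section
namespace LoopedReLU
open Turing Turing.PartrecToTM2

/-! ### Stack machines with an output tape -/

/-- An instruction of a stack machine with stacks indexed by `K`, alphabet `Γ` and states `Q`. -/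
inductive Instr (K Γ Q : Type)
  | push (k : K) (a : Γ) (q : Q)
  | pop (k : K) (f : Option Γ → Q)
  | peek (k : K) (f : Option Γ → Q)
  | emit (b : Bool) (q : Q)
  | halt

/-- The states an instruction can lead to. -/
def Instr.Leads {K Γ Q : Type} (F : Q → Prop) : Instr K Γ Q → Prop
  | .push _ _ q => F q
  | .pop _ f => ∀ o, F (f o)
  | .peek _ f => ∀ o, F (f o)
  | .emit _ q => F q
  | .halt => True

/-- Renaming of the states. -/
def Instr.map {K Γ Q Q' : Type} (φ : Q → Q') : Instr K Γ Q → Instr K Γ Q'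
  | .push k a q => .push k a (φ q)
  | .pop k f => .pop k (fun o => φ (f o))
  | .peek k f => .peek k (fun o => φ (f o))
  | .emit b q => .emit b (φ q)
  | .halt => .halt

/-- From state `q` with stack contents `S` the machine `M` emits exactly `s` and halts. -/
inductive Produces {K Γ Q : Type} [DecidableEq K] (M : Q → Instr K Γ Q) :
    Q → (K → List Γ) → List Bool → Prop
  | push {q S s k a q'} (h : M q = .push k a q')
      (H : Produces M q' (Function.update S k (a :: S k)) s) : Produces M q S s
  | pop {q S s k f} (h : M q = .pop k f)
      (H : Produces M (f (S k).head?) (Function.update S k (S k).tail) s) : Produces M q S s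
  | peek {q S s k f} (h : M q = .peek k f)
      (H : Produces M (f (S k).head?) S s) : Produces M q S s
  | emit {q S s b q'} (h : M q = .emit b q') (H : Produces M q' S s) : Produces M q S (b :: s)
  | halt {q S} (h : M q = .halt) : Produces M q S []

/-- Induction along the run: it never leaves `F`, so agreement of the two machines on `F` is enough.
-/
theorem Produces.map {K Γ Q Q' : Type} [DecidableEq K] {M : Q → Instr K Γ Q}
    {M' : Q' → Instr K Γ Q'} {F : Q → Prop} (φ : Q → Q') (hF : ∀ q, F q → (M q).Leads F)
    (hM : ∀ q, F q → M' (φ q) = (M q).map φ) {q : Q} {S : K → List Γ} {s : List Bool}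
    (H : Produces M q S s) (hq : F q) : Produces M' (φ q) S s := by
  induction H with
  | push h _ ih =>
    have h1 := hF _ hq; have h2 := hM _ hq; rw [h] at h1 h2
    exact .push h2 (ih h1)
  | pop h _ ih =>
    have h1 := hF _ hq; have h2 := hM _ hq; rw [h] at h1 h2
    exact .pop h2 (ih (h1 _))
  | peek h _ ih =>
    have h1 := hF _ hq; have h2 := hM _ hq; rw [h] at h1 h2
    exact .peek h2 (ih (h1 _))
  | emit h _ ih =>
    have h1 := hF _ hq; have h2 := hM _ hq; rw [h] at h1 h2
    exact .emit h2 (ih h1)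
  | halt h =>
    have h2 := hM _ hq; rw [h] at h2
    exact .halt h2

/-- A machine and a finite set of states closed under transitions give a machine with a finite
state space. -/
theorem exists_fintype_machine {K Γ Q : Type} [DecidableEq K] (M : Q → Instr K Γ Q)
    (F : Finset Q) (hF : ∀ q ∈ F, (M q).Leads (· ∈ F)) (q₀ : Q) (h₀ : q₀ ∈ F) :
    ∃ (Q' : Type) (_ : Fintype Q') (_ : DecidableEq Q') (M' : Q' → Instr K Γ Q') (q₀' : Q'),
      ∀ S s, Produces M q₀ S s → Produces M' q₀' S s := by
  classical
  let φ : Q → {q // q ∈ F} := fun q => if h : q ∈ F then ⟨q, h⟩ else ⟨q₀, h₀⟩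
  refine ⟨{q // q ∈ F}, inferInstance, inferInstance, fun q => (M q.1).map φ, φ q₀, ?_⟩
  intro S s H
  refine H.map (F := (· ∈ F)) φ hF (fun q hq => ?_) h₀
  simp [φ, hq]

/-! ### Binary words as numbers -/

/-- The number whose binary digits, least significant first, are `w` followed by a leading `1`. -/
def wordNum (w : List Bool) : ℕ := w.foldr (fun b n => 2 * n + b.toNat) 1

/-- The positive binary numeral of `wordNum`. -/
def wordPosNum (w : List Bool) : PosNum :=
  w.foldr (fun b n => cond b n.bit1 n.bit0) PosNum.one

/-- The stack symbol of a bit. -/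
def bitSym (b : Bool) : Γ' := cond b Γ'.bit1 Γ'.bit0

theorem wordPosNum_cast (w : List Bool) : ((wordPosNum w : PosNum) : ℕ) = wordNum w := by
  induction w with
  | nil => rfl
  | cons b w ih =>
    simp only [wordPosNum, wordNum, List.foldr_cons] at ih ⊢
    cases b <;> simp [PosNum.cast_bit0, PosNum.cast_bit1, ih] <;> ring

theorem trPosNum_wordPosNum (w : List Bool) :
    trPosNum (wordPosNum w) = w.map bitSym ++ [Γ'.bit1] := by
  induction w with
  | nil => rfl
  | cons b w ih =>
    simp only [wordPosNum, List.foldr_cons] at ih ⊢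
    cases b <;> simp [trPosNum, ih, bitSym]

/-- The reason for coding words with a leading one: the stack representation of such a number is
literally the word, followed by that one and a terminator. -/
theorem trList_wordNum (w : List Bool) :
    trList [wordNum w] = w.map bitSym ++ [Γ'.bit1, Γ'.cons] := by
  have : ((wordNum w : ℕ) : Num) = Num.pos (wordPosNum w) := by
    rw [← wordPosNum_cast, ← PosNum.cast_to_num, ← Num.cast_pos, Num.of_to_nat]
    simp
  simp [trList, trNat, this, trNum, trPosNum_wordPosNum]

theorem wordNum_injective : Function.Injective wordNum := by
  have hpos : ∀ w, 0 < wordNum w := fun w => by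
    rw [← wordPosNum_cast]; exact PosNum.cast_pos _
  intro v
  induction v with
  | nil =>
    intro w h
    cases w with
    | nil => rfl
    | cons b w =>
      have := hpos w
      simp only [wordNum, List.foldr_cons, List.foldr_nil] at h this
      omega
  | cons a v ih =>
    intro w h
    cases w with
    | nil =>
      have := hpos v
      simp only [wordNum, List.foldr_cons, List.foldr_nil] at h this
      omega
    | cons b w =>
      simp only [wordNum, List.foldr_cons] at h
      have hab : a = b := by cases a <;> cases b <;> simp at h ⊢ <;> omega
      subst hab
      rw [ih (a₂ := w) (by simp only [wordNum]; omega)]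

/-! ### Partial recursive functions on stack machines -/

/-- Statements of the `TM2` programs obtained from partial recursive functions. -/
abbrev Prog := (TM2.Stmt (fun _ : K' => Γ') Λ' (Option Γ') : Type)

/-- States of the compiled machine: pending statements together with the local variable, and the
states of the final phase, which emits the number on the main stack. -/
inductive RunState
  | run (q : Prog) (v : Option Γ')
  | first
  | buffer (b : Bool)
  | flush (b c : Bool)
  | done

/-- The statements of a `TM2` program, split into single stack operations. -/
def runInstr : Prog → Option Γ' → Instr K' Γ' RunState
  | .push k f q, v => .push k (f v) (.run q v)
  | .peek k f q, v => .peek k (fun o => .run q (f v o))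
  | .pop k f q, v => .pop k (fun o => .run q (f v o))
  -- Steps without a stack operation become a peek whose result is ignored.
  | .load a q, v => .peek K'.main (fun _ => .run q (a v))
  | .branch f q₁ q₂, v => .peek K'.main (fun _ => .run (cond (f v) q₁ q₂) v)
  | .goto l, v => .peek K'.main (fun _ => .run (tr (l v)) v)
  | .halt, _ => .peek K'.main (fun _ => .first)

/-- The compiled machine. -/
def runMachine : RunState → Instr K' Γ' RunState
  | .run q v => runInstr q v
  | .first => .pop K'.main (fun o => match o with
      | some Γ'.bit0 => .buffer false
      | some Γ'.bit1 => .buffer true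
      | _ => .done)
  | .buffer b => .pop K'.main (fun o => match o with
      | some Γ'.bit0 => .flush b false
      | some Γ'.bit1 => .flush b true
      | _ => .done)
  | .flush b c => .emit b (.buffer c)
  | .done => .halt

/-- The state of the compiled machine that corresponds to a configuration. -/
def cfgState (c : TM2.Cfg (fun _ : K' => Γ') Λ' (Option Γ')) : RunState :=
  match c.l with
  | some l => .run (tr l) c.var
  | none => .first

theorem produces_of_stepAux (q : TM2.Stmt (fun _ : K' => Γ') Λ' (Option Γ')) (v : Option Γ')
    (S : K' → List Γ') (s : List Bool)
    (H : Produces runMachine (cfgState (TM2.stepAux q v S)) (TM2.stepAux q v S).stk s) :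
    Produces runMachine (.run q v) S s := by
  induction q generalizing v S with
  | push k f q ih => exact .push (k := k) (a := f v) (q' := .run q v) rfl (ih _ _ H)
  | peek k f q ih => exact .peek (k := k) (f := fun o => .run q (f v o)) rfl (ih _ _ H)
  | pop k f q ih => exact .pop (k := k) (f := fun o => .run q (f v o)) rfl (ih _ _ H)
  | load a q ih =>
    exact .peek (k := K'.main) (f := fun _ => .run q (a v)) rfl (ih _ _ H)
  | branch f q₁ q₂ ih₁ ih₂ =>
    refine .peek (k := K'.main) (f := fun _ => .run (cond (f v) q₁ q₂) v) rfl ?_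
    rw [TM2.stepAux] at H
    cases hb : f v <;> simp only [hb, cond_true, cond_false] at H ⊢
    · exact ih₂ _ _ H
    · exact ih₁ _ _ H
  | goto l => exact .peek (k := K'.main) (f := fun _ => .run (tr (l v)) v) rfl H
  | halt => exact .peek (k := K'.main) (f := fun _ => .first) rfl H

theorem produces_of_reaches {a b : TM2.Cfg (fun _ : K' => Γ') Λ' (Option Γ')} {s : List Bool}
    (h : StateTransition.Reaches (TM2.step tr) a b)
    (H : Produces runMachine (cfgState b) b.stk s) : Produces runMachine (cfgState a) a.stk s := by
  induction h using Relation.ReflTransGen.head_induction_on with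
  | refl => exact H
  | @head a c hac _ ih =>
    obtain ⟨l, v, S⟩ := a
    cases l with
    | none => simp [TM2.step] at hac
    | some l =>
      simp only [TM2.step, Option.mem_def, Option.some.injEq] at hac
      subst hac
      exact produces_of_stepAux _ _ _ _ ih

/-- The last digit on the stack is the leading one of `wordNum` and must not be emitted. The machine
therefore withholds each bit until another one follows, and drops the withheld bit at the
terminator. -/
theorem produces_buffer (b : Bool) (l : List Bool) :
    Produces runMachine (.buffer b) (K'.elim (l.map bitSym ++ [Γ'.bit1, Γ'.cons]) [] [] [])
      (b :: l) := by
  induction l generalizing b with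
  | nil =>
    refine .pop rfl ?_
    refine .emit (b := b) (q' := .buffer true) rfl (.pop rfl ?_)
    exact .halt rfl
  | cons c l ih =>
    refine .pop rfl ?_
    have : Produces runMachine (.flush b c)
      (K'.elim (l.map bitSym ++ [Γ'.bit1, Γ'.cons]) [] [] []) (b :: c :: l) :=
      .emit rfl (ih c)
    cases c <;> simpa [bitSym] using this

theorem produces_first (s : List Bool) :
    Produces runMachine .first (K'.elim (s.map bitSym ++ [Γ'.bit1, Γ'.cons]) [] [] []) s := by
  cases s with
  | nil => exact .pop rfl (.pop rfl (.halt rfl))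
  | cons b l =>
    refine .pop rfl ?_
    have := produces_buffer b l
    cases b <;> simpa [bitSym] using this

open Classical in
/-- The states that the compiled machine of the code `c` can visit. -/
def visited (S : Finset Λ') : Finset RunState :=
  ((S.biUnion fun l => TM2.stmts₁ (tr l)) ×ˢ (Finset.univ : Finset (Option Γ'))).image
      (fun x => RunState.run x.1 x.2) ∪
    ({.first, .buffer false, .buffer true, .flush false false, .flush false true,
      .flush true false, .flush true true, .done} : Finset RunState)

theorem run_mem_visited {S : Finset Λ'} {q : Prog} {v : Option Γ'} :
    RunState.run q v ∈ visited S ↔ ∃ l ∈ S, q ∈ TM2.stmts₁ (tr l) := by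
  simp only [visited, Finset.mem_union, Finset.mem_image, Finset.mem_product, Finset.mem_biUnion,
    Finset.mem_univ, and_true, Finset.mem_insert, Finset.mem_singleton, reduceCtorEq, or_false,
    Prod.exists, RunState.run.injEq]
  constructor
  · rintro ⟨a, _, h, rfl, _⟩
    exact h
  · exact fun h => ⟨q, v, h, rfl, rfl⟩

/-- Each instruction passes to a sub-statement of the current one, jumps to a label of the supported
set, or belongs to the finite output phase. -/
theorem visited_closed {S : Finset Λ'} (hS : ∀ l ∈ S, TM2.SupportsStmt S (tr l)) (q : RunState)
    (hq : q ∈ visited S) : (runMachine q).Leads (· ∈ visited S) := by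
  cases q with
  | run q v =>
    obtain ⟨l, hl, hql⟩ := run_mem_visited.1 hq
    have hsup := TM2.stmts₁_supportsStmt_mono hql (hS l hl)
    have sub : ∀ q', q' ∈ TM2.stmts₁ q → ∀ v', RunState.run q' v' ∈ visited S := fun q' h v' =>
      run_mem_visited.2 ⟨l, hl, TM2.stmts₁_trans hql h⟩
    cases q with
    | push k f q => exact sub q (by simp [TM2.stmts₁, TM2.stmts₁_self]) _
    | peek k f q => exact fun o => sub q (by simp [TM2.stmts₁, TM2.stmts₁_self]) _
    | pop k f q => exact fun o => sub q (by simp [TM2.stmts₁, TM2.stmts₁_self]) _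
    | load a q => exact fun o => sub q (by simp [TM2.stmts₁, TM2.stmts₁_self]) _
    | branch f q₁ q₂ =>
      refine fun o => sub _ ?_ _
      simp only [TM2.stmts₁, Finset.mem_insert, Finset.mem_union]
      cases f v
      · exact .inr (.inr TM2.stmts₁_self)
      · exact .inr (.inl TM2.stmts₁_self)
    | goto l' =>
      exact fun o => run_mem_visited.2 ⟨l' v, hsup v, TM2.stmts₁_self⟩
    | halt => exact fun o => by simp [visited]
  | first =>
    intro o
    rcases o with _ | (_ | _ | _ | _) <;> simp [visited]
  | buffer b =>
    intro o
    rcases o with _ | (_ | _ | _ | _) <;> cases b <;> simp [visited]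
  | flush b c => cases c <;> simp [visited, runMachine, Instr.Leads]
  | done => trivial

/-- Every partial recursive function on (numbers of) words is computed by a finite stack machine
that reads its argument from the main stack and emits its value. -/
theorem exists_stackMachine (g : ℕ →. ℕ) (hg : Partrec g) :
    ∃ (Q : Type) (_ : Fintype Q) (_ : DecidableEq Q) (M : Q → Instr K' Γ' Q) (q₀ : Q),
      ∀ w s, wordNum s ∈ g (wordNum w) →
        Produces M q₀ (K'.elim (w.map bitSym ++ [Γ'.bit1, Γ'.cons]) [] [] []) s := by
  obtain ⟨c, hc⟩ := ToPartrec.Code.exists_code (Nat.Partrec'.part_iff₁.2 hg)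
  have hsup := tr_supports c Cont'.halt
  obtain ⟨Q, i₁, i₂, M, q₀, hM⟩ := exists_fintype_machine runMachine
    (visited (codeSupp c Cont'.halt)) (visited_closed hsup.2)
    (.run (tr (trNormal c Cont'.halt)) none)
    (run_mem_visited.2 ⟨_, hsup.1, TM2.stmts₁_self⟩)
  refine ⟨Q, i₁, i₂, M, q₀, fun w s hs => hM _ _ ?_⟩
  have hcode : [wordNum s] ∈ c.eval [wordNum w] := by
    have := hc ⟨[wordNum w], rfl⟩
    rw [this]
    exact Part.mem_map (fun x => [x]) hs
  have hev : halt [wordNum s] ∈ StateTransition.eval (TM2.step tr) (init c [wordNum w]) := by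
    rw [tr_eval]; exact Part.mem_map _ hcode
  have hre := (StateTransition.mem_eval.1 hev).1
  have hfin : Produces runMachine (cfgState (halt [wordNum s])) (halt [wordNum s]).stk s := by
    have := produces_first s
    rw [← trList_wordNum] at this
    exact this
  have := produces_of_reaches hre hfin
  rw [← trList_wordNum]
  exact this

end LoopedReLU
end

/-! ### From integer networks to networks with parameters in `{-δ, 0, δ}` -/

noncomputable section
namespace LoopedReLU

/-! ### Counting parameters -/

/-- `1` for a non-zero parameter and `0` for a zero parameter. -/
def nonzeroCount (w : ℝ) : ℕ := if w = 0 then 0 else 1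

theorem card_filter_ne_zero (s : Multiset ℝ) [DecidablePred fun w : ℝ => w ≠ 0] :
    (s.filter (fun w => w ≠ 0)).card = (s.map nonzeroCount).sum := by
  induction s using Multiset.induction with
  | empty => simp
  | cons a s ih =>
    by_cases h : a = 0
    · simp [h, ih, nonzeroCount]
    · rw [Multiset.filter_cons_of_pos (p := fun w : ℝ => w ≠ 0) _ h]
      simp [h, ih, nonzeroCount, add_comm]

theorem LoopedNet.l0_eq (θ : LoopedNet) : θ.l0 = (θ.block.params.map nonzeroCount).sum := by
  exact @card_filter_ne_zero θ.block.params _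

theorem sum_map_layerParams {α : Type*} [AddCommMonoid α] {m n : ℕ}
    (A : Matrix (Fin n) (Fin m) ℝ) (b : Fin n → ℝ) (f : ℝ → α) :
    ((layerParams A b).map f).sum = (∑ i, ∑ j, f (A i j)) + ∑ i, f (b i) := by
  rw [layerParams, Multiset.map_add, Multiset.sum_add, Multiset.map_map, Multiset.map_map]
  congr 1
  exact Fintype.sum_prod_type' (fun i j => f (A i j))

theorem forall_mem_layerParams {m n : ℕ} (A : Matrix (Fin n) (Fin m) ℝ) (b : Fin n → ℝ)
    (P : ℝ → Prop) (hA : ∀ i j, P (A i j)) (hb : ∀ i, P (b i)) : ∀ w ∈ layerParams A b, P w := by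
  intro w hw
  simp only [layerParams, Multiset.mem_add, Multiset.mem_map] at hw
  rcases hw with ⟨x, _, rfl⟩ | ⟨x, _, rfl⟩
  · exact hA _ _
  · exact hb _

/-! ### Integer networks -/

section IntegerNetwork

variable {X Y : Type} [Fintype X] [Fintype Y]

/-- The hidden values of a homogeneous network with one hidden layer. -/
def hiddenVal (W₁ : Y → X → ℤ) (u : X → ℝ) (y : Y) : ℝ := max (∑ x, (W₁ y x : ℝ) * u x) 0

/-- One iteration of a homogeneous network with one hidden layer. -/
def homStep (W₁ : Y → X → ℤ) (W₂ : X → Y → ℤ) (u : X → ℝ) (x : X) : ℝ :=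
  ∑ y, (W₂ x y : ℝ) * hiddenVal W₁ u y

/-- The iterates of a homogeneous network, started in `u₀`. -/
def traj (W₁ : Y → X → ℤ) (W₂ : X → Y → ℤ) (u₀ : X → ℤ) : ℕ → X → ℝ
  | 0 => fun x => (u₀ x : ℝ)
  | t + 1 => homStep W₁ W₂ (traj W₁ W₂ u₀ t)

end IntegerNetwork

/-- The weight `w` spread over copies: the `c`-th copy of the source gets a weight `±1` if
`c < |w|`. -/
def spread (w : ℤ) (c : ℕ) : ℤ := if c < w.natAbs then w.sign else 0

theorem sum_spread {w : ℤ} {m : ℕ} (h : w.natAbs ≤ m) : ∑ c : Fin m, spread w c = w := by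
  rw [Fin.sum_univ_eq_sum_range (fun c => spread w c)]
  unfold spread
  rw [Finset.sum_ite, Finset.sum_const_zero, add_zero, Finset.sum_const]
  have : (Finset.range m).filter (fun c => c < w.natAbs) = Finset.range w.natAbs := by
    ext c; simp; omega
  rw [this, Finset.card_range, nsmul_eq_mul, mul_comm]
  exact Int.sign_mul_natAbs w

/-- Spreading costs no more than the absolute value of the weight, so the size of the copied network
is governed by absolute sums of integer weights. -/
theorem sum_natAbs_spread (w : ℤ) (m : ℕ) : ∑ c : Fin m, (spread w c).natAbs ≤ w.natAbs := by
  rw [Fin.sum_univ_eq_sum_range (fun c => (spread w c).natAbs)]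
  have : ∀ c ∈ Finset.range m, (spread w c).natAbs ≤ if c < w.natAbs then 1 else 0 := by
    intro c _
    unfold spread
    split_ifs
    · rcases Int.sign_trichotomy w with h | h | h <;> simp [h]
    · simp
  refine (Finset.sum_le_sum this).trans ?_
  rw [← Finset.card_filter]
  calc _ ≤ (Finset.range w.natAbs).card := Finset.card_le_card (by intro c; simp)
    _ = _ := Finset.card_range _

theorem natAbs_spread_le (w : ℤ) (c : ℕ) : (spread w c).natAbs ≤ 1 := by
  unfold spread
  split_ifs
  · rcases Int.sign_trichotomy w with h | h | h <;> simp [h]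
  · simp

theorem nonzeroCount_mul_le (δ : ℝ) (k : ℤ) : nonzeroCount (δ * k) ≤ k.natAbs := by
  unfold nonzeroCount
  split_ifs with h
  · simp
  · have : k ≠ 0 := by rintro rfl; simp at h
    have := Int.natAbs_pos.2 this
    omega

section Reindex

variable {S H : Type}

/-- The block with one hidden layer, state units `S`, hidden units `H`, and parameters
`δ` times the given integers. -/
def twoLayerBlock (δ : ℝ) {n h : ℕ} (e : S ≃ Fin n) (f : H ≃ Fin h) (A₁ : H → S → ℤ)
    (b₁ : H → ℤ) (A₂ : S → H → ℤ) (b₂ : S → ℤ) : FFN n n :=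
  .layer (Matrix.of fun i j => δ * A₁ (f.symm i) (e.symm j)) (fun i => δ * b₁ (f.symm i))
    (.last (Matrix.of fun i j => δ * A₂ (e.symm i) (f.symm j)) (fun i => δ * b₂ (e.symm i)))

variable (δ : ℝ) {n h : ℕ} (e : S ≃ Fin n) (f : H ≃ Fin h) (A₁ : H → S → ℤ)
    (b₁ : H → ℤ) (A₂ : S → H → ℤ) (b₂ : S → ℤ)

theorem twoLayerBlock_eval [Fintype S] [Fintype H] (v : Fin n → ℝ) (s : S) :
    (twoLayerBlock δ e f A₁ b₁ A₂ b₂).eval v (e s) =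
      (∑ y, δ * A₂ s y * max ((∑ x, δ * A₁ y x * v (e x)) + δ * b₁ y) 0) + δ * b₂ s := by
  simp only [twoLayerBlock, FFN.eval, relu, Matrix.mulVec, dotProduct, Pi.add_apply,
    Equiv.symm_apply_apply, Matrix.of_apply]
  congr 1
  rw [← Equiv.sum_comp f]
  refine Finset.sum_congr rfl fun y _ => ?_
  rw [← Equiv.sum_comp e]
  simp

theorem twoLayerBlock_precision {M : ℝ} (hδ : 0 < δ) (hM : δ ≤ M)
    (h₁ : ∀ y x, (A₁ y x).natAbs ≤ 1) (h₂ : ∀ y, (b₁ y).natAbs ≤ 1)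
    (h₃ : ∀ x y, (A₂ x y).natAbs ≤ 1) (h₄ : ∀ x, (b₂ x).natAbs ≤ 1) :
    ∀ w ∈ (twoLayerBlock δ e f A₁ b₁ A₂ b₂).params, (∃ k : ℤ, w = δ * k) ∧ |w| ≤ M := by
  have key : ∀ k : ℤ, k.natAbs ≤ 1 → (∃ j : ℤ, δ * k = δ * j) ∧ |δ * k| ≤ M := by
    intro k hk
    refine ⟨⟨k, rfl⟩, ?_⟩
    rw [abs_mul, abs_of_pos hδ]
    have : |(k : ℝ)| ≤ 1 := by
      rw [← Int.cast_abs, Int.abs_eq_natAbs]; exact_mod_cast hk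
    nlinarith [abs_nonneg (k : ℝ)]
  intro w hw
  rcases Multiset.mem_add.1 hw with hw | hw
  · exact forall_mem_layerParams _ _ (fun w => (∃ j : ℤ, w = δ * j) ∧ |w| ≤ M)
      (fun i j => key _ (h₁ _ _)) (fun i => key _ (h₂ _)) w hw
  · exact forall_mem_layerParams _ _ (fun w => (∃ j : ℤ, w = δ * j) ∧ |w| ≤ M)
      (fun i j => key _ (h₃ _ _)) (fun i => key _ (h₄ _)) w hw

theorem twoLayerBlock_l0_le [Fintype S] [Fintype H] :
    ((twoLayerBlock δ e f A₁ b₁ A₂ b₂).params.map nonzeroCount).sum ≤ ((∑ y, ∑ x, (A₁ y x).natAbs) + ∑ y, (b₁ y).natAbs) +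
      ((∑ x, ∑ y, (A₂ x y).natAbs) + ∑ x, (b₂ x).natAbs) := by
  simp only [twoLayerBlock, FFN.params, Multiset.map_add, Multiset.sum_add, sum_map_layerParams, Matrix.of_apply]
  rw [← Equiv.sum_comp f, ← Equiv.sum_comp f, ← Equiv.sum_comp e (fun i => ∑ j, _),
    ← Equiv.sum_comp e (fun i => nonzeroCount _)]
  simp only [Equiv.symm_apply_apply]
  refine add_le_add (add_le_add (Finset.sum_le_sum fun y _ => ?_)
    (Finset.sum_le_sum fun y _ => nonzeroCount_mul_le _ _))
    (add_le_add (Finset.sum_le_sum fun x _ => ?_)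
    (Finset.sum_le_sum fun x _ => nonzeroCount_mul_le _ _))
  · rw [← Equiv.sum_comp e]
    simp only [Equiv.symm_apply_apply]
    exact Finset.sum_le_sum fun _ _ => nonzeroCount_mul_le _ _
  · rw [← Equiv.sum_comp f]
    simp only [Equiv.symm_apply_apply]
    exact Finset.sum_le_sum fun _ _ => nonzeroCount_mul_le _ _

end Reindex

/-- Three distinct elements of a finite type can be numbered `0`, `1`, `2`. -/
theorem exists_equiv_fin_three {S : Type} [Fintype S] [DecidableEq S] (s : Fin 3 → S)
    (hs : Function.Injective s) :
    ∃ (n : ℕ) (_ : 3 ≤ n) (e : S ≃ Fin n), ∀ i : Fin 3, (e (s i) : ℕ) = i := by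
  have hcard : 3 ≤ Fintype.card S := by simpa using Fintype.card_le_of_injective s hs
  let e₀ := Fintype.equivFin S
  let ι : Fin 3 → Fin (Fintype.card S) := fun i => ⟨i, by omega⟩
  have hι : Function.Injective ι := fun i j h => by simpa [ι, Fin.ext_iff] using h
  obtain ⟨σ, hσ⟩ := Equiv.Perm.exists_extending_pair (e₀ ∘ s) ι (e₀.injective.comp hs) hι
  exact ⟨_, hcard, e₀.trans σ, fun i => by simpa [ι] using congrArg Fin.val (hσ i)⟩

section Realization

variable {X Y : Type} (W₁ : Y → X → ℤ) (W₂ : X → Y → ℤ) (u₀ : X → ℤ) (mX : X → ℕ) (mY : Y → ℕ)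
  (m : ℕ)

/-- State units: `mX x` copies of each state variable `x` and `m` units that are constant from
time `1` on. -/
abbrev StateUnit (mX : X → ℕ) (m : ℕ) : Type := (Σ x, Fin (mX x)) ⊕ Fin m

/-- Hidden units: `mY y` copies of each hidden variable `y`, and the unit that fires at time `0`. -/
abbrev HiddenUnit (mY : Y → ℕ) : Type := (Σ y, Fin (mY y)) ⊕ Unit

/-- Weights of the first layer. -/
def copyWeights₁ : HiddenUnit mY → StateUnit mX m → ℤ
  | .inl y, .inl x => spread (W₁ y.1 x.1) x.2
  | .inl _, .inr _ => 0
  | .inr _, .inl _ => 0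
  | .inr _, .inr _ => -1

/-- Biases of the first layer. -/
def copyBias₁ : HiddenUnit mY → ℤ
  | .inl _ => 0
  | .inr _ => 1

/-- Weights of the second layer. -/
def copyWeights₂ : StateUnit mX m → HiddenUnit mY → ℤ
  | .inl x, .inl y => spread (W₂ x.1 y.1) y.2
  | .inl x, .inr _ => u₀ x.1
  | .inr _, _ => 0

/-- Biases of the second layer. -/
def copyBias₂ : StateUnit mX m → ℤ
  | .inl _ => 0
  | .inr _ => 1

variable [Fintype X] [Fintype Y]

/-- A homogeneous integer network can be run, up to the factor `δ ^ (2 * t)`, by a looped network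
with parameters in `{-δ, 0, δ}`, if every unit is replaced by sufficiently many copies. -/
theorem exists_net_traj [DecidableEq X] {δ M : ℝ} (hδ : 0 < δ) (hM : δ ≤ M)
    (h₁ : ∀ y x, (W₁ y x).natAbs ≤ mX x) (h₂ : ∀ x y, (W₂ x y).natAbs ≤ mY y)
    (h₀ : ∀ x, (u₀ x).natAbs ≤ 1) (hm : 1 ≤ m * δ) (ch : Fin 3 → X)
    (hch : Function.Injective ch) (hpos : ∀ i, 0 < mX (ch i)) :
    ∃ θ : LoopedNet, θ.HasPrecision δ M ∧
      θ.l0 ≤ (∑ y, mY y * ∑ x, (W₁ y x).natAbs) + (∑ x, mX x * ∑ y, (W₂ x y).natAbs) +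
        (∑ x, mX x * (u₀ x).natAbs) + (2 * m + 1) ∧
      ∀ t, θ.haltCh (t + 1) = δ ^ (2 * (t + 1)) * traj W₁ W₂ u₀ t (ch 0) ∧
        θ.emitCh (t + 1) = δ ^ (2 * (t + 1)) * traj W₁ W₂ u₀ t (ch 1) ∧
        θ.bitCh (t + 1) = δ ^ (2 * (t + 1)) * traj W₁ W₂ u₀ t (ch 2) := by
  let s : Fin 3 → StateUnit mX m := fun i => .inl ⟨ch i, ⟨0, hpos i⟩⟩
  have hs : Function.Injective s := by
    intro i j h
    simp only [s, Sum.inl.injEq, Sigma.mk.injEq] at h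
    exact hch h.1
  obtain ⟨n, hn, e, he⟩ := exists_equiv_fin_three s hs
  let f := Fintype.equivFin (HiddenUnit mY)
  let A₁ := copyWeights₁ W₁ mX mY m
  let A₂ := copyWeights₂ W₂ u₀ mX mY m
  let N : FFN n n := twoLayerBlock δ e f A₁ (copyBias₁ mY) A₂ (copyBias₂ mX m)
  -- Only the bias reaches these units, whatever the state is: they are 0 at time 0 and `δ` ever
  -- after.
  have hconst : ∀ v c, N.eval v (e (.inr c)) = δ := by
    intro v c
    simp [N, twoLayerBlock_eval, A₂, copyWeights₂, copyBias₂]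
  have hl : ∀ x v, N.eval v (e (.inl x)) = δ * (∑ y, (W₂ x.1 y : ℝ) *
      max (δ * ∑ x' : X, ∑ c : Fin (mX x'), (spread (W₁ y x') c : ℝ) * v (e (.inl ⟨x', c⟩))) 0) +
        δ * u₀ x.1 * max (δ - δ * ∑ c, v (e (.inr c))) 0 := by
    intro x v
    simp only [N, twoLayerBlock_eval, Fintype.sum_sum_type, A₁, A₂, copyWeights₁, copyWeights₂,
      copyBias₁, copyBias₂, Fintype.sum_sigma, Finset.univ_unique, Finset.sum_singleton]
    simp only [Int.cast_zero, mul_zero, zero_mul, Finset.sum_const_zero, add_zero, zero_add,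
      Int.cast_neg, Int.cast_one, mul_one, mul_neg, neg_mul, Finset.sum_neg_distrib]
    congr 1
    · rw [Finset.mul_sum]
      refine Finset.sum_congr rfl fun y _ => ?_
      rw [← Finset.sum_mul]
      have : ∑ c : Fin (mY y), δ * (spread (W₂ x.1 y) c : ℝ) = δ * W₂ x.1 y := by
        rw [← Finset.mul_sum, ← Int.cast_sum, sum_spread (h₂ _ _)]
      rw [this, mul_assoc]
      congr 3
      simp only [Finset.mul_sum, mul_assoc]
    · congr 2
      rw [Finset.mul_sum]
      ring
  -- The state at time `0` is zero, so the pulse unit fires and writes `δ ^ 2 * u₀`. From then on it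
  -- is silent and each iteration contributes one factor `δ` per layer.
  have key : ∀ (t : ℕ) x, N.eval^[t + 1] 0 (e (.inl x)) =
      δ ^ (2 * (t + 1)) * traj W₁ W₂ u₀ t x.1 := by
    intro t
    induction t with
    | zero =>
      intro x
      rw [zero_add, Function.iterate_one, hl]
      simp [traj, max_eq_left hδ.le]
      ring
    | succ t ih =>
      intro x
      rw [Function.iterate_succ_apply', hl]
      have hr : ∀ c, N.eval^[t + 1] 0 (e (.inr c)) = δ := fun c => by
        rw [Function.iterate_succ_apply']; exact hconst _ _
      -- The `m` constant units inhibit the pulse unit: its input is `δ - m δ ^ 2`, which is not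
      -- positive because `1 ≤ m * δ`.
      have hpi : max (δ - δ * ∑ c : Fin m, N.eval^[t + 1] 0 (e (.inr c))) 0 = 0 := by
        simp only [hr, Finset.sum_const, Finset.card_univ, Fintype.card_fin, nsmul_eq_mul]
        apply max_eq_right
        nlinarith
      -- All copies of a variable carry the same value, so the spread weights add up to the integer
      -- weight; the positive scale factor passes through the ReLU.
      have hin : ∀ y, max (δ * ∑ x' : X, ∑ c : Fin (mX x'), (spread (W₁ y x') c : ℝ) *
          N.eval^[t + 1] 0 (e (.inl ⟨x', c⟩))) 0 =
          δ * δ ^ (2 * (t + 1)) * hiddenVal W₁ (traj W₁ W₂ u₀ t) y := by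
        intro y
        rw [hiddenVal, mul_max_of_nonneg _ _ (by positivity), mul_zero, mul_assoc, Finset.mul_sum,
          Finset.mul_sum, Finset.mul_sum]
        congr 1
        refine Finset.sum_congr rfl fun x' _ => ?_
        simp only [ih]
        rw [← Finset.sum_mul, ← Int.cast_sum, sum_spread (h₁ _ _)]
        ring
      rw [hpi, mul_zero, add_zero]
      simp only [hin, traj, homStep]
      rw [Finset.mul_sum, Finset.mul_sum]
      refine Finset.sum_congr rfl fun y _ => ?_
      ring
  have hchan : ∀ (i : Fin 3) (h : (i : ℕ) < n) t,
      N.eval^[t + 1] 0 ⟨i, h⟩ = δ ^ (2 * (t + 1)) * traj W₁ W₂ u₀ t (ch i) := by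
    intro i h t
    rw [← key t ⟨ch i, ⟨0, hpos i⟩⟩]
    exact congrArg _ (Fin.ext (he i).symm)
  refine ⟨⟨n, hn, N⟩, ?_, ?_, fun t => ⟨hchan 0 _ t, hchan 1 _ t, hchan 2 _ t⟩⟩
  · refine twoLayerBlock_precision δ e f _ _ _ _ hδ hM ?_ ?_ ?_ ?_
    · rintro (y | y) (x | x) <;> simp [A₁, copyWeights₁, natAbs_spread_le]
    · rintro (y | y) <;> simp [copyBias₁]
    · rintro (x | x) (y | y) <;> simp [A₂, copyWeights₂, natAbs_spread_le, h₀]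
    · rintro (x | x) <;> simp [copyBias₂]
  · rw [LoopedNet.l0_eq]
    refine (twoLayerBlock_l0_le δ e f _ _ _ _).trans ?_
    simp only [Fintype.sum_sum_type, A₁, A₂, copyWeights₁, copyWeights₂, copyBias₁, copyBias₂,
      Fintype.sum_sigma, Finset.univ_unique, Finset.sum_singleton, Int.natAbs_zero,
      Finset.sum_const_zero, add_zero, zero_add, Int.natAbs_neg, Int.natAbs_one, Finset.sum_const,
      Finset.card_univ, Fintype.card_fin, smul_eq_mul, mul_one, Finset.sum_add_distrib, Finset.card_singleton, one_mul]
    have e₁ : ∑ y, mY y * ∑ x, ∑ c : Fin (mX x), (spread (W₁ y x) c).natAbs ≤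
        ∑ y, mY y * ∑ x, (W₁ y x).natAbs :=
      Finset.sum_le_sum fun y _ => Nat.mul_le_mul_left _
        (Finset.sum_le_sum fun x _ => sum_natAbs_spread _ _)
    have e₂ : ∑ x, mX x * ∑ y, ∑ c : Fin (mY y), (spread (W₂ x y) c).natAbs ≤
        ∑ x, mX x * ∑ y, (W₂ x y).natAbs :=
      Finset.sum_le_sum fun y _ => Nat.mul_le_mul_left _
        (Finset.sum_le_sum fun x _ => sum_natAbs_spread _ _)
    omega

end Realization

end LoopedReLU
end

/-! ### A homogeneous network that simulates a stack machine -/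

noncomputable section
namespace LoopedReLU
open Turing.PartrecToTM2

/-! ### Stacks as real numbers -/

/-- The digit of a stack symbol. -/
def symDigit : Γ' → ℕ
  | .bit0 => 1
  | .bit1 => 2
  | .cons => 3
  | .consₗ => 4

/-- The digit of the top of a stack, `0` for an empty stack. -/
def topDigit : Option Γ' → ℕ
  | none => 0
  | some a => symDigit a

theorem topDigit_injective : Function.Injective topDigit := by
  intro a b h
  rcases a with _ | (_ | _ | _ | _) <;> rcases b with _ | (_ | _ | _ | _) <;>
    simp_all [topDigit, symDigit]

theorem symDigit_bounds (a : Γ') : 1 ≤ symDigit a ∧ symDigit a ≤ 4 := by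
  cases a <;> simp [symDigit]

theorem topDigit_le (o : Option Γ') : topDigit o ≤ 4 := by
  cases o with
  | none => simp [topDigit]
  | some a => exact (symDigit_bounds a).2

/-- The contents of a stack as a decimal fraction with digits `2`, `4`, `6`, `8`. -/
def stackVal : List Γ' → ℝ
  | [] => 0
  | a :: l => (2 * symDigit a + stackVal l) / 10

theorem stackVal_nonneg (l : List Γ') : 0 ≤ stackVal l := by
  induction l with
  | nil => exact le_rfl
  | cons a l ih => simp only [stackVal]; positivity

/-- A digit of at most 8 and a remainder of at most 1 stay below 10. Since digits are two apart, a
remainder of at most one leaves a gap of length one between different top digits, which is what the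
thresholds use. -/
theorem stackVal_le_one (l : List Γ') : stackVal l ≤ 1 := by
  induction l with
  | nil => simp [stackVal]
  | cons a l ih =>
    have : (symDigit a : ℝ) ≤ 4 := by exact_mod_cast (symDigit_bounds a).2
    simp only [stackVal]; linarith

theorem ten_mul_stackVal (l : List Γ') :
    10 * stackVal l = 2 * topDigit l.head? + stackVal l.tail := by
  cases l with
  | nil => simp [stackVal, topDigit]
  | cons a l => simp [stackVal, topDigit]; ring

/-- The digit on top of a stack is read off by thresholds. -/
theorem threshold_stackVal (l : List Γ') (m : ℕ) :
    max (10 * stackVal l - (2 * m + 1)) 0 - max (10 * stackVal l - (2 * m + 2)) 0 =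
      if m + 1 ≤ topDigit l.head? then 1 else 0 := by
  have h1 := ten_mul_stackVal l
  have h2 := stackVal_nonneg l.tail
  have h3 := stackVal_le_one l.tail
  split_ifs with h
  · have h' : (m : ℝ) + 1 ≤ topDigit l.head? := by exact_mod_cast h
    rw [max_eq_left (by linarith), max_eq_left (by linarith)]; ring
  · have h' : (topDigit l.head? : ℝ) ≤ m := by exact_mod_cast (by omega)
    rw [max_eq_right (by linarith), max_eq_right (by linarith)]; ring

/-! ### The fixed part of the simulating network -/

/-- State variables of the simulating network, without the chain that holds the program. -/
inductive SimVar (Q : Type)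
  | ref | load | timer | fin | act
  | kind (j : Bool × Bool × Bool)
  | st (q : Q)
  | stk (k : K')
  | out (i : Fin 3)
  deriving DecidableEq

/-- Hidden variables of the simulating network, without chain and collectors. -/
inductive SimHid (Q : Type)
  | ref | load | timer | start | fin | act
  | kind (j : Bool × Bool × Bool)
  | st (q : Q)
  | stk (k : K')
  | gate (q : Q) (k : K')
  | thr (q : Q) (d : Fin 4) (b : Bool)
  deriving DecidableEq

instance : Fintype K' where
  elems := {.main, .rev, .aux, .stack}
  complete k := by cases k <;> simp

instance (Q : Type) [Fintype Q] [DecidableEq Q] : Fintype (SimVar Q) :=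
  Fintype.ofSurjective (fun x : Fin 5 ⊕ (Bool × Bool × Bool) ⊕ Q ⊕ K' ⊕ Fin 3 => match x with
    | .inl 0 => .ref
    | .inl 1 => .load
    | .inl 2 => .timer
    | .inl 3 => .fin
    | .inl 4 => .act
    | .inr (.inl j) => .kind j
    | .inr (.inr (.inl q)) => .st q
    | .inr (.inr (.inr (.inl k))) => .stk k
    | .inr (.inr (.inr (.inr i))) => .out i) (fun v => match v with
    | .ref => ⟨.inl 0, rfl⟩
    | .load => ⟨.inl 1, rfl⟩
    | .timer => ⟨.inl 2, rfl⟩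
    | .fin => ⟨.inl 3, rfl⟩
    | .act => ⟨.inl 4, rfl⟩
    | .kind j => ⟨.inr (.inl j), rfl⟩
    | .st q => ⟨.inr (.inr (.inl q)), rfl⟩
    | .stk k => ⟨.inr (.inr (.inr (.inl k))), rfl⟩
    | .out i => ⟨.inr (.inr (.inr (.inr i))), rfl⟩)

instance (Q : Type) [Fintype Q] [DecidableEq Q] : Fintype (SimHid Q) :=
  Fintype.ofSurjective (fun x : Fin 6 ⊕ (Bool × Bool × Bool) ⊕ Q ⊕ K' ⊕ (Q × K') ⊕
      (Q × Fin 4 × Bool) => match x with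
    | .inl 0 => .ref
    | .inl 1 => .load
    | .inl 2 => .timer
    | .inl 3 => .start
    | .inl 4 => .fin
    | .inl 5 => .act
    | .inr (.inl j) => .kind j
    | .inr (.inr (.inl q)) => .st q
    | .inr (.inr (.inr (.inl k))) => .stk k
    | .inr (.inr (.inr (.inr (.inl x)))) => .gate x.1 x.2
    | .inr (.inr (.inr (.inr (.inr x)))) => .thr x.1 x.2.1 x.2.2) (fun v => match v with
    | .ref => ⟨.inl 0, rfl⟩
    | .load => ⟨.inl 1, rfl⟩
    | .timer => ⟨.inl 2, rfl⟩
    | .start => ⟨.inl 3, rfl⟩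
    | .fin => ⟨.inl 4, rfl⟩
    | .act => ⟨.inl 5, rfl⟩
    | .kind j => ⟨.inr (.inl j), rfl⟩
    | .st q => ⟨.inr (.inr (.inl q)), rfl⟩
    | .stk k => ⟨.inr (.inr (.inr (.inl k))), rfl⟩
    | .gate q k => ⟨.inr (.inr (.inr (.inr (.inl (q, k))))), rfl⟩
    | .thr q d b => ⟨.inr (.inr (.inr (.inr (.inr (q, d, b))))), rfl⟩)

/-- Three bits as decimal digits, scaled by `1000`. -/
def tripleVal (j : Bool × Bool × Bool) : ℤ :=
  -- The triple of link `i` reaches the stack at time `i + 2`, when the scale is `1000 ^ (i + 2)`,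
  -- but its digits belong at relative size `1000 ^ (-(i + 1))`. The outer factor 1000 makes up for
  -- this delay.
  1000 * (200 * symDigit (bitSym j.1) + 20 * symDigit (bitSym j.2.1) +
    2 * symDigit (bitSym j.2.2))

section Forms

variable {Q : Type} [Fintype Q] [DecidableEq Q] (M : Q → Instr K' Γ' Q) (q₀ : Q)

open Finsupp (single)

/-- The stack read by a state. -/
def readStack (q : Q) : K' :=
  match M q with
  | .emit _ _ => K'.main
  | .halt => K'.main
  | .push k _ _ => k
  | .pop k _ => k
  | .peek k _ => k

/-- The weights of the hidden variables. -/
def hidForm : SimHid Q → SimVar Q →₀ ℤ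
  | .ref => single SimVar.ref 1
  | .load => single SimVar.load 1
  | .timer => single SimVar.timer 1
  -- As long as `10 * timer ≤ ref` this is negative; when the timer equals the reference the value
  -- is exactly that of `ref`.
  | .start => single SimVar.timer 10 - single SimVar.ref 9
  | .fin => single SimVar.fin 1
  | .act => single SimVar.act 1
  | .kind j => single (SimVar.kind j) 1
  | .st q => single (SimVar.st q) 1
  | .stk k => single (SimVar.stk k) 1
  -- Product of a stack value with a control bit: at scale `R` this is `Rσ` in state `q`, and `Rσ -
  -- R ≤ 0` in any other state because `σ ≤ 1`.
  | .gate q k => single (SimVar.stk k) 1 - single SimVar.ref 1 + single (SimVar.st q) 1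
  -- The same gating with weight 10, silenced outside `q` by `10σ ≤ 10`. The bit `b` selects between
  -- the two thresholds `2d + 1` and `2d + 2` of `threshold_stackVal`.
  | .thr q d b => single (SimVar.stk (readStack M q)) 10 - single SimVar.ref (2 * (d : ℕ) + 1 + b.toNat + 10 : ℤ) +
      single (SimVar.st q) 10

/-- The form with value `1` if the machine is in state `q` and the digit on top of the stack that
`q` reads is at least `m`. -/
def topForm (q : Q) : ℕ → SimHid Q →₀ ℤ
  | 0 => single (SimHid.st q) 1
  -- No digit reaches level 5, so the form is zero there; the difference in `transForm` at digit 4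
  -- relies on this.
  | m + 1 => if h : m < 4 then single (SimHid.thr q ⟨m, h⟩ false) 1 - single (SimHid.thr q ⟨m, h⟩ true) 1 else 0

/-- The form with value `1` if the machine goes from state `q` to state `q'`. -/
def transForm (q q' : Q) : SimHid Q →₀ ℤ :=
  match M q with
  | .push _ _ p => if p = q' then single (SimHid.st q) 1 else 0
  -- The top digit equals `d` if it is at least `d` and not at least `d + 1`.
  | .pop _ f => ∑ o, if f o = q' then topForm q (topDigit o) - topForm q (topDigit o + 1) else 0
  | .peek _ f => ∑ o, if f o = q' then topForm q (topDigit o) - topForm q (topDigit o + 1) else 0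
  | .emit _ p => if p = q' then single (SimHid.st q) 1 else 0
  | .halt => 0

/-- The change of stack `k` in state `q`, scaled by `1000`. -/
def stackForm (q : Q) (k : K') : SimHid Q →₀ ℤ :=
  match M q with
  -- `1000 (2a + σ) / 10 = 1000 σ + (200 a - 900 σ)`; the term `1000 σ` is in `varForm`.
  | .push k' a _ => if k' = k then
      single (SimHid.st q) (200 * symDigit a : ℤ) - single (SimHid.gate q k) 900 else 0
  -- `1000 (10 σ - 2d) = 1000 σ + (9000 σ - 2000 d)`, where the top digit `d` is the number of
  -- levels `1, …, 4` that it reaches.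
  | .pop k' _ => if k' = k then
      single (SimHid.gate q k) 9000 - ∑ m ∈ Finset.range 4, (2000 : ℤ) • topForm q (m + 1) else 0
  | .peek _ _ => 0
  | .emit _ _ => 0
  | .halt => 0

/-- The forms of the three channels. -/
def outForm (q : Q) (i : Fin 3) : SimHid Q →₀ ℤ :=
  match M q with
  | .emit b _ => if i = 1 ∨ (i = 2 ∧ b = true) then single (SimHid.st q) 1 else 0
  | .halt => if i = 0 then single (SimHid.st q) 1 else 0
  | _ => 0

/-- The weights of the state variables. -/
def varForm : SimVar Q → SimHid Q →₀ ℤ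
  | .ref => single SimHid.ref 1000
  | .load => single SimHid.load 1
  -- Set to 1 through `fin` after the pulse has left the chain, and cleared by `start` at the moment
  -- it equals the reference.
  | .timer => single SimHid.timer 10000 - single SimHid.start 10000 + single SimHid.fin 1
  | .fin => 0
  | .act => single SimHid.load 1
  | .kind _ => 0
  | .st q' => (1000 : ℤ) • (∑ q, transForm M q q') + if q' = q₀ then single SimHid.start 1000 else 0
  | .stk k => single (SimHid.stk k) 1000 + (∑ q, stackForm M q k) +
      -- During loading `act` adds the all-zero triple at every step and `kind j` adds the
      -- correction, so a link with the all-zero triple needs no collector edge. The unit `fin` adds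
      -- the terminator.
      if k = K'.main then single SimHid.act (tripleVal (false, false, false)) +
        (∑ j, single (SimHid.kind j) (tripleVal j - tripleVal (false, false, false))) +
        single SimHid.fin (1000 * (200 * symDigit .cons) : ℤ) else 0
  | .out i => ∑ q, outForm M q i

end Forms

/-! ### The network with its program chain -/

section Network

variable {Q : Type} [Fintype Q] [DecidableEq Q] (M : Q → Instr K' Γ' Q) (q₀ : Q)
  (T : ℕ) (bits : ℕ → Bool × Bool × Bool)

/-- State variables including the chain. -/
abbrev FullVar (Q : Type) (T : ℕ) : Type := SimVar Q ⊕ Fin (T + 1)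

/-- Hidden variables including collectors and chain. -/
abbrev FullHid (Q : Type) (T : ℕ) : Type := SimHid Q ⊕ (Bool × Bool × Bool) ⊕ Fin (T + 1)

/-- Weights of the first layer. -/
def fullW₁ : FullHid Q T → FullVar Q T → ℤ
  | .inl h, .inl v => hidForm M h v
  -- The pulse at the end of the chain switches `load` off.
  | .inl h, .inr i => if h = .load ∧ i = Fin.last T then -1 else 0
  | .inr _, .inl _ => 0
  | .inr (.inl j), .inr i => if i.1 < T ∧ bits i = j ∧ j ≠ (false, false, false) then 1 else 0
  | .inr (.inr i'), .inr i => if i' = i then 1 else 0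

/-- Weights of the second layer. -/
def fullW₂ : FullVar Q T → FullHid Q T → ℤ
  | .inl v, .inl h => varForm M q₀ v h
  | .inl v, .inr (.inl j) => if v = .kind j then 1 else 0
  | .inl v, .inr (.inr i) => if v = .fin ∧ i = Fin.last T then 1 else 0
  | .inr _, .inl _ => 0
  | .inr _, .inr (.inl _) => 0
  | .inr i, .inr (.inr i') => if i'.1 + 1 = i.1 then 1 else 0

/-- The initial values. -/
def fullInit : FullVar Q T → ℤ
  | .inl v => if v = .ref ∨ v = .load then 1 else 0
  | .inr i => if i.1 = 0 then 1 else 0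

/-- The trajectory of the simulating network. -/
def simTraj : ℕ → FullVar Q T → ℝ := traj (fullW₁ M T bits) (fullW₂ M q₀ T) (fullInit T)

end Network
end LoopedReLU
end

noncomputable section
namespace LoopedReLU
open Turing.PartrecToTM2

/-! ### One iteration of the simulating network -/

section Step

variable {Q : Type} [Fintype Q] [DecidableEq Q] (M : Q → Instr K' Γ' Q) (q₀ : Q)
  (T : ℕ) (bits : ℕ → Bool × Bool × Bool)

/-- The value of an integer linear form. -/
abbrev formVal {α : Type} (u : α → ℝ) : (α →₀ ℤ) →ₗ[ℤ] ℝ := Finsupp.linearCombination ℤ u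

theorem formVal_eq_sum {α : Type} [Fintype α] (u : α → ℝ) (f : α →₀ ℤ) :
    formVal u f = ∑ a, (f a : ℝ) * u a := by
  rw [Finsupp.linearCombination_apply, Finsupp.sum_fintype _ _ (by simp)]
  simp

/-- The hidden values of the simulating network. -/
def simHid (u : FullVar Q T → ℝ) : FullHid Q T → ℝ := hiddenVal (fullW₁ M T bits) u

variable {T} (u : FullVar Q T → ℝ)

theorem simHid_inl (h : SimHid Q) : simHid M T bits u (.inl h) =
    max (formVal (fun v => u (.inl v)) (hidForm M h) +
      if h = .load then -u (.inr (Fin.last T)) else 0) 0 := by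
  rw [simHid, hiddenVal, Fintype.sum_sum_type, formVal_eq_sum]
  congr 2
  by_cases hh : h = .load <;> simp [fullW₁, hh]

theorem simHid_collector (j : Bool × Bool × Bool) : simHid M T bits u (.inr (.inl j)) =
    max (∑ i : Fin (T + 1), if i.1 < T ∧ bits i = j ∧ j ≠ (false, false, false) then
      u (.inr i) else 0) 0 := by
  rw [simHid, hiddenVal, Fintype.sum_sum_type]
  simp [fullW₁]

theorem simHid_chain (i : Fin (T + 1)) :
    simHid M T bits u (.inr (.inr i)) = max (u (.inr i)) 0 := by
  rw [simHid, hiddenVal, Fintype.sum_sum_type]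
  simp [fullW₁]

/-- One iteration of the simulating network. -/
def simStep (u : FullVar Q T → ℝ) : FullVar Q T → ℝ :=
  homStep (fullW₁ M T bits) (fullW₂ M q₀ T) u

theorem simStep_inl (v : SimVar Q) : simStep M q₀ bits u (.inl v) =
    formVal (fun h => simHid M T bits u (.inl h)) (varForm M q₀ v) +
      ((∑ j, if v = .kind j then simHid M T bits u (.inr (.inl j)) else 0) +
        if v = .fin then simHid M T bits u (.inr (.inr (Fin.last T))) else 0) := by
  rw [simStep, homStep, Fintype.sum_sum_type, Fintype.sum_sum_type, formVal_eq_sum]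
  congr 2
  · simp [fullW₂, simHid]
  · by_cases hv : v = .fin <;> simp [fullW₂, simHid, hv]

theorem simStep_chain_zero (i : Fin (T + 1)) (hi : i.1 = 0) :
    simStep M q₀ bits u (.inr i) = 0 := by
  rw [simStep, homStep, Fintype.sum_sum_type, Fintype.sum_sum_type]
  simp [fullW₂, hi]

theorem simStep_chain_succ (i : Fin (T + 1)) (i' : Fin (T + 1)) (hi : i'.1 + 1 = i.1) :
    simStep M q₀ bits u (.inr i) = max (u (.inr i')) 0 := by
  rw [simStep, homStep, Fintype.sum_sum_type, Fintype.sum_sum_type]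
  rw [← simHid_chain M bits u i']
  have : ∀ k : Fin (T + 1), (k.1 + 1 = i.1) = (k = i') := by
    intro k
    rw [eq_iff_iff, Fin.ext_iff]
    omega
  simp [fullW₂, simHid, this]

/-- The state `u` describes, at scale `R`, stacks with values `σ` and the control state `qo`. -/
structure Control (u : FullVar Q T → ℝ) (R : ℝ) (qo : Option Q) (σ : K' → ℝ) : Prop where
  pos : 0 < R
  ref : u (.inl .ref) = R
  st : ∀ q, u (.inl (.st q)) = if qo = some q then R else 0
  stk : ∀ k, u (.inl (.stk k)) = R * σ k
  nonneg : ∀ k, 0 ≤ σ k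
  le_one : ∀ k, σ k ≤ 1

variable {M bits u} {R : ℝ} {qo : Option Q} {σ : K' → ℝ}

theorem Control.hid_ref (H : Control u R qo σ) : simHid M T bits u (.inl .ref) = R := by
  simp [simHid_inl, hidForm, H.ref, H.pos.le]

theorem Control.hid_st (H : Control u R qo σ) (q : Q) :
    simHid M T bits u (.inl (.st q)) = if qo = some q then R else 0 := by
  simp only [simHid_inl, hidForm, Finsupp.linearCombination_single, one_smul, H.st, reduceCtorEq,
    if_false, add_zero]
  split_ifs
  · exact max_eq_left H.pos.le
  · exact max_self _

theorem Control.hid_stk (H : Control u R qo σ) (k : K') :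
    simHid M T bits u (.inl (.stk k)) = R * σ k := by
  simp [simHid_inl, hidForm, H.stk, mul_nonneg H.pos.le (H.nonneg k)]

theorem Control.hid_gate (H : Control u R qo σ) (q : Q) (k : K') :
    simHid M T bits u (.inl (.gate q k)) = if qo = some q then R * σ k else 0 := by
  simp only [simHid_inl, hidForm, Finsupp.linearCombination_single, one_smul, H.st, H.stk, H.ref,
    reduceCtorEq, if_false, add_zero, map_add, map_sub]
  have h1 := mul_nonneg H.pos.le (H.nonneg k)
  have h2 := mul_le_mul_of_nonneg_left (H.le_one k) H.pos.le
  split_ifs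
  · rw [max_eq_left (by linarith)]; ring
  · rw [max_eq_right (by linarith)]

theorem Control.hid_thr (H : Control u R qo σ) (q : Q) (d : Fin 4) (b : Bool) :
    simHid M T bits u (.inl (.thr q d b)) = if qo = some q then
      R * max (10 * σ (readStack M q) - (2 * (d : ℕ) + 1 + b.toNat)) 0 else 0 := by
  have h2 := mul_le_mul_of_nonneg_left (H.le_one (readStack M q)) H.pos.le
  simp only [simHid_inl, hidForm, Finsupp.linearCombination_single, H.st, H.stk, H.ref,
    reduceCtorEq, if_false, add_zero, map_add, map_sub, zsmul_eq_mul]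
  push_cast
  split_ifs
  · rw [mul_max_of_nonneg _ _ H.pos.le, mul_zero]
    congr 1
    ring
  · rw [max_eq_right]
    have : 0 ≤ (2 * ((d : ℕ) : ℝ) + 1 + (b.toNat : ℝ)) * R := by have := H.pos; positivity
    linarith

theorem Control.top_inactive (H : Control u R qo σ) {q : Q} (hq : qo ≠ some q) (m : ℕ) :
    formVal (fun h => simHid M T bits u (.inl h)) (topForm q m) = 0 := by
  cases m with
  | zero => simp [topForm, H.hid_st, hq]
  | succ m =>
    rw [topForm]
    split_ifs
    · simp [H.hid_thr, hq]
    · simp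

/-- `threshold_stackVal`, multiplied by the scale `R`. -/
theorem Control.top_active {q : Q} (H : Control u R (some q) σ) {l : List Γ'}
    (hl : σ (readStack M q) = stackVal l) (m : ℕ) :
    formVal (fun h => simHid M T bits u (.inl h)) (topForm q m) =
      if m ≤ topDigit l.head? then R else 0 := by
  cases m with
  | zero => simp [topForm, H.hid_st]
  | succ m =>
    rw [topForm]
    have hle := topDigit_le l.head?
    split_ifs with h1 h2 h2
    · have := threshold_stackVal l m
      rw [if_pos h2] at this
      simp only [map_sub, Finsupp.linearCombination_single, one_smul, H.hid_thr, if_true, hl]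
      simp only [Bool.toNat_false, Bool.toNat_true, Nat.cast_zero, Nat.cast_one, add_zero]
      rw [← mul_sub, show (2 * (m : ℝ) + 1 + 1) = 2 * m + 2 by ring, this, mul_one]
    · have := threshold_stackVal l m
      rw [if_neg h2] at this
      simp only [map_sub, Finsupp.linearCombination_single, one_smul, H.hid_thr, if_true, hl]
      simp only [Bool.toNat_false, Bool.toNat_true, Nat.cast_zero, Nat.cast_one, add_zero]
      rw [← mul_sub, show (2 * (m : ℝ) + 1 + 1) = 2 * m + 2 by ring, this, mul_zero]
    · omega
    · simp

theorem Control.trans_inactive (H : Control u R qo σ) {q : Q} (hq : qo ≠ some q) (q' : Q) :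
    formVal (fun h => simHid M T bits u (.inl h)) (transForm M q q') = 0 := by
  unfold transForm
  have : ∀ o : Option Γ', ∀ p : Prop, [Decidable p] → formVal (fun h => simHid M T bits u (.inl h))
      (if p then topForm q (topDigit o) - topForm q (topDigit o + 1) else 0) = 0 := by
    intro o p _
    split_ifs
    · rw [map_sub, H.top_inactive hq, H.top_inactive hq, sub_zero]
    · simp
  cases M q with
  | push k a p => simp only; split_ifs <;> simp [H.hid_st, hq]
  | pop k f => simp only [map_sum]; exact Finset.sum_eq_zero fun o _ => this o _
  | peek k f => simp only [map_sum]; exact Finset.sum_eq_zero fun o _ => this o _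
  | emit b p => simp only; split_ifs <;> simp [H.hid_st, hq]
  | halt => simp

theorem Control.stack_inactive (H : Control u R qo σ) {q : Q} (hq : qo ≠ some q) (k : K') :
    formVal (fun h => simHid M T bits u (.inl h)) (stackForm M q k) = 0 := by
  unfold stackForm
  cases M q with
  | push k' a p =>
    simp only
    split_ifs
    · simp only [map_sub, Finsupp.linearCombination_single, H.hid_st, H.hid_gate, hq, if_false,
        smul_zero, sub_zero]
    · simp
  | pop k' f =>
    simp only
    split_ifs
    · simp only [map_sub, map_sum, map_smul, H.top_inactive hq]
      simp [H.hid_gate, hq]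
    · simp
  | peek k f => simp
  | emit b p => simp
  | halt => simp

theorem Control.out_inactive (H : Control u R qo σ) {q : Q} (hq : qo ≠ some q) (i : Fin 3) :
    formVal (fun h => simHid M T bits u (.inl h)) (outForm M q i) = 0 := by
  unfold outForm
  cases M q with
  | push k' a p => simp
  | pop k' f => simp
  | peek k f => simp
  | emit b p => simp only; split_ifs <;> simp [H.hid_st, hq]
  | halt => simp only; split_ifs <;> simp [H.hid_st, hq]

/-- Sums over all control states reduce to the active state. -/
theorem sum_active {Q : Type} [Fintype Q] (g : Q → ℝ) (qo : Option Q) (hg : ∀ q, qo ≠ some q → g q = 0) :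
    ∑ q, g q = qo.elim 0 g := by
  cases qo with
  | none => exact Finset.sum_eq_zero fun q _ => hg q (by simp)
  | some q =>
    exact Finset.sum_eq_single_of_mem q (Finset.mem_univ _) fun p _ hp => hg p (by simpa using hp.symm)

theorem Control.step_ref (H : Control u R qo σ) :
    simStep M q₀ bits u (.inl .ref) = 1000 * R := by
  simp [simStep_inl, varForm, H.hid_ref]

theorem Control.step_st (H : Control u R qo σ) (q' : Q) :
    simStep M q₀ bits u (.inl (.st q')) = 1000 * qo.elim 0 (fun q =>
      formVal (fun h => simHid M T bits u (.inl h)) (transForm M q q')) +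
      if q' = q₀ then 1000 * simHid M T bits u (.inl .start) else 0 := by
  rw [simStep_inl, varForm, map_add, map_smul, map_sum,
    sum_active _ qo fun q hq => H.trans_inactive hq q']
  simp only [reduceCtorEq, if_false, Finset.sum_const_zero, add_zero]
  split_ifs <;> simp

theorem Control.step_stk (H : Control u R qo σ) (k : K') :
    simStep M q₀ bits u (.inl (.stk k)) = 1000 * R * σ k + qo.elim 0 (fun q =>
      formVal (fun h => simHid M T bits u (.inl h)) (stackForm M q k)) +
      if k = K'.main then tripleVal (false, false, false) * simHid M T bits u (.inl .act) +
        (∑ j, ((tripleVal j - tripleVal (false, false, false) : ℤ) : ℝ) *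
          simHid M T bits u (.inl (.kind j))) + 600000 * simHid M T bits u (.inl .fin) else 0 := by
  rw [simStep_inl, varForm, map_add, map_add, map_sum,
    sum_active _ qo fun q hq => H.stack_inactive hq k]
  have h6 : (1000 * (200 * (symDigit Γ'.cons : ℤ)) : ℤ) = 600000 := by simp [symDigit]
  rw [h6]
  simp only [reduceCtorEq, if_false, Finset.sum_const_zero, add_zero]
  split_ifs
  · simp only [map_add, map_sum, Finsupp.linearCombination_single, zsmul_eq_mul, H.hid_stk]
    push_cast
    ring
  · simp only [map_zero, Finsupp.linearCombination_single, zsmul_eq_mul, H.hid_stk]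
    push_cast
    ring

theorem Control.step_out (H : Control u R qo σ) (i : Fin 3) :
    simStep M q₀ bits u (.inl (.out i)) = qo.elim 0 (fun q =>
      formVal (fun h => simHid M T bits u (.inl h)) (outForm M q i)) := by
  rw [simStep_inl, varForm, map_sum, sum_active _ qo fun q hq => H.out_inactive hq i]
  simp

/-- The loading units and the chain are silent. -/
structure Quiet (u : FullVar Q T → ℝ) : Prop where
  load : u (.inl .load) = 0
  timer : u (.inl .timer) = 0
  fin : u (.inl .fin) = 0
  act : u (.inl .act) = 0
  kind : ∀ j, u (.inl (.kind j)) = 0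
  chain : ∀ i, u (.inr i) = 0

/-- With the timer at zero the form is `-9R`. -/
theorem Quiet.start (hq : Quiet u) (H : Control u R qo σ) :
    simHid M T bits u (.inl .start) = 0 := by
  simp only [simHid_inl, hidForm, map_sub, Finsupp.linearCombination_single, hq.timer, H.ref,
    reduceCtorEq, if_false, smul_zero, zsmul_eq_mul, add_zero, zero_sub]
  exact max_eq_right (by have := H.pos; push_cast; linarith)

/-- Once loading is over, the loading units stay at zero and never interfere with the simulation. -/
theorem Quiet.step (hq : Quiet u) (H : Control u R qo σ) : Quiet (simStep M q₀ bits u) where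
  load := by simp [simStep_inl, varForm, simHid_inl, hidForm, hq.load, hq.chain]
  timer := by
    have h1 := hq.start (M := M) (bits := bits) H
    simp only [simStep_inl, varForm, map_sub, map_add, Finsupp.linearCombination_single, h1]
    simp [simHid_inl, hidForm, hq.timer, hq.fin]
  fin := by simp [simStep_inl, varForm, simHid_chain, hq.chain]
  act := by simp [simStep_inl, varForm, simHid_inl, hidForm, hq.load, hq.chain]
  kind j := by simp [simStep_inl, varForm, simHid_collector, hq.chain]
  chain i := by
    by_cases hi : i.1 = 0
    · exact simStep_chain_zero _ _ _ _ i hi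
    · rw [simStep_chain_succ _ _ _ _ i ⟨i.1 - 1, by omega⟩ (by simp; omega), hq.chain, max_self]

/-- The state `u` describes the machine in state `q` with stack contents `S`. -/
structure Running (u : FullVar Q T → ℝ) (R : ℝ) (q : Q) (S : K' → List Γ') : Prop where
  control : Control u R (some q) (fun k => stackVal (S k))
  quiet : Quiet u

variable {q : Q} {S : K' → List Γ'}

/-- Reduces each kind of instruction to two identities between linear forms, one for the control
state and one for the stacks; the loading terms vanish by quietness. -/
theorem Running.of_step (H : Running u R q S) {q' : Q} {S' : K' → List Γ'}
    (hst : ∀ p, formVal (fun h => simHid M T bits u (.inl h)) (transForm M q p) =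
      if q' = p then R else 0)
    (hstk : ∀ k, formVal (fun h => simHid M T bits u (.inl h)) (stackForm M q k) =
      1000 * R * (stackVal (S' k) - stackVal (S k))) :
    Running (simStep M q₀ bits u) (1000 * R) q' S' where
  control :=
    { pos := by have := H.control.pos; positivity
      ref := H.control.step_ref q₀
      st := fun p => by
        rw [H.control.step_st, Option.elim_some, hst, H.quiet.start H.control]
        simp
      stk := fun k => by
        have ha : simHid M T bits u (.inl .act) = 0 := by simp [simHid_inl, hidForm, H.quiet.act]
        have hf : simHid M T bits u (.inl .fin) = 0 := by simp [simHid_inl, hidForm, H.quiet.fin]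
        have hk : ∀ j, simHid M T bits u (.inl (.kind j)) = 0 := fun j => by
          simp [simHid_inl, hidForm, H.quiet.kind]
        rw [H.control.step_stk, Option.elim_some, hstk, ha, hf]
        simp only [hk, mul_zero, Finset.sum_const_zero, add_zero, ite_self]
        ring
      nonneg := fun k => stackVal_nonneg _
      le_one := fun k => stackVal_le_one _ }
  quiet := H.quiet.step q₀ H.control

/-- The differences of consecutive levels are `R` times the indicators of the possible tops, so
exactly one summand survives. -/
theorem Running.trans_read (H : Running u R q S) {l : List Γ'} (hl : S (readStack M q) = l)
    (f : Option Γ' → Q) (p : Q) :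
    formVal (fun h => simHid M T bits u (.inl h)) (∑ o, if f o = p then
      topForm q (topDigit o) - topForm q (topDigit o + 1) else 0) =
        if f l.head? = p then R else 0 := by
  have key : ∀ o, formVal (fun h => simHid M T bits u (.inl h))
      (topForm q (topDigit o) - topForm q (topDigit o + 1)) = if o = l.head? then R else 0 := by
    intro o
    rw [map_sub, H.control.top_active (l := l) (by rw [hl]),
      H.control.top_active (l := l) (by rw [hl])]
    by_cases ho : o = l.head?
    · subst ho; simp
    · have : topDigit o ≠ topDigit l.head? := fun h => ho (topDigit_injective h)
      rw [if_neg ho]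
      split_ifs <;> first | omega | simp
  rw [map_sum]
  have : ∀ o, formVal (fun h => simHid M T bits u (.inl h)) (if f o = p then
      topForm q (topDigit o) - topForm q (topDigit o + 1) else 0) =
      if o = l.head? then (if f l.head? = p then R else 0) else 0 := by
    intro o
    by_cases hp : f o = p
    · rw [if_pos hp, key]
      by_cases ho : o = l.head?
      · rw [if_pos ho, if_pos ho, ← ho, if_pos hp]
      · rw [if_neg ho, if_neg ho]
    · rw [if_neg hp, map_zero]
      by_cases ho : o = l.head?
      · rw [if_pos ho, ← ho, if_neg hp]
      · rw [if_neg ho]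
  simp only [this]
  simp

theorem Running.push (H : Running u R q S) {k : K'} {a : Γ'} {q' : Q} (h : M q = .push k a q') :
    Running (simStep M q₀ bits u) (1000 * R) q' (Function.update S k (a :: S k)) := by
  refine H.of_step q₀ (fun p => ?_) (fun k' => ?_)
  · simp only [transForm, h]
    split_ifs <;> simp [H.control.hid_st]
  · simp only [stackForm, h]
    by_cases hk : k = k'
    · subst hk
      simp only [if_true, map_sub, Finsupp.linearCombination_single, zsmul_eq_mul,
        H.control.hid_st, H.control.hid_gate, Function.update_self, stackVal]
      push_cast
      ring
    · simp [hk, Function.update_of_ne (Ne.symm hk)]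

theorem Running.pop (H : Running u R q S) {k : K'} {f : Option Γ' → Q} (h : M q = .pop k f) :
    Running (simStep M q₀ bits u) (1000 * R) (f (S k).head?)
      (Function.update S k (S k).tail) := by
  have hr : readStack M q = k := by simp [readStack, h]
  refine H.of_step q₀ (fun p => ?_) (fun k' => ?_)
  · simp only [transForm, h]
    exact H.trans_read (by rw [hr]) f p
  · simp only [stackForm, h]
    by_cases hk : k = k'
    · subst hk
      have h10 := ten_mul_stackVal (S k)
      simp only [if_true, map_sub, map_sum, map_smul, Finsupp.linearCombination_single,
        zsmul_eq_mul, H.control.hid_gate, Function.update_self]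
      have htop : ∀ m, formVal (fun h => simHid M T bits u (.inl h)) (topForm q m) =
          if m ≤ topDigit (S k).head? then R else 0 :=
        H.control.top_active (by rw [hr])
      have hsum : ∑ m ∈ Finset.range 4, ((2000 : ℤ) : ℝ) *
          formVal (fun h => simHid M T bits u (.inl h)) (topForm q (m + 1)) =
          2000 * R * topDigit (S k).head? := by
        simp only [htop, Finset.sum_range_succ, Finset.sum_range_zero]
        rcases (S k).head? with _ | (_ | _ | _ | _) <;> simp [topDigit, symDigit] <;> ring
      rw [hsum]
      push_cast
      linear_combination (1000 * R) * h10
    · simp [hk, Function.update_of_ne (Ne.symm hk)]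

theorem Running.peek (H : Running u R q S) {k : K'} {f : Option Γ' → Q} (h : M q = .peek k f) :
    Running (simStep M q₀ bits u) (1000 * R) (f (S k).head?) S := by
  have hr : readStack M q = k := by simp [readStack, h]
  refine H.of_step q₀ (fun p => ?_) (fun k' => ?_)
  · simp only [transForm, h]
    exact H.trans_read (by rw [hr]) f p
  · simp [stackForm, h]

theorem Running.emit (H : Running u R q S) {b : Bool} {q' : Q} (h : M q = .emit b q') :
    Running (simStep M q₀ bits u) (1000 * R) q' S := by
  refine H.of_step q₀ (fun p => ?_) (fun k' => ?_)
  · simp only [transForm, h]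
    split_ifs <;> simp [H.control.hid_st]
  · simp [stackForm, h]

theorem Running.out (H : Running u R q S) (i : Fin 3) :
    simStep M q₀ bits u (.inl (.out i)) = match M q with
      | .emit b _ => if i = 1 ∨ (i = 2 ∧ b = true) then R else 0
      | .halt => if i = 0 then R else 0
      | _ => 0 := by
  rw [H.control.step_out, Option.elim_some, outForm]
  cases M q with
  | push k' a p => simp
  | pop k' f => simp
  | peek k f => simp
  | emit b p => simp only; split_ifs <;> simp [H.control.hid_st]
  | halt => simp only; split_ifs <;> simp [H.control.hid_st]

end Step
end LoopedReLU
end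

noncomputable section
namespace LoopedReLU
open Turing.PartrecToTM2

/-! ### The output of a running machine -/

open Classical in
/-- The bits emitted at time `t`, given the values of the two output channels. -/
def emittedAt (e b : ℕ → ℝ) (t : ℕ) : List Bool :=
  if 0 < e t then [decide (0 < b t)] else []

/-- Observed from time `t` on, the channels `h`, `e`, `b` output `s` and halt. -/
def HaltsWith (h e b : ℕ → ℝ) (t : ℕ) (s : List Bool) : Prop :=
  ∃ τ, t ≤ τ ∧ 0 < h τ ∧ (∀ i, t ≤ i → i < τ → ¬ 0 < h i) ∧
    (List.range' t (τ - t)).flatMap (emittedAt e b) = s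

theorem HaltsWith.cons {h e b : ℕ → ℝ} {t : ℕ} {s : List Bool} (H : HaltsWith h e b (t + 1) s)
    (ht : h t ≤ 0) : HaltsWith h e b t (emittedAt e b t ++ s) := by
  obtain ⟨τ, h1, h2, h3, h4⟩ := H
  refine ⟨τ, by omega, h2, fun i hi hiτ => ?_, ?_⟩
  · rcases Nat.eq_or_lt_of_le hi with rfl | hi
    · exact not_lt.2 ht
    · exact h3 i hi hiτ
  · rw [show τ - t = (τ - (t + 1)) + 1 by omega, List.range'_succ, List.flatMap_cons, h4]

theorem HaltsWith.silent {h e b : ℕ → ℝ} {t₀ t : ℕ} {s : List Bool} (H : HaltsWith h e b t s)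
    (ht : t₀ ≤ t) (hh : ∀ i, t₀ ≤ i → i < t → h i ≤ 0) (he : ∀ i, t₀ ≤ i → i < t → e i ≤ 0) :
    HaltsWith h e b t₀ s := by
  induction t, ht using Nat.le_induction with
  | base => exact H
  | succ t ht ih =>
    refine ih ?_ (fun i hi hit => hh i hi (by omega)) (fun i hi hit => he i hi (by omega))
    have := H.cons (hh t ht (by omega))
    rwa [emittedAt, if_neg (not_lt.2 (he t ht (by omega))), List.nil_append] at this

theorem LoopedNet.outputs_iff (θ : LoopedNet) (s : List Bool) :
    θ.Outputs s ↔ HaltsWith θ.haltCh θ.emitCh θ.bitCh 1 s := Iff.rfl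

/-- Only signs of the channels are observed, so a positive factor depending on time is invisible.
The shift by one is the iteration in which the initial values are written. -/
theorem HaltsWith.congr {h e b h' e' b' : ℕ → ℝ} {c : ℕ → ℝ} (hc : ∀ t, 0 < c t)
    (hh : ∀ t, h' (t + 1) = c t * h t) (he : ∀ t, e' (t + 1) = c t * e t)
    (hb : ∀ t, b' (t + 1) = c t * b t) {t : ℕ} {s : List Bool} (H : HaltsWith h e b t s) :
    HaltsWith h' e' b' (t + 1) s := by
  obtain ⟨τ, h1, h2, h3, h4⟩ := H
  have hpos : ∀ (a : ℝ) t, (0 < c t * a) = (0 < a) := fun a t => by simp [hc t]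
  refine ⟨τ + 1, by omega, by rwa [hh, hpos], fun i hi hiτ => ?_, ?_⟩
  · obtain ⟨i, rfl⟩ : ∃ j, i = j + 1 := ⟨i - 1, by omega⟩
    rw [hh, hpos]
    exact h3 i (by omega) (by omega)
  · rw [← h4, Nat.add_sub_add_right, add_comm t 1, ← List.map_add_range', List.flatMap_map]
    refine congrArg (fun f => List.flatMap f _) (funext fun i => ?_)
    simp only [emittedAt, add_comm 1 i, he, hb, hpos]

section Output

variable {Q : Type} [Fintype Q] [DecidableEq Q] {M : Q → Instr K' Γ' Q} {q₀ : Q}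
  {T : ℕ} {bits : ℕ → Bool × Bool × Bool}

/-- The channels of a sequence of states. -/
abbrev ChannelsHaltWith (x : ℕ → FullVar Q T → ℝ) (t : ℕ) (s : List Bool) : Prop :=
  HaltsWith (fun t => x t (.inl (.out 0))) (fun t => x t (.inl (.out 1)))
    (fun t => x t (.inl (.out 2))) t s

theorem Running.output {x : ℕ → FullVar Q T → ℝ} (hx : ∀ t, x (t + 1) = simStep M q₀ bits (x t))
    {q : Q} {S : K' → List Γ'} {s : List Bool} (hs : Produces M q S s) (t : ℕ) (R : ℝ)
    (H : Running (x t) R q S) : ChannelsHaltWith x (t + 1) s := by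
  -- Instructions that neither emit nor halt leave all three channels at zero in the next state.
  have next : ∀ {t R q S s}, Running (x t) R q S → ChannelsHaltWith x (t + 2) s →
      (∀ b q', M q ≠ .emit b q') → M q ≠ .halt → ChannelsHaltWith x (t + 1) s := by
    intro t R q S s H hs h1 h2
    have hout : ∀ i, x (t + 1) (.inl (.out i)) = 0 := by
      intro i
      rw [hx, H.out]
      split
      · exact absurd ‹_› (h1 _ _)
      · exact absurd ‹_› h2
      · rfl
    have := hs.cons (hout 0).le
    simpa [emittedAt, hout] using this
  induction hs generalizing t R with
  | @push q S s k a q' h _ ih =>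
    exact next H (ih (t + 1) _ (by rw [hx]; exact H.push q₀ h)) (by simp [h]) (by simp [h])
  | @pop q S s k f h _ ih =>
    exact next H (ih (t + 1) _ (by rw [hx]; exact H.pop q₀ h)) (by simp [h]) (by simp [h])
  | @peek q S s k f h _ ih =>
    exact next H (ih (t + 1) _ (by rw [hx]; exact H.peek q₀ h)) (by simp [h]) (by simp [h])
  | @emit q S s b q' h _ ih =>
    have h1 := ih (t + 1) _ (by rw [hx]; exact H.emit q₀ h)
    have hout := fun i => H.out (M := M) (bits := bits) q₀ i
    simp only [← hx, h] at hout
    have h2 := HaltsWith.cons h1 (by simp [hout])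
    have hR := H.control.pos
    have h3 : emittedAt (fun t => x t (.inl (.out 1))) (fun t => x t (.inl (.out 2))) (t + 1) =
        [b] := by
      cases b <;> simp [emittedAt, hout, hR]
    rwa [h3] at h2
  | @halt q S h =>
    have hout := fun i => H.out (M := M) (bits := bits) q₀ i
    simp only [← hx, h] at hout
    exact ⟨t + 1, le_rfl, by simp [hout, H.control.pos], fun i h1 h2 => by omega, by simp⟩

end Output

/-! ### Loading the program -/

/-- The word, with a terminator, that is loaded from a list of triples of bits. -/
def loadedWord (L : List (Bool × Bool × Bool)) : List Γ' :=
  L.flatMap (fun j => [bitSym j.1, bitSym j.2.1, bitSym j.2.2]) ++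
    ([Γ'.cons] : List _)

/-- The increments of the main stack while the word is loaded. -/
def loadIncr (L : List (Bool × Bool × Bool)) (i : ℕ) : ℝ :=
  if i < L.length then (tripleVal (L.getD i (false, false, false)) : ℝ)
  else if i = L.length then 600000 else 0

theorem tripleVal_nonneg (j : Bool × Bool × Bool) : 0 ≤ tripleVal j := by
  unfold tripleVal; positivity

theorem loadIncr_nonneg (L : List (Bool × Bool × Bool)) (i : ℕ) : 0 ≤ loadIncr L i := by
  unfold loadIncr
  have := tripleVal_nonneg (L.getD i (false, false, false))
  split_ifs
  · exact_mod_cast this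
  · norm_num
  · exact le_rfl

/-- The value of the main stack after some loading steps. -/
def loadVal (L : List (Bool × Bool × Bool)) (n : ℕ) : ℝ :=
  -- The pulse passes from the chain to `kind` and from there to the stack, so increment `i` arrives
  -- at time `i + 2`.
  ∑ i ∈ Finset.range (n - 1), loadIncr L i / 1000 ^ (i + 2)

theorem stackVal_loadedWord (L : List (Bool × Bool × Bool)) :
    stackVal (loadedWord L) = ∑ i ∈ Finset.range (L.length + 1), loadIncr L i / 1000 ^ (i + 2) := by
  induction L with
  | nil => simp [loadedWord, stackVal, loadIncr, symDigit]; norm_num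
  | cons j L ih =>
    have hsucc : ∀ i, loadIncr (j :: L) (i + 1) = loadIncr L i := by
      intro i; simp [loadIncr]
    rw [List.length_cons, Finset.sum_range_succ']
    have : ∀ i, loadIncr (j :: L) (i + 1) / 1000 ^ (i + 1 + 2) =
        (loadIncr L i / 1000 ^ (i + 2)) / 1000 := by
      intro i
      rw [hsucc, show i + 1 + 2 = (i + 2) + 1 by ring, pow_succ, div_div]
    simp only [this]
    rw [← Finset.sum_div, ← ih]
    have h0 : loadIncr (j :: L) 0 = tripleVal j := by simp [loadIncr]
    have hw : loadedWord (j :: L) = bitSym j.1 :: bitSym j.2.1 :: bitSym j.2.2 :: loadedWord L := by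
      simp [loadedWord]
    rw [h0, hw]
    simp only [stackVal, tripleVal]
    push_cast
    ring

theorem loadVal_eq (L : List (Bool × Bool × Bool)) {n : ℕ} (hn : L.length + 2 ≤ n) :
    loadVal L n = stackVal (loadedWord L) := by
  rw [stackVal_loadedWord, loadVal]
  refine (Finset.sum_subset (by intro i; simp; omega) fun i hi hi' => ?_).symm
  simp only [Finset.mem_range] at hi'
  rw [loadIncr, if_neg (by omega), if_neg (by omega), zero_div]

theorem loadVal_nonneg (L : List (Bool × Bool × Bool)) (n : ℕ) : 0 ≤ loadVal L n :=
  Finset.sum_nonneg fun i _ => div_nonneg (loadIncr_nonneg L i) (by positivity)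

/-- The partial sums of a non-negative series are bounded by its full sum, a stack value. The bound
is needed because `Control` must hold during loading, too. -/
theorem loadVal_le_one (L : List (Bool × Bool × Bool)) (n : ℕ) : loadVal L n ≤ 1 := by
  have : loadVal L n ≤ loadVal L (n + L.length + 2) :=
    Finset.sum_le_sum_of_subset_of_nonneg (by intro i; simp; omega)
      fun i _ _ => div_nonneg (loadIncr_nonneg L i) (by positivity)
  rw [loadVal_eq L (n := n + L.length + 2) (by omega)] at this
  exact this.trans (stackVal_le_one _)

section Load

variable {Q : Type} [Fintype Q] [DecidableEq Q] (M : Q → Instr K' Γ' Q) (q₀ : Q)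
  (L : List (Bool × Bool × Bool))

/-- The state of the network after `n` iterations, while it is loading its program. -/
def loadState (n : ℕ) : FullVar Q L.length → ℝ
  | .inl .ref => 1000 ^ n
  | .inl .load => if n ≤ L.length then 1 else 0
  | .inl .timer => if L.length + 2 ≤ n then 10000 ^ (n - (L.length + 2)) else 0
  | .inl .fin => if n = L.length + 1 then 1 else 0
  | .inl .act => if 1 ≤ n ∧ n ≤ L.length then 1 else 0
  | .inl (.kind j) => if 1 ≤ n ∧ n ≤ L.length ∧ L.getD (n - 1) (false, false, false) = j ∧
      j ≠ (false, false, false) then 1 else 0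
  | .inl (.st _) => 0
  | .inl (.stk k) => if k = K'.main then 1000 ^ n * loadVal L n else 0
  | .inl (.out _) => 0
  | .inr i => if n = i.1 then 1 else 0

theorem control_loadState {Q : Type} [DecidableEq Q] (L : List (Bool × Bool × Bool)) (n : ℕ) : Control (loadState (Q := Q) L n) (1000 ^ n) none
    (fun k => if k = K'.main then loadVal L n else 0) where
  pos := by positivity
  ref := rfl
  st q := by simp [loadState]
  stk k := by by_cases hk : k = K'.main <;> simp [loadState, hk]
  nonneg k := by
    have := loadVal_nonneg L n
    split_ifs <;> simp [this]
  le_one k := by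
    have := loadVal_le_one L n
    split_ifs <;> simp [this]

theorem simTraj_zero : simTraj M q₀ L.length (fun i => L.getD i (false, false, false)) 0 =
    loadState L 0 := by
  funext x
  rcases x with (_ | _ | _ | _ | _ | _ | _ | _ | _) | i <;>
    simp [simTraj, traj, fullInit, loadState, loadVal, eq_comm]

theorem loadVal_succ {n : ℕ} (hn : 1 ≤ n) :
    1000 ^ (n + 1) * loadVal L (n + 1) = 1000 * 1000 ^ n * loadVal L n + loadIncr L (n - 1) := by
  obtain ⟨n, rfl⟩ : ∃ k, n = k + 1 := ⟨n - 1, by omega⟩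
  simp only [loadVal, Nat.add_sub_cancel, Finset.sum_range_succ]
  have : (1000 : ℝ) ^ (n + 2) ≠ 0 := by positivity
  rw [mul_add, show n + 1 + 1 = n + 2 by ring, mul_div_cancel₀ _ this]
  ring

/-- While the program is loaded the start unit is silent. -/
theorem loadState_start (n : ℕ) (hn : n < 4 * L.length + 8) :
    simHid M L.length (fun i => L.getD i (false, false, false)) (loadState L n) (.inl .start) =
      0 := by
  simp only [simHid_inl, hidForm, map_sub, Finsupp.linearCombination_single, reduceCtorEq, if_false,
    add_zero, zsmul_eq_mul, loadState]
  apply max_eq_right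
  push_cast
  have hpos : (0 : ℝ) < 1000 ^ n := by positivity
  split_ifs with h
  -- In powers of ten this is `4 (n - T - 2) + 1 ≤ 3 n` with `T = L.length`, that is `n ≤ 4 T + 7`.
  · have : (10 : ℝ) * 10000 ^ (n - (L.length + 2)) ≤ 1000 ^ n := by
      rw [show (10000 : ℝ) = 10 ^ 4 by norm_num, show (1000 : ℝ) = 10 ^ 3 by norm_num, ← pow_mul,
        ← pow_mul, ← pow_succ']
      exact pow_le_pow_right₀ (by norm_num) (by omega)
    linarith
  · linarith

theorem loadState_succ (n : ℕ) (hn : n < 4 * L.length + 8) :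
    simStep M q₀ (fun i => L.getD i (false, false, false)) (loadState L n) =
      loadState L (n + 1) := by
  have H := control_loadState (Q := Q) L n
  have hstart := loadState_start M L n hn
  have hload : simHid M L.length (fun i => L.getD i (false, false, false)) (loadState L n)
      (.inl .load) = if n + 1 ≤ L.length then 1 else 0 := by
    simp only [simHid_inl, hidForm, Finsupp.linearCombination_single, if_true, loadState,
      Fin.val_last, one_smul]
    split_ifs <;> first | omega | simp
  have hfin : simHid M L.length (fun i => L.getD i (false, false, false)) (loadState L n)
      (.inl .fin) = if n = L.length + 1 then 1 else 0 := by
    simp only [simHid_inl, hidForm, Finsupp.linearCombination_single, loadState, one_smul,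
      reduceCtorEq, if_false, add_zero]
    split_ifs <;> simp
  have hact : simHid M L.length (fun i => L.getD i (false, false, false)) (loadState L n)
      (.inl .act) = if 1 ≤ n ∧ n ≤ L.length then 1 else 0 := by
    simp only [simHid_inl, hidForm, Finsupp.linearCombination_single, loadState, one_smul,
      reduceCtorEq, if_false, add_zero]
    split_ifs <;> simp
  have hkind : ∀ j, simHid M L.length (fun i => L.getD i (false, false, false)) (loadState L n)
      (.inl (.kind j)) = if 1 ≤ n ∧ n ≤ L.length ∧ L.getD (n - 1) (false, false, false) = j ∧
        j ≠ (false, false, false) then 1 else 0 := by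
    intro j
    simp only [simHid_inl, hidForm, Finsupp.linearCombination_single, loadState, one_smul,
      reduceCtorEq, if_false, add_zero]
    split_ifs <;> simp
  funext x
  rcases x with (_ | _ | _ | _ | _ | j | q | k | i) | i
  · rw [H.step_ref]; simp [loadState, pow_succ']
  · simp only [simStep_inl, varForm, Finsupp.linearCombination_single, hload, reduceCtorEq,
      if_false, Finset.sum_const_zero, add_zero, loadState, one_smul]
  · have htimer : simHid M L.length (fun i => L.getD i (false, false, false)) (loadState L n)
        (.inl .timer) = if L.length + 2 ≤ n then 10000 ^ (n - (L.length + 2)) else 0 := by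
      simp only [simHid_inl, hidForm, Finsupp.linearCombination_single, loadState, one_smul,
        reduceCtorEq, if_false, add_zero]
      split_ifs <;> simp
    simp only [simStep_inl, varForm, map_add, map_sub, Finsupp.linearCombination_single, hstart,
      hfin, htimer, reduceCtorEq, if_false, Finset.sum_const_zero, add_zero, loadState, smul_zero,
      sub_zero, zsmul_eq_mul]
    push_cast
    rcases lt_trichotomy n (L.length + 1) with h | h | h
    · rw [if_neg (by omega), if_neg (by omega), if_neg (by omega)]; simp
    · rw [if_neg (by omega), if_pos h, if_pos (by omega), h]; simp
    · rw [if_pos (by omega), if_neg (by omega), if_pos (by omega),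
        show n - (L.length + 1) = n - (L.length + 2) + 1 by omega, pow_succ]
      ring
  · simp only [simStep_inl, varForm, map_zero, reduceCtorEq, if_false, if_true,
      Finset.sum_const_zero, zero_add, simHid_chain, loadState, Fin.val_last]
    split_ifs <;> first | omega | simp
  · simp only [simStep_inl, varForm, Finsupp.linearCombination_single, hload, reduceCtorEq,
      if_false, Finset.sum_const_zero, add_zero, loadState, one_smul]
    simp
  · simp only [simStep_inl, varForm, map_zero, reduceCtorEq, if_false, SimVar.kind.injEq,
      Finset.sum_ite_eq, Finset.mem_univ, if_true, zero_add, add_zero, simHid_collector, loadState]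
    have : ∀ i : Fin (L.length + 1), (if i.1 < L.length ∧ L.getD i (false, false, false) = j ∧
        j ≠ (false, false, false) then (if n = i.1 then (1 : ℝ) else 0) else 0) =
        if n = i.1 then (if n < L.length ∧ L.getD n (false, false, false) = j ∧
        j ≠ (false, false, false) then (1 : ℝ) else 0) else 0 := by
      intro i
      by_cases h : n = i.1
      · simp [h]
      · simp [h]
    -- The pulse is in a single link at time `n`, so at most one summand is non-zero.
    simp only [this]
    by_cases h : n < L.length ∧ L.getD n (false, false, false) = j ∧ j ≠ (false, false, false)
    · have h' : 1 ≤ n + 1 ∧ n + 1 ≤ L.length ∧ L.getD (n + 1 - 1) (false, false, false) = j ∧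
          j ≠ (false, false, false) := ⟨by omega, by omega, h.2⟩
      rw [if_pos h']
      simp only [if_pos h]
      rw [Finset.sum_eq_single_of_mem (⟨n, by omega⟩ : Fin (L.length + 1)) (Finset.mem_univ _)
        (fun b _ hb => if_neg fun h => hb (Fin.ext h.symm))]
      simp
    · have h' : ¬ (1 ≤ n + 1 ∧ n + 1 ≤ L.length ∧ L.getD (n + 1 - 1) (false, false, false) = j ∧
          j ≠ (false, false, false)) := fun h' => h ⟨by omega, h'.2.2⟩
      rw [if_neg h']
      simp only [if_neg h]
      simp
  · rw [H.step_st, hstart]; simp [loadState]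
  · rw [H.step_stk, hact, hfin]
    simp only [hkind, Option.elim_none, add_zero, loadState]
    by_cases hk : k = K'.main
    · simp only [hk, if_true]
      rcases Nat.eq_zero_or_pos n with rfl | hn0
      · simp [loadVal]
      · rw [loadVal_succ L hn0, add_assoc]
        congr 1
        set j₀ := L.getD (n - 1) (false, false, false) with hj₀
        by_cases h : n ≤ L.length
        · have hsum : ∑ j, ((tripleVal j - tripleVal (false, false, false) : ℤ) : ℝ) *
              (if 1 ≤ n ∧ n ≤ L.length ∧ j₀ = j ∧ j ≠ (false, false, false) then 1 else 0) =
              ((tripleVal j₀ - tripleVal (false, false, false) : ℤ) : ℝ) := by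
            rw [Finset.sum_eq_single_of_mem j₀ (Finset.mem_univ _)]
            · by_cases hj : j₀ = (false, false, false)
              · simp [hj]
              · rw [if_pos ⟨hn0, h, rfl, hj⟩, mul_one]
            · intro j _ hj
              rw [if_neg (fun h => hj h.2.2.1.symm), mul_zero]
          rw [hsum, if_pos ⟨hn0, h⟩, if_neg (by omega), loadIncr, if_pos (by omega)]
          push_cast
          ring
        · have hsum : ∑ j, ((tripleVal j - tripleVal (false, false, false) : ℤ) : ℝ) *
              (if 1 ≤ n ∧ n ≤ L.length ∧ j₀ = j ∧ j ≠ (false, false, false) then 1 else 0) = 0 :=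
            Finset.sum_eq_zero fun j _ => by rw [if_neg (fun h' => h h'.2.1), mul_zero]
          rw [hsum, if_neg (fun h' => h h'.2), loadIncr,
            if_neg (show ¬ n - 1 < L.length by omega)]
          by_cases h' : n = L.length + 1
          · rw [if_pos h', if_pos (by omega)]; ring
          · rw [if_neg h', if_neg (by omega)]; ring
    · simp [hk]
  · rw [H.step_out]; simp [loadState]
  · by_cases hi : i.1 = 0
    · rw [simStep_chain_zero _ _ _ _ i hi]; simp [loadState, hi]
    · rw [simStep_chain_succ _ _ _ _ i ⟨i.1 - 1, by omega⟩ (by simp; omega)]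
      simp only [loadState]
      split_ifs <;> first | omega | simp

theorem simTraj_eq_loadState (n : ℕ) (hn : n ≤ 4 * L.length + 8) :
    simTraj M q₀ L.length (fun i => L.getD i (false, false, false)) n = loadState L n := by
  induction n with
  | zero => exact simTraj_zero M q₀ L
  | succ n ih =>
    rw [← loadState_succ M q₀ L n (by omega), ← ih (by omega)]
    rfl

/-- At time `4 * L.length + 8` timer and reference agree, so `start` has the value of the reference
and puts the machine into `q₀` at full scale, while it cancels the timer. -/
theorem running_simTraj :
    Running (simTraj M q₀ L.length (fun i => L.getD i (false, false, false)) (4 * L.length + 9))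
      (1000 ^ (4 * L.length + 9)) q₀ (K'.elim (loadedWord L) [] [] []) := by
  obtain ⟨N, hN⟩ : ∃ N, N = 4 * L.length + 8 := ⟨_, rfl⟩
  have hstep : simTraj M q₀ L.length (fun i => L.getD i (false, false, false)) (N + 1) =
      simStep M q₀ (fun i => L.getD i (false, false, false)) (loadState L N) := by
    rw [← simTraj_eq_loadState M q₀ L N hN.le]; rfl
  rw [show 4 * L.length + 9 = N + 1 by omega, hstep]
  have H := control_loadState (Q := Q) L N
  have htimer : loadState (Q := Q) L N (.inl .timer) = 1000 ^ N := by
    simp only [loadState]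
    rw [if_pos (by omega), show (10000 : ℝ) = 10 ^ 4 by norm_num,
      show (1000 : ℝ) = 10 ^ 3 by norm_num, ← pow_mul, ← pow_mul]
    congr 1
    omega
  have hstart : simHid M L.length (fun i => L.getD i (false, false, false)) (loadState L N)
      (.inl .start) = 1000 ^ N := by
    simp only [simHid_inl, hidForm, map_sub, Finsupp.linearCombination_single, reduceCtorEq,
      if_false, add_zero, zsmul_eq_mul, htimer, H.ref]
    push_cast
    rw [max_eq_left (by have := H.pos; linarith)]
    ring
  have hchain : ∀ i, loadState (Q := Q) L N (.inr i) = 0 := by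
    intro i
    simp only [loadState]
    exact if_neg (by omega)
  have hload : loadState (Q := Q) L N (.inl .load) = 0 := by
    simp only [loadState]; exact if_neg (by omega)
  have hfin : loadState (Q := Q) L N (.inl .fin) = 0 := by
    simp only [loadState]; exact if_neg (by omega)
  have hact : loadState (Q := Q) L N (.inl .act) = 0 := by
    simp only [loadState]; exact if_neg (by omega)
  have hkind : ∀ j, loadState (Q := Q) L N (.inl (.kind j)) = 0 := by
    intro j
    simp only [loadState]; exact if_neg (by omega)
  refine ⟨⟨by positivity, ?_, ?_, ?_, fun k => stackVal_nonneg _, fun k => stackVal_le_one _⟩,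
    ⟨?_, ?_, ?_, ?_, ?_, ?_⟩⟩
  · rw [H.step_ref, pow_succ' _ N]
  · intro q
    rw [H.step_st, hstart, pow_succ' _ N]
    simp [eq_comm]
  · intro k
    rw [H.step_stk]
    have h1 : simHid M L.length (fun i => L.getD i (false, false, false)) (loadState L N)
        (.inl .act) = 0 := by simp [simHid_inl, hidForm, hact]
    have h2 : simHid M L.length (fun i => L.getD i (false, false, false)) (loadState L N)
        (.inl .fin) = 0 := by simp [simHid_inl, hidForm, hfin]
    have h3 : ∀ j, simHid M L.length (fun i => L.getD i (false, false, false)) (loadState L N)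
        (.inl (.kind j)) = 0 := fun j => by simp [simHid_inl, hidForm, hkind]
    rw [h1, h2]
    simp only [h3, mul_zero, Finset.sum_const_zero, add_zero, ite_self, Option.elim_none]
    rw [loadVal_eq L (n := N) (by omega), pow_succ' _ N]
    cases k <;> simp [K'.elim, stackVal]
  · simp [simStep_inl, varForm, simHid_inl, hidForm, hload, hchain]
  · simp only [simStep_inl, varForm, map_sub, map_add, Finsupp.linearCombination_single, hstart]
    simp [simHid_inl, hidForm, htimer, hfin]
  · simp [simStep_inl, varForm, simHid_chain, hchain]
  · simp [simStep_inl, varForm, simHid_inl, hidForm, hload, hchain]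
  · intro j; simp [simStep_inl, varForm, simHid_collector, hchain]
  · intro i
    by_cases hi : i.1 = 0
    · exact simStep_chain_zero _ _ _ _ i hi
    · rw [simStep_chain_succ _ _ _ _ i ⟨i.1 - 1, by omega⟩ (by simp; omega), hchain, max_self]

/-- The simulating network with the program chain of `L` outputs what the machine produces from
the word of `L`. -/
theorem simTraj_output {s : List Bool}
    (hs : Produces M q₀ (K'.elim (loadedWord L) [] [] []) s) :
    ChannelsHaltWith (simTraj M q₀ L.length (fun i => L.getD i (false, false, false))) 0 s := by
  have H := running_simTraj M q₀ L
  have h1 := H.output (fun t => rfl) hs (4 * L.length + 9)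
  -- The channels vanish while loading, and also in the first running state, which is computed from
  -- a loading state without control state.
  have hsil : ∀ i j, i < 4 * L.length + 10 →
      simTraj M q₀ L.length (fun i => L.getD i (false, false, false)) i (.inl (.out j)) = 0 := by
    intro i j hi
    rcases Nat.lt_or_ge i (4 * L.length + 9) with h | h
    · rw [simTraj_eq_loadState M q₀ L i (by omega)]; rfl
    · obtain rfl : i = (4 * L.length + 8) + 1 := by omega
      change simStep M q₀ _ (simTraj M q₀ L.length _ (4 * L.length + 8)) _ = 0
      rw [simTraj_eq_loadState M q₀ L _ le_rfl, (control_loadState (Q := Q) L _).step_out]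
      simp
  exact HaltsWith.silent h1 (by omega) (fun i _ hi => (hsil i 0 hi).le)
    (fun i _ hi => (hsil i 1 hi).le)

end Load
end LoopedReLU
end

noncomputable section
namespace LoopedReLU
open Turing.PartrecToTM2

/-! ### Networks from programs -/

section Count

variable {Q : Type} [Fintype Q] [DecidableEq Q] (M : Q → Instr K' Γ' Q) (q₀ : Q)

/-- The number of copies of the units of the fixed part. -/
def copies : ℕ :=
  1 + ∑ h : SimHid Q, ∑ v, (hidForm M h v).natAbs + ∑ v : SimVar Q, ∑ h, (varForm M q₀ v h).natAbs

theorem natAbs_hidForm_le (h : SimHid Q) (v : SimVar Q) :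
    (hidForm M h v).natAbs ≤ copies M q₀ := by
  have h1 := Finset.single_le_sum (f := fun v => (hidForm M h v).natAbs) (fun _ _ => Nat.zero_le _)
    (Finset.mem_univ v)
  have h2 := Finset.single_le_sum (f := fun h => ∑ v, (hidForm M h v).natAbs)
    (fun _ _ => Nat.zero_le _) (Finset.mem_univ h)
  unfold copies
  omega

theorem natAbs_varForm_le (h : SimHid Q) (v : SimVar Q) :
    (varForm M q₀ v h).natAbs ≤ copies M q₀ := by
  have h1 := Finset.single_le_sum (f := fun h => (varForm M q₀ v h).natAbs)
    (fun _ _ => Nat.zero_le _) (Finset.mem_univ h)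
  have h2 := Finset.single_le_sum (f := fun v => ∑ h, (varForm M q₀ v h).natAbs)
    (fun _ _ => Nat.zero_le _) (Finset.mem_univ v)
  unfold copies
  omega

/-- Multiplicities of the units: `copies` for the fixed part, `1` for the chain. -/
def mult {α β : Type} (C : ℕ) : α ⊕ β → ℕ
  | .inl _ => C
  | .inr _ => 1

/-- Used for rows and columns with at most one non-zero entry, as in the chain and the collectors.
-/
theorem sum_natAbs_ite_le_one {α : Type} [Fintype α] (P : α → Prop) [DecidablePred P] (z : ℤ)
    (hz : z.natAbs ≤ 1) (hP : ∀ a b, P a → P b → a = b) :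
    ∑ a, (if P a then z else 0).natAbs ≤ 1 := by
  by_cases h : ∃ a, P a
  · obtain ⟨a, ha⟩ := h
    rw [Finset.sum_eq_single_of_mem a (Finset.mem_univ _)]
    · simpa [ha] using hz
    · intro b _ hb
      rw [if_neg fun h => hb (hP _ _ h ha)]; rfl
  · push Not at h
    simp [h]

/-- A machine can be simulated by networks whose size grows by three parameters for every three
bits of input. -/
theorem exists_net_of_machine {δ B : ℝ} (hδ : 0 < δ) (hB : δ ≤ B) :
    ∃ c : ℕ, ∀ (L : List (Bool × Bool × Bool)) (s : List Bool),
      Produces M q₀ (K'.elim (loadedWord L) [] [] []) s →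
      ∃ θ : LoopedNet, θ.HasPrecision δ B ∧ θ.Outputs s ∧ θ.l0 ≤ 3 * L.length + c := by
  obtain ⟨m, hm⟩ : ∃ m : ℕ, 1 ≤ m * δ := by
    obtain ⟨m, hm⟩ := exists_nat_ge (1 / δ)
    exact ⟨m, by rwa [div_le_iff₀ hδ] at hm⟩
  set C := copies M q₀ with hC
  have hC1 : 1 ≤ C := by rw [hC]; unfold copies; omega
  -- What does not grow with the chain. The `+ 1` is the edge from the end of the chain to `load`;
  -- the `+ 2` covers the edges from a collector to its `kind` and from the chain to `fin`.
  refine ⟨(∑ h : SimHid Q, C * (∑ v, (hidForm M h v).natAbs + 1)) +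
    (∑ v : SimVar Q, C * (∑ h, (varForm M q₀ v h).natAbs + 2)) +
    (∑ _v : SimVar Q, C) + (2 * m + 1) + 3, fun L s hs => ?_⟩
  set bits : ℕ → Bool × Bool × Bool := fun i => L.getD i (false, false, false) with hbits
  set T := L.length with hT
  obtain ⟨θ, h1, h2, h3⟩ := exists_net_traj (fullW₁ M T bits) (fullW₂ M q₀ T) (fullInit T)
    (mult C) (mult C) m hδ hB
    (by
      rintro (h | j | i) (v | i')
      · exact natAbs_hidForm_le M q₀ h v
      · simp only [fullW₁, mult]; split_ifs <;> simp
      · simp [fullW₁]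
      · simp only [fullW₁, mult]; split_ifs <;> simp
      · simp [fullW₁]
      · simp only [fullW₁, mult]; split_ifs <;> simp)
    (by
      rintro (v | i) (h | j | i')
      · exact natAbs_varForm_le M q₀ h v
      · simp only [fullW₂, mult]; split_ifs <;> simp
      · simp only [fullW₂, mult]; split_ifs <;> simp
      · simp [fullW₂]
      · simp [fullW₂]
      · simp only [fullW₂, mult]; split_ifs <;> simp)
    (by rintro (v | i) <;> simp only [fullInit] <;> split_ifs <;> simp)
    hm (fun i => .inl (.out i)) (fun i j h => by simpa using h) (fun i => hC1)
  refine ⟨θ, h1, ?_, h2.trans ?_⟩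
  · rw [LoopedNet.outputs_iff]
    exact HaltsWith.congr (c := fun t => δ ^ (2 * (t + 1))) (fun t => by positivity)
      (fun t => (h3 t).1) (fun t => (h3 t).2.1) (fun t => (h3 t).2.2) (simTraj_output M q₀ L hs)
  · have e1 : ∑ y, mult C y * ∑ x, (fullW₁ M T bits y x).natAbs ≤
        (∑ h : SimHid Q, C * (∑ v, (hidForm M h v).natAbs + 1)) + (T + (T + 1)) := by
      rw [Fintype.sum_sum_type, Fintype.sum_sum_type]
      refine add_le_add (Finset.sum_le_sum fun h _ => ?_) (add_le_add ?_ ?_)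
      · refine Nat.mul_le_mul_left _ ?_
        rw [Fintype.sum_sum_type]
        refine add_le_add_right ?_ _
        exact sum_natAbs_ite_le_one _ _ (by simp) fun a b ha hb => ha.2.trans hb.2.symm
      · simp only [mult, one_mul, Fintype.sum_sum_type, fullW₁, Int.natAbs_zero,
          Finset.sum_const_zero, zero_add]
        -- Counted by links instead of collectors: each link feeds at most one collector, and the
        -- last one feeds none.
        rw [Finset.sum_comm]
        calc _ ≤ ∑ i : Fin (T + 1), (if i.1 < T then 1 else 0) := by
              refine Finset.sum_le_sum fun i _ => ?_
              by_cases hi : i.1 < T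
              · rw [if_pos hi]
                exact sum_natAbs_ite_le_one _ _ (by simp)
                  fun a b ha hb => ha.2.1.symm.trans hb.2.1
              · simp [hi]
          _ = T := by
              rw [Fin.sum_univ_castSucc]
              simp
      · simp only [mult, one_mul, Fintype.sum_sum_type, fullW₁, Int.natAbs_zero,
          Finset.sum_const_zero, zero_add]
        refine (Finset.sum_le_sum (g := fun _ => 1) fun i _ => ?_).trans (by simp)
        exact sum_natAbs_ite_le_one _ _ (by simp) fun a b ha hb => ha.symm.trans hb
    -- The shift along the chain is the third and last contribution of size `T`.
    have e2 : ∑ x, mult C x * ∑ y, (fullW₂ M q₀ T x y).natAbs ≤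
        (∑ v : SimVar Q, C * (∑ h, (varForm M q₀ v h).natAbs + 2)) + T := by
      rw [Fintype.sum_sum_type]
      refine add_le_add (Finset.sum_le_sum fun v _ => ?_) ?_
      · refine Nat.mul_le_mul_left _ ?_
        rw [Fintype.sum_sum_type, Fintype.sum_sum_type]
        refine add_le_add_right ?_ _
        change _ + _ ≤ 1 + 1
        refine add_le_add ?_ ?_
        · exact sum_natAbs_ite_le_one _ _ (by simp) fun a b ha hb => by
            simpa using ha.symm.trans hb
        · exact sum_natAbs_ite_le_one _ _ (by simp) fun a b ha hb => ha.2.trans hb.2.symm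
      · simp only [mult, one_mul, Fintype.sum_sum_type, fullW₂, Int.natAbs_zero,
          Finset.sum_const_zero, zero_add]
        rw [Fin.sum_univ_succ]
        have : ∑ x : Fin (T + 1), (if x.1 + 1 = (0 : Fin (T + 1)).1 then (1 : ℤ) else 0).natAbs
          = 0 := by simp
        rw [this, zero_add]
        refine (Finset.sum_le_sum (g := fun _ => 1) fun i _ => ?_).trans (by simp)
        exact sum_natAbs_ite_le_one _ _ (by simp) fun a b ha hb => Fin.ext (by omega)
    have e3 : ∑ x, mult C x * (fullInit (Q := Q) T x).natAbs ≤ (∑ _v : SimVar Q, C) + 1 := by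
      rw [Fintype.sum_sum_type]
      refine add_le_add (Finset.sum_le_sum fun v _ => ?_) ?_
      · simp only [fullInit, mult]; split_ifs <;> simp
      · simp only [mult, one_mul, fullInit]
        exact sum_natAbs_ite_le_one _ _ (by simp) fun a b ha hb => Fin.ext (by omega)
    refine (add_le_add (add_le_add (add_le_add e1 e2) e3) le_rfl).trans ?_
    omega

end Count

/-- A word padded to a prescribed residue of its length. -/
def padWord (j : ℕ) (p : List Bool) : List Bool := List.replicate j false ++ true :: p

/-- The first `true` marks the end of the padding, so its length need not be known. -/
theorem padWord_inj {j j' : ℕ} {p p' : List Bool} (h : padWord j p = padWord j' p') : p = p' := by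
  induction j generalizing j' with
  | zero =>
    cases j' with
    | zero => simpa [padWord] using h
    | succ j' => simp [padWord, List.replicate_succ] at h
  | succ j ih =>
    cases j' with
    | zero => simp [padWord, List.replicate_succ] at h
    | succ j' => exact ih (j' := j') (by simpa [padWord, List.replicate_succ] using h)

theorem primrec_wordNum : Primrec wordNum := by
  have : Primrec fun w : List Bool => w.foldr (fun b n => 2 * n + b.toNat) 1 :=
    Primrec.list_foldr (h := fun _ (x : Bool × ℕ) => 2 * x.2 + x.1.toNat) Primrec.id
      (Primrec.const 1)
      (Primrec.nat_add.comp (Primrec.nat_mul.comp (Primrec.const 2) (Primrec.snd.comp Primrec.snd))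
        ((Primrec.dom_bool Bool.toNat).comp (Primrec.fst.comp Primrec.snd))).to₂
  exact this

theorem primrec_padWord (j : ℕ) : Primrec (padWord j) :=
  Primrec.list_append.comp (Primrec.const _) (Primrec.list_cons.comp (Primrec.const _) Primrec.id)

/-- The word whose padding is encoded by `n`, if found at stage `k` of a search. -/
def unpadStage (n k : ℕ) : Option (List Bool) :=
  (Encodable.decode (α := List Bool) k).bind fun p =>
    if wordNum (padWord 0 p) = n ∨ wordNum (padWord 1 p) = n ∨ wordNum (padWord 2 p) = n then
      some p else none

theorem computable_unpadStage : Computable₂ unpadStage := by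
  have h : ∀ j, PrimrecPred fun x : (ℕ × ℕ) × List Bool => wordNum (padWord j x.2) = x.1.1 :=
    fun j => Primrec.eq.comp (primrec_wordNum.comp ((primrec_padWord j).comp Primrec.snd))
      (Primrec.fst.comp Primrec.fst)
  have : Primrec fun x : ℕ × ℕ => unpadStage x.1 x.2 :=
    Primrec.option_bind (Primrec.decode.comp Primrec.snd)
      (Primrec.ite ((h 0).or ((h 1).or (h 2))) (Primrec.option_some.comp Primrec.snd)
        (Primrec.const none)).to₂
  exact this.to_comp

/-- Whatever the search finds has a padding with the same number, and both `wordNum` and the padding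
are injective. -/
theorem mem_rfindOpt_unpadStage {j : ℕ} (hj : j < 3) (p : List Bool) :
    p ∈ Nat.rfindOpt (unpadStage (wordNum (padWord j p))) := by
  have hd : (Nat.rfindOpt (unpadStage (wordNum (padWord j p)))).Dom := by
    refine Nat.rfindOpt_dom.2 ⟨Encodable.encode p, p, ?_⟩
    have : j = 0 ∨ j = 1 ∨ j = 2 := by omega
    rcases this with rfl | rfl | rfl <;> simp [unpadStage]
  obtain ⟨k, hk⟩ := Nat.rfindOpt_spec (Part.get_mem hd)
  have : (Nat.rfindOpt (unpadStage (wordNum (padWord j p)))).get hd = p := by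
    simp only [unpadStage, Option.mem_def, Option.bind_eq_some_iff] at hk
    obtain ⟨p', _, hp'⟩ := hk
    split_ifs at hp' with h
    rw [← Option.some.inj hp']
    rcases h with h | h | h <;> exact padWord_inj (wordNum_injective h)
  have h := Part.get_mem hd
  rwa [this] at h

theorem exists_triples (T : ℕ) (w : List Bool) (hw : w.length = 3 * T) :
    ∃ L : List (Bool × Bool × Bool), L.length = T ∧ L.flatMap (fun j => [j.1, j.2.1, j.2.2]) = w := by
  induction T generalizing w with
  | zero => exact ⟨[], rfl, by simpa [eq_comm] using hw⟩
  | succ T ih =>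
    match w, hw with
    | a :: b :: c :: w, hw =>
      obtain ⟨L, h1, h2⟩ := ih w (by simp only [List.length_cons] at hw; omega)
      exact ⟨(a, b, c) :: L, by simp [h1], by simp [h2]⟩
    | [], hw => simp at hw
    | [_], hw => simp only [List.length_cons, List.length_nil] at hw; omega
    | [_, _], hw => simp only [List.length_cons, List.length_nil] at hw; omega

/-- For every partial computable `U` there is a constant `c` such that `U p` is the output of a
network with at most `p.length + c` parameters. -/
theorem exists_net_of_program {δ B : ℝ} (hδ : 0 < δ) (hB : δ ≤ B) (U : List Bool →. List Bool)
    (hU : Partrec U) : ∃ c : ℕ, ∀ p s : List Bool, s ∈ U p →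
      ∃ θ : LoopedNet, θ.HasPrecision δ B ∧ θ.Outputs s ∧ θ.l0 ≤ p.length + c := by
  let g : ℕ →. ℕ := fun n => ((Nat.rfindOpt (unpadStage n)).bind U).map wordNum
  have hg : Partrec g :=
    ((Partrec.rfindOpt computable_unpadStage).bind (hU.comp Computable.snd).to₂).map
      (primrec_wordNum.to_comp.comp Computable.snd).to₂
  obtain ⟨Q, _, _, M, q₀, hM⟩ := exists_stackMachine g hg
  obtain ⟨c, hc⟩ := exists_net_of_machine M q₀ hδ hB
  -- The loaded word consists of `j ≤ 2` padding bits, a separator, `p` and the leading one of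
  -- `wordNum`.
  refine ⟨c + 4, fun p s hs => ?_⟩
  obtain ⟨j, hj, T, hT⟩ : ∃ j < 3, ∃ T, p.length + 2 + j = 3 * T :=
    -- `2n ≡ -n` modulo 3.
    ⟨(2 * (p.length + 2)) % 3, by omega, (p.length + 2 + (2 * (p.length + 2)) % 3) / 3, by omega⟩
  -- The leading one of `wordNum` is loaded as a program bit; only the terminator comes from `fin`.
  obtain ⟨L, hL, hLw⟩ := exists_triples T (padWord j p ++ [true]) (by
    simp only [padWord, List.length_append, List.length_replicate, List.length_cons,
      List.length_nil]
    omega)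
  have hw : loadedWord L = (padWord j p).map bitSym ++ [Γ'.bit1, Γ'.cons] := by
    have := congrArg (List.map bitSym) hLw
    rw [List.map_flatMap] at this
    simp only [List.map_cons, List.map_nil, List.map_append] at this
    rw [loadedWord, this]
    simp [bitSym]
  obtain ⟨θ, h1, h2, h3⟩ := hc L s (by
    rw [hw]
    refine hM _ _ ?_
    exact Part.mem_map _ (Part.mem_bind (mem_rfindOpt_unpadStage hj p) hs))
  exact ⟨θ, h1, h2, by omega⟩

end LoopedReLU
end

/-! ### Exact evaluation of networks over a computable real -/

noncomputable section
namespace LoopedReLU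

/-! ### The sign of polynomial expressions in a computable real -/

/-- A list of signed monomials; `(true, j)` stands for `X ^ j` and `(false, j)` for `-X ^ j`. -/
abbrev SignedSum : Type := List (Bool × ℕ)

/-- The sign coded by a bit. -/
def sgn (b : Bool) : ℤ := if b then 1 else -1

theorem sgn_beq (a b : Bool) : sgn (a == b) = sgn a * sgn b := by
  cases a <;> cases b <;> rfl

theorem sgn_not (a : Bool) : sgn (!a) = -sgn a := by
  cases a <;> rfl

namespace SignedSum

open Polynomial

/-- The polynomial denoted by a list of signed monomials. -/
def toPoly (l : SignedSum) : ℤ[X] := (l.map fun x => monomial x.2 (sgn x.1)).sum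

/-- The value of a list of signed monomials at a real number. -/
def val (δ : ℝ) (l : SignedSum) : ℝ := (l.map fun x => (sgn x.1 : ℝ) * δ ^ x.2).sum

@[simp] theorem toPoly_nil : toPoly [] = 0 := rfl
@[simp] theorem toPoly_cons (x : Bool × ℕ) (l : SignedSum) :
    toPoly (x :: l) = monomial x.2 (sgn x.1) + toPoly l := rfl
@[simp] theorem toPoly_append (l m : SignedSum) : toPoly (l ++ m) = toPoly l + toPoly m := by
  simp [toPoly]
@[simp] theorem val_nil (δ : ℝ) : val δ [] = 0 := rfl
@[simp] theorem val_cons (δ : ℝ) (x : Bool × ℕ) (l : SignedSum) :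
    val δ (x :: l) = sgn x.1 * δ ^ x.2 + val δ l := rfl
@[simp] theorem val_append (δ : ℝ) (l m : SignedSum) : val δ (l ++ m) = val δ l + val δ m := by
  simp [val]

theorem aeval_toPoly (δ : ℝ) (l : SignedSum) : aeval δ (toPoly l) = val δ l := by
  induction l with
  | nil => simp
  | cons x l ih => simp [ih, aeval_monomial]

theorem coeff_toPoly (l : SignedSum) (j : ℕ) :
    (toPoly l).coeff j = (l.count (true, j) : ℤ) - l.count (false, j) := by
  induction l with
  | nil => simp
  | cons x l ih =>
    obtain ⟨b, i⟩ := x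
    rw [toPoly_cons, coeff_add, ih, coeff_monomial, List.count_cons, List.count_cons]
    by_cases h : i = j <;> cases b <;> simp [h, sgn] <;> ring

/-- Only exponents that occur need to be compared, which makes formal vanishing a primitive
recursive condition. -/
theorem toPoly_eq_zero_iff (l : SignedSum) :
    toPoly l = 0 ↔ ∀ x ∈ l, l.count (true, x.2) = l.count (false, x.2) := by
  constructor
  · intro h x _
    have := coeff_toPoly l x.2
    rw [h, coeff_zero] at this
    omega
  · intro h
    ext j
    rw [coeff_toPoly, coeff_zero]
    by_cases h1 : (true, j) ∈ l
    · have := h _ h1; simp only at this; omega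
    by_cases h2 : (false, j) ∈ l
    · have := h _ h2; simp only at this; omega
    rw [List.count_eq_zero_of_not_mem h1, List.count_eq_zero_of_not_mem h2]; simp

theorem toPoly_surjective (q : ℤ[X]) : ∃ l : SignedSum, toPoly l = q := by
  induction q using Polynomial.induction_on' with
  | add p q hp hq =>
    obtain ⟨l, rfl⟩ := hp
    obtain ⟨m, rfl⟩ := hq
    exact ⟨l ++ m, toPoly_append _ _⟩
  | monomial n a =>
    have key : ∀ (b : Bool) (k : ℕ), toPoly (List.replicate k (b, n)) = monomial n (k * sgn b) := by
      intro b k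
      simp only [toPoly, List.map_replicate, List.sum_replicate, nsmul_eq_mul]
      rw [← nsmul_eq_mul, ← map_nsmul, nsmul_eq_mul]
    rcases Int.eq_nat_or_neg a with ⟨k, rfl | rfl⟩
    · exact ⟨_, (key true k).trans (by simp [sgn])⟩
    · exact ⟨_, (key false k).trans (by simp [sgn])⟩

/-- Products of lists of signed monomials. -/
def mul (l m : SignedSum) : SignedSum :=
  l.flatMap fun x => m.map fun y => (x.1 == y.1, x.2 + y.2)

theorem toPoly_mul (l m : SignedSum) : toPoly (mul l m) = toPoly l * toPoly m := by
  induction l with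
  | nil => simp [mul]
  | cons x l ih =>
    have h : toPoly (m.map fun y => (x.1 == y.1, x.2 + y.2)) =
        monomial x.2 (sgn x.1) * toPoly m := by
      clear ih
      induction m with
      | nil => simp
      | cons y m ih => simp [ih, mul_add, monomial_mul_monomial, sgn_beq]
    simp only [mul, List.flatMap_cons, toPoly_append] at ih ⊢
    rw [h, ih, toPoly_cons, add_mul]

/-- The combination of the entries of `G` with the listed coefficients. -/
def combination (G : List SignedSum) (c : List (ℕ × SignedSum)) : SignedSum :=
  c.flatMap fun x => mul x.2 (G.getD x.1 [])

theorem toPoly_combination_cons (G : List SignedSum) (x : ℕ × SignedSum)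
    (c : List (ℕ × SignedSum)) : toPoly (combination G (x :: c)) =
      toPoly x.2 * toPoly (G.getD x.1 []) + toPoly (combination G c) := by
  simp [combination, toPoly_mul]

/-- Membership in the ideal is witnessed by a finite object, a list of indices and coefficients,
that a search can enumerate. -/
theorem exists_combination (G : List SignedSum) {q : ℤ[X]}
    (hq : q ∈ Ideal.span {r | ∃ g ∈ G, toPoly g = r}) : ∃ c, toPoly (combination G c) = q := by
  induction hq using Submodule.span_induction with
  | mem x hx =>
    obtain ⟨g, hg, rfl⟩ := hx
    obtain ⟨i, hi, rfl⟩ := List.getElem_of_mem hg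
    refine ⟨[(i, [(true, 0)])], ?_⟩
    rw [toPoly_combination_cons, List.getD_eq_getElem _ _ hi]
    simp [combination, sgn]
  | zero => exact ⟨[], rfl⟩
  | add x y _ _ hx hy =>
    obtain ⟨c, rfl⟩ := hx
    obtain ⟨d, rfl⟩ := hy
    exact ⟨c ++ d, by simp [combination]⟩
  | smul a x hxm hx =>
    clear hxm
    obtain ⟨c, rfl⟩ := hx
    obtain ⟨m, rfl⟩ := toPoly_surjective a
    refine ⟨c.map fun x => (x.1, mul m x.2), ?_⟩
    induction c with
    | nil => simp [combination]
    | cons x c ih =>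
      rw [List.map_cons, toPoly_combination_cons, toPoly_combination_cons, ih, toPoly_mul]
      simp only [smul_eq_mul]; ring

/-- The algebraic relations of a real number are finitely generated. -/
theorem exists_relations (δ : ℝ) : ∃ G : List SignedSum, ∀ l : SignedSum,
    val δ l = 0 ↔ ∃ c, toPoly (l ++ combination G c) = 0 := by
  -- Hilbert's basis theorem. The generators need not be computed from `δ`: their mere existence
  -- gives an algorithm for this `δ`.
  obtain ⟨S, hS⟩ := (isNoetherianRing_iff_ideal_fg ℤ[X]).1 inferInstance
    (RingHom.ker (aeval δ : ℤ[X] →ₐ[ℤ] ℝ))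
  choose g hg using toPoly_surjective
  refine ⟨S.toList.map g, fun l => ?_⟩
  have hset : {r | ∃ h ∈ S.toList.map g, toPoly h = r} = (S : Set ℤ[X]) := by
    ext r; simp [hg]
  constructor
  · intro h
    have hm : -toPoly l ∈ Ideal.span (S : Set ℤ[X]) := by
      rw [hS, RingHom.mem_ker, map_neg, neg_eq_zero]
      exact (aeval_toPoly δ l).trans h
    rw [← hset] at hm
    obtain ⟨c, hc⟩ := exists_combination _ hm
    exact ⟨c, by rw [toPoly_append, hc, add_neg_cancel]⟩
  · rintro ⟨c, hc⟩
    have h0 : ∀ c, aeval δ (toPoly (combination (S.toList.map g) c)) = 0 := by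
      intro c
      induction c with
      | nil => simp [combination]
      | cons x c ih =>
        rw [toPoly_combination_cons, map_add, ih, add_zero, map_mul]
        refine mul_eq_zero_of_right _ ?_
        by_cases hx : x.1 < (S.toList.map g).length
        · rw [List.getD_eq_getElem _ _ hx]
          have := List.getElem_mem hx
          obtain ⟨r, hr, hr'⟩ := List.mem_map.1 this
          rw [← hr', hg]
          have : r ∈ Ideal.span (S : Set ℤ[X]) := Ideal.subset_span (by simpa using hr)
          rw [hS] at this
          exact this
        · rw [List.getD_eq_default _ _ (not_lt.1 hx)]; simp
    have := congrArg (aeval δ) hc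
    rw [toPoly_append, map_add, h0, add_zero, aeval_toPoly, map_zero] at this
    exact this

/-- The total degree, an upper bound for all exponents. -/
def deg (l : SignedSum) : ℕ := l.foldr (fun x n => x.2 + n) 0

theorem le_deg {l : SignedSum} {x : Bool × ℕ} (h : x ∈ l) : x.2 ≤ deg l := by
  induction l with
  | nil => simp at h
  | cons y l ih =>
    change x.2 ≤ y.2 + deg l
    rcases List.mem_cons.1 h with rfl | h
    · omega
    · have := ih h; omega

/-- The sum of the monomials of one sign, homogenised to degree `D`, at the fraction `a / d`. -/
def part (b : Bool) (D a d : ℕ) (l : SignedSum) : ℕ :=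
  l.foldr (fun x n => (if x.1 = b then a ^ x.2 * d ^ (D - x.2) else 0) + n) 0

/-- If `2 ^ k δ` is within `1` of `a`, this certifies that the value at `δ` is positive. -/
def certPos (l : SignedSum) (k a : ℕ) : Bool :=
  decide (part false (deg l) (a + 1) (2 ^ k) l < part true (deg l) (a - 1) (2 ^ k) l)

/-- Homogenising clears all denominators, so `certPos` only compares natural numbers. -/
theorem part_eq (b : Bool) (D a d : ℕ) (hd : 0 < d) (l : SignedSum) (hl : ∀ x ∈ l, x.2 ≤ D) :
    (part b D a d l : ℝ) =
      (d : ℝ) ^ D * (l.map fun x => if x.1 = b then ((a : ℝ) / d) ^ x.2 else 0).sum := by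
  induction l with
  | nil => simp [part]
  | cons x l ih =>
    have h1 : part b D a d (x :: l) =
      (if x.1 = b then a ^ x.2 * d ^ (D - x.2) else 0) + part b D a d l := rfl
    rw [h1, Nat.cast_add, ih fun y hy => hl y (List.mem_cons_of_mem _ hy), List.map_cons,
      List.sum_cons, mul_add]
    congr 1
    have hd' : (d : ℝ) ≠ 0 := by positivity
    have hx := hl x (List.mem_cons_self ..)
    split_ifs
    · push_cast
      rw [pow_sub₀ _ hd' hx, div_pow]
      field_simp
    · simp

theorem val_eq_sub (δ : ℝ) (l : SignedSum) :
    val δ l = (l.map fun x => if x.1 = true then δ ^ x.2 else 0).sum -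
      (l.map fun x => if x.1 = false then δ ^ x.2 else 0).sum := by
  induction l with
  | nil => simp
  | cons x l ih =>
    obtain ⟨b, j⟩ := x
    rw [val_cons, ih]
    cases b <;> simp [sgn] <;> ring

theorem certPos_iff (l : SignedSum) (k a : ℕ) : certPos l k a = true ↔
    (l.map fun x => if x.1 = false then (((a : ℝ) + 1) / 2 ^ k) ^ x.2 else 0).sum <
    (l.map fun x => if x.1 = true then (((a - 1 : ℕ) : ℝ) / 2 ^ k) ^ x.2 else 0).sum := by
  rw [certPos, decide_eq_true_iff, ← @Nat.cast_lt ℝ,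
    part_eq _ _ _ _ (by positivity) _ fun x => le_deg,
    part_eq _ _ _ _ (by positivity) _ fun x => le_deg, mul_lt_mul_iff_right₀ (by positivity)]
  push_cast
  rfl

/-- Powers are monotone on non-negative reals: negative monomials are estimated with an upper bound
for `δ`, positive ones with a lower bound. -/
theorem val_pos_of_certPos {δ : ℝ} (hδ : 0 < δ) {l : SignedSum} {k a : ℕ}
    (ha : |δ * 2 ^ k - a| ≤ 1) (h : certPos l k a = true) : 0 < val δ l := by
  rw [certPos_iff] at h
  rw [val_eq_sub, sub_pos]
  rw [abs_le] at ha
  have h2 : (0 : ℝ) < 2 ^ k := by positivity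
  refine lt_of_le_of_lt ?_ (h.trans_le ?_)
  · refine List.sum_le_sum fun x _ => ?_
    split_ifs
    · refine pow_le_pow_left₀ hδ.le ?_ _
      rw [le_div_iff₀ h2]; linarith
    · rfl
  · refine List.sum_le_sum fun x _ => ?_
    split_ifs
    · refine pow_le_pow_left₀ (by positivity) ?_ _
      rw [div_le_iff₀ h2]
      -- For `a = 0` the truncated `a - 1` is 0, still a lower bound since `δ > 0`.
      rcases Nat.eq_zero_or_pos a with rfl | h
      · simp; positivity
      · rw [Nat.cast_sub h]; push_cast; linarith
    · rfl

-- Both estimates converge to the true sums by continuity, so a strict inequality at `δ` is visible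
-- at some finite precision.
open Filter Topology in
theorem exists_certPos {δ : ℝ} (hδ : 0 < δ) {a : ℕ → ℕ} (ha : ∀ k, |δ * 2 ^ k - a k| ≤ 1)
    {l : SignedSum} (h : 0 < val δ l) : ∃ k, certPos l k (a k) = true := by
  have h2 : Tendsto (fun k : ℕ => 2 * (1 / 2 : ℝ) ^ k) atTop (𝓝 0) := by
    simpa using (tendsto_pow_atTop_nhds_zero_of_lt_one (by norm_num : (0 : ℝ) ≤ 1 / 2)
      (by norm_num)).const_mul 2
  have hclose : ∀ r : ℕ → ℝ, (∀ k, |r k - δ * 2 ^ k| ≤ 2) →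
      Tendsto (fun k => r k / 2 ^ k) atTop (𝓝 δ) := by
    intro r hr
    rw [tendsto_iff_dist_tendsto_zero]
    refine squeeze_zero (fun _ => dist_nonneg) (fun k => ?_) h2
    rw [Real.dist_eq]
    have h2k : (0 : ℝ) < 2 ^ k := by positivity
    have : r k / 2 ^ k - δ = (r k - δ * 2 ^ k) * (1 / 2) ^ k := by
      rw [div_pow, one_pow]; field_simp
    rw [this, abs_mul, abs_of_nonneg (by positivity : (0 : ℝ) ≤ (1 / 2) ^ k)]
    exact mul_le_mul_of_nonneg_right (hr k) (by positivity)
  have hcont : ∀ (b : Bool), Continuous fun y : ℝ =>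
      (l.map fun x => if x.1 = b then y ^ x.2 else 0).sum := by
    intro b
    clear h
    induction l with
    | nil => simpa using continuous_const
    | cons x l ih =>
      simp only [List.map_cons, List.sum_cons]
      refine Continuous.add ?_ ih
      split_ifs <;> fun_prop
  have hup := ((hcont false).tendsto δ).comp (hclose (fun k => a k + 1) fun k => by
    have := ha k; rw [abs_le] at this ⊢; constructor <;> linarith)
  have hlo := ((hcont true).tendsto δ).comp (hclose (fun k => (a k - 1 : ℕ)) fun k => by
    have := ha k; rw [abs_le] at this ⊢
    have hpos : 0 < δ * 2 ^ k := by positivity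
    rcases Nat.eq_zero_or_pos (a k) with h | h
    · rw [h] at this ⊢; push_cast at this ⊢; simp; constructor <;> linarith
    · rw [Nat.cast_sub h]; push_cast; constructor <;> linarith)
  rw [val_eq_sub, sub_pos] at h
  obtain ⟨k, hk⟩ := (hup.eventually_lt hlo h).exists
  exact ⟨k, (certPos_iff _ _ _).2 hk⟩

/-- The negated expression. -/
def neg (l : SignedSum) : SignedSum := l.map fun x => (!x.1, x.2)

theorem val_neg (δ : ℝ) (l : SignedSum) : val δ (neg l) = -val δ l := by
  induction l with
  | nil => simp [neg]
  | cons x l ih =>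
    simp only [neg, List.map_cons, val_cons] at ih ⊢
    rw [ih, sgn_not]; push_cast; ring

end SignedSum
end LoopedReLU
end

noncomputable section
namespace LoopedReLU

/-! ### Computability of the sign -/

theorem primrec_nat_pow : Primrec₂ ((· ^ ·) : ℕ → ℕ → ℕ) :=
  Primrec₂.unpaired'.1 Nat.Primrec.pow

theorem primrec_int_toNat : Primrec Int.toNat := by
  have h : Primrec fun z : ℤ => bif (Encodable.encode z).bodd then 0 else (Encodable.encode z).div2 :=
    Primrec.cond (Primrec.nat_bodd.comp Primrec.encode) (Primrec.const 0)
      (Primrec.nat_div2.comp Primrec.encode)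
  refine h.of_eq fun z => ?_
  rcases z with m | m
  · have : Encodable.encode (Int.ofNat m) = 2 * m := rfl
    rw [this]; simp
  · have : Encodable.encode (Int.negSucc m) = 2 * m + 1 := rfl
    rw [this]; simp

theorem primrec_list_count {α : Type*} [Primcodable α] [BEq α] [LawfulBEq α] :
    Primrec₂ fun (l : List α) (a : α) => l.count a := by
  classical
  have : Primrec₂ fun (l : List α) (a : α) => l.foldr (fun x n => (if x = a then 1 else 0) + n) 0 :=
    Primrec.list_foldr (h := fun (p : List α × α) (x : α × ℕ) => (if x.1 = p.2 then 1 else 0) + x.2)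
      Primrec.fst (Primrec.const 0)
      (Primrec.nat_add.comp (Primrec.ite (Primrec.eq.comp (Primrec.fst.comp Primrec.snd)
        (Primrec.snd.comp Primrec.fst)) (Primrec.const 1) (Primrec.const 0))
        (Primrec.snd.comp Primrec.snd)).to₂
  refine this.of_eq fun l a => ?_
  induction l with
  | nil => rfl
  | cons x l ih =>
    rw [List.foldr_cons, ih, List.count_cons]
    by_cases h : x = a <;> simp [h, add_comm]

theorem exists_computable_search {α σ : Type*} [Primcodable α] [Primcodable σ]
    {f : α → ℕ → Option σ} (hf : Computable₂ f) (h : ∀ x, ∃ k, f x k ≠ none) :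
    ∃ g : α → σ, Computable g ∧ ∀ x, ∃ k, f x k = some (g x) := by
  have hdom : ∀ x, (Nat.rfindOpt (f x)).Dom := by
    intro x
    obtain ⟨k, hk⟩ := h x
    obtain ⟨b, hb⟩ := Option.ne_none_iff_exists'.1 hk
    exact Nat.rfindOpt_dom.2 ⟨k, b, hb⟩
  exact ⟨fun x => (Nat.rfindOpt (f x)).get (hdom x),
    (Partrec.rfindOpt hf).of_eq_tot fun x => Part.get_mem _,
    fun x => Nat.rfindOpt_spec (Part.get_mem (hdom x))⟩

namespace SignedSum

theorem primrec_deg : Primrec deg :=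
  Primrec.list_foldr (h := fun _ (x : (Bool × ℕ) × ℕ) => x.1.2 + x.2) Primrec.id (Primrec.const 0)
    (Primrec.nat_add.comp (Primrec.snd.comp (Primrec.fst.comp Primrec.snd))
      (Primrec.snd.comp Primrec.snd)).to₂

theorem primrec_part (b : Bool) {α : Type*} [Primcodable α] {D a d : α → ℕ} {l : α → SignedSum}
    (hD : Primrec D) (ha : Primrec a) (hd : Primrec d) (hl : Primrec l) :
    Primrec fun x => part b (D x) (a x) (d x) (l x) := by
  have hy : Primrec fun z : α × (Bool × ℕ) × ℕ => z.2.1.2 :=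
    Primrec.snd.comp (Primrec.fst.comp Primrec.snd)
  exact Primrec.list_foldr (h := fun x (y : (Bool × ℕ) × ℕ) =>
      (if y.1.1 = b then a x ^ y.1.2 * d x ^ (D x - y.1.2) else 0) + y.2) hl (Primrec.const 0)
    (Primrec.nat_add.comp (Primrec.ite
      (Primrec.eq.comp (Primrec.fst.comp (Primrec.fst.comp Primrec.snd)) (Primrec.const b))
      (Primrec.nat_mul.comp (primrec_nat_pow.comp (ha.comp Primrec.fst) hy)
        (primrec_nat_pow.comp (hd.comp Primrec.fst)
          (Primrec.nat_sub.comp (hD.comp Primrec.fst) hy)))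
      (Primrec.const 0)) (Primrec.snd.comp Primrec.snd)).to₂

theorem primrec_certPos : Primrec fun x : SignedSum × ℕ × ℕ => certPos x.1 x.2.1 x.2.2 := by
  have hk : Primrec fun x : SignedSum × ℕ × ℕ => 2 ^ x.2.1 :=
    primrec_nat_pow.comp (Primrec.const 2) (Primrec.fst.comp Primrec.snd)
  have ha : Primrec fun x : SignedSum × ℕ × ℕ => x.2.2 := Primrec.snd.comp Primrec.snd
  have hD : Primrec fun x : SignedSum × ℕ × ℕ => deg x.1 := primrec_deg.comp Primrec.fst
  exact (Primrec.nat_lt.comp (primrec_part false hD (Primrec.succ.comp ha) hk Primrec.fst)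
    (primrec_part true hD (Primrec.pred.comp ha) hk Primrec.fst)).decide

theorem primrec_neg : Primrec neg :=
  Primrec.list_map Primrec.id (Primrec.pair (Primrec.not.comp (Primrec.fst.comp Primrec.snd))
    (Primrec.snd.comp Primrec.snd)).to₂

theorem primrec_mul : Primrec₂ mul := by
  have h1 : Primrec₂ fun (p : SignedSum × SignedSum) (x : Bool × ℕ) =>
      p.2.map fun y => (x.1 == y.1, x.2 + y.2) := by
    refine Primrec.list_map (Primrec.snd.comp Primrec.fst) ?_
    change Primrec fun z : ((SignedSum × SignedSum) × (Bool × ℕ)) × (Bool × ℕ) =>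
      (z.1.2.1 == z.2.1, z.1.2.2 + z.2.2)
    refine Primrec.pair ?_ ?_
    · exact (Primrec.dom_finite (fun x : Bool × Bool => x.1 == x.2)).comp
        ((Primrec.fst.comp (Primrec.snd.comp Primrec.fst)).pair (Primrec.fst.comp Primrec.snd))
    · exact Primrec.nat_add.comp (Primrec.snd.comp (Primrec.snd.comp Primrec.fst))
        (Primrec.snd.comp Primrec.snd)
  exact Primrec.list_flatMap (f := fun p : SignedSum × SignedSum => p.1) Primrec.fst h1

theorem primrec_combination (G : List SignedSum) : Primrec (combination G) :=
  Primrec.list_flatMap Primrec.id (primrec_mul.comp (Primrec.snd.comp Primrec.snd)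
    ((Primrec.list_getD []).comp (Primrec.const G) (Primrec.fst.comp Primrec.snd))).to₂

theorem primrecPred_toPoly_eq_zero : PrimrecPred fun l : SignedSum => toPoly l = 0 := by
  have hR : PrimrecRel fun (x : Bool × ℕ) (l : SignedSum) =>
      l.count (true, x.2) = l.count (false, x.2) :=
    Primrec.eq.comp
      (primrec_list_count.comp Primrec.snd
        ((Primrec.const true).pair (Primrec.snd.comp Primrec.fst)))
      (primrec_list_count.comp Primrec.snd
        ((Primrec.const false).pair (Primrec.snd.comp Primrec.fst)))
  exact ((PrimrecRel.forall_mem_list hR).comp Primrec.id Primrec.id).of_eq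
    fun l => (toPoly_eq_zero_iff l).symm

/-- Stage `k` of the search for the sign, with an approximation `a` of `2 ^ k δ`. -/
def signStage (G : List SignedSum) (l : SignedSum) (k a : ℕ) : Option Bool :=
  bif certPos l k a then some true else bif certPos (neg l) k a then some false else
    bif ((Encodable.decode (α := List (ℕ × SignedSum)) k).map fun c =>
      decide (toPoly (l ++ combination G c) = 0)).getD false then some false else none

theorem primrec_signStage (G : List SignedSum) :
    Primrec fun x : SignedSum × ℕ × ℕ => signStage G x.1 x.2.1 x.2.2 := by
  have h1 : Primrec fun x : SignedSum × ℕ × ℕ => certPos (neg x.1) x.2.1 x.2.2 :=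
    primrec_certPos.comp ((primrec_neg.comp Primrec.fst).pair Primrec.snd)
  have h2 : Primrec₂ fun (x : SignedSum × ℕ × ℕ) (c : List (ℕ × SignedSum)) =>
      decide (toPoly (x.1 ++ combination G c) = 0) := by
    have h3 : Primrec fun z : (SignedSum × ℕ × ℕ) × List (ℕ × SignedSum) =>
        z.1.1 ++ combination G z.2 :=
      Primrec.list_append.comp (Primrec.fst.comp Primrec.fst)
        ((primrec_combination G).comp Primrec.snd)
    exact (primrecPred_toPoly_eq_zero.comp h3).decide
  have h4 : Primrec fun x : SignedSum × ℕ × ℕ =>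
      ((Encodable.decode (α := List (ℕ × SignedSum)) x.2.1).map fun c =>
        decide (toPoly (x.1 ++ combination G c) = 0)).getD false :=
    Primrec.option_getD.comp
      (Primrec.option_map (Primrec.decode.comp (Primrec.fst.comp Primrec.snd)) h2)
      (Primrec.const _)
  exact Primrec.cond primrec_certPos (Primrec.const _)
    (Primrec.cond h1 (Primrec.const _) (Primrec.cond h4 (Primrec.const _) (Primrec.const _)))

/-- Each of the three certificates is sound by itself, so the order of the tests and the stage at
which one succeeds do not matter. -/
theorem signStage_spec {δ : ℝ} (hδ : 0 < δ) {G : List SignedSum}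
    (hG : ∀ l : SignedSum, val δ l = 0 ↔ ∃ c, toPoly (l ++ combination G c) = 0)
    {l : SignedSum} {k a : ℕ} (ha : |δ * 2 ^ k - a| ≤ 1) {b : Bool} (hb : signStage G l k a = some b) :
    b = true ↔ 0 < val δ l := by
  unfold signStage at hb
  cases h1 : certPos l k a with
  | true =>
    rw [h1] at hb
    obtain rfl : true = b := by simpa using hb
    simpa using val_pos_of_certPos hδ ha h1
  | false =>
    rw [h1, cond_false] at hb
    cases h2 : certPos (neg l) k a with
    | true =>
      rw [h2] at hb
      obtain rfl : false = b := by simpa using hb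
      have := val_pos_of_certPos hδ ha h2
      rw [val_neg] at this
      simp only [Bool.false_eq_true, false_iff, not_lt]
      linarith
    | false =>
      rw [h2, cond_false] at hb
      cases hd : Encodable.decode (α := List (ℕ × SignedSum)) k with
      | none => rw [hd] at hb; simp at hb
      | some c =>
        rw [hd, Option.map_some, Option.getD_some] at hb
        by_cases h3 : toPoly (l ++ combination G c) = 0
        · rw [decide_eq_true h3, cond_true] at hb
          rw [(hG l).2 ⟨c, h3⟩, ← Option.some.inj hb]
          simp
        · rw [decide_eq_false h3, cond_false] at hb
          simp at hb

/-- Trichotomy: a positive or negative value is certified by precision, a zero value by a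
combination of relations. The stage serves both as precision and as code of the combination. -/
theorem exists_signStage_ne_none {δ : ℝ} (hδ : 0 < δ) {G : List SignedSum}
    (hG : ∀ l : SignedSum, val δ l = 0 ↔ ∃ c, toPoly (l ++ combination G c) = 0)
    {a : ℕ → ℕ} (ha : ∀ k, |δ * 2 ^ k - a k| ≤ 1) (l : SignedSum) :
    ∃ k, signStage G l k (a k) ≠ none := by
  unfold signStage
  rcases lt_trichotomy 0 (val δ l) with h | h | h
  · obtain ⟨k, hk⟩ := exists_certPos hδ ha h
    exact ⟨k, by rw [hk]; simp⟩
  · obtain ⟨c, hc⟩ := (hG l).1 h.symm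
    refine ⟨Encodable.encode c, ?_⟩
    rw [Encodable.encodek, Option.map_some, Option.getD_some, decide_eq_true hc]
    cases certPos l _ _ <;> cases certPos (neg l) _ _ <;> simp
  · obtain ⟨k, hk⟩ := exists_certPos hδ ha (l := neg l) (by rw [val_neg]; linarith)
    refine ⟨k, ?_⟩
    rw [hk]
    cases certPos l k (a k) <;> simp

theorem exists_computable_approx {δ : ℝ} (hδ : 0 < δ) (hc : IsComputableReal δ) :
    ∃ a : ℕ → ℕ, Computable a ∧ ∀ k, |δ * 2 ^ k - a k| ≤ 1 := by
  obtain ⟨f, hf, hfa⟩ := hc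
  refine ⟨fun k => (f k).toNat, primrec_int_toNat.to_comp.comp hf, fun k => ?_⟩
  have h2 : (0 : ℝ) < 2 ^ k := by positivity
  have h1 : |δ * 2 ^ k - f k| ≤ 1 := by
    have := hfa k
    have e : δ - (f k : ℝ) / 2 ^ k = (δ * 2 ^ k - f k) / 2 ^ k := by field_simp
    rw [e, abs_div, abs_of_pos h2] at this
    rwa [div_le_div_iff_of_pos_right h2] at this
  rcases le_total 0 (f k) with h | h
  · have h3 : (((f k).toNat : ℕ) : ℝ) = f k := by
      have : (((f k).toNat : ℕ) : ℤ) = f k := Int.toNat_of_nonneg h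
      exact_mod_cast this
    rwa [h3]
  -- Here `δ * 2 ^ k` lies in `(0, 1]`, so 0 is close enough.
  · have hf0 : (f k : ℝ) ≤ 0 := by exact_mod_cast h
    change |δ * 2 ^ k - (((f k).toNat : ℕ) : ℝ)| ≤ 1
    rw [Int.toNat_of_nonpos h]
    rw [abs_le] at h1 ⊢
    have : 0 < δ * 2 ^ k := by positivity
    push_cast
    constructor <;> linarith

attribute [irreducible] signStage

/-- The sign of polynomial expressions in a computable positive real is computable. -/
theorem exists_computable_pos {δ : ℝ} (hδ : 0 < δ) (hc : IsComputableReal δ) :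
    ∃ pos : SignedSum → Bool, Computable pos ∧ ∀ l, pos l = true ↔ 0 < val δ l := by
  obtain ⟨a, hac, haa⟩ := exists_computable_approx hδ hc
  obtain ⟨G, hG⟩ := exists_relations δ
  have hstage : Computable₂ fun (l : SignedSum) (k : ℕ) => signStage G l k (a k) :=
    (primrec_signStage G).to_comp.comp
      (Computable.fst.pair (Computable.snd.pair (hac.comp Computable.snd)))
  obtain ⟨g, hg, hg'⟩ := exists_computable_search hstage (exists_signStage_ne_none hδ hG haa)
  refine ⟨g, hg, fun l => ?_⟩
  obtain ⟨k, hk⟩ := hg' l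
  exact signStage_spec hδ hG (haa k) hk

end SignedSum
end LoopedReLU
end

noncomputable section
namespace LoopedReLU

/-! ### Sparse programs -/

/-- An edge `(b, src, tgt)` adds `±δ` times the (possibly rectified) value of the variable `src`
to the variable `(tgt, true)`. Variables `(i, true)` are rectified when they are read. -/
abbrev Edge : Type := Bool × (ℕ × Bool) × ℕ

/-- The value that is read from a variable. -/
def act (r : Bool) (x : ℝ) : ℝ := if r then max x 0 else x

/-- The effect of one edge. -/
def edgeStep (δ : ℝ) (Y : ℕ × Bool → ℝ) (e : Edge) : ℕ × Bool → ℝ :=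
  fun v => Y v + if v = (e.2.2, true) then sgn e.1 * (δ * act e.2.1.2 (Y e.2.1)) else 0

/-- The initial values: the variable `(0, false)` is the constant `1`. -/
def startState : ℕ × Bool → ℝ := fun v => if v = (0, false) then 1 else 0

/-- At the end of a cycle `(i, true)` is moved to `(i, false)`. -/
def nextState (Y : ℕ × Bool → ℝ) : ℕ × Bool → ℝ := fun v =>
  if v.2 then 0 else if v.1 = 0 then 1 else Y (v.1, true)

/-- The values of the variables after `t` cycles. -/
def sparseState (δ : ℝ) (E : List Edge) : ℕ → ℕ × Bool → ℝ
  | 0 => startState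
  | t + 1 => nextState (E.foldl (edgeStep δ) (sparseState δ E t))

/-- A list of signed monomials, each attributed to a variable. -/
abbrev Log : Type := List ((ℕ × Bool) × Bool × ℕ)

/-- The monomials attributed to a variable. -/
def collect (L : Log) (v : ℕ × Bool) : SignedSum :=
  L.filterMap fun x => if x.1 = v then some x.2 else none

/-- The values of the variables described by a log. -/
def logVal (δ : ℝ) (L : Log) (v : ℕ × Bool) : ℝ := SignedSum.val δ (collect L v)

theorem logVal_cons (δ : ℝ) (x : (ℕ × Bool) × Bool × ℕ) (L : Log) (v : ℕ × Bool) :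
    logVal δ (x :: L) v = (if x.1 = v then (sgn x.2.1 : ℝ) * δ ^ x.2.2 else 0) + logVal δ L v := by
  unfold logVal collect
  by_cases h : x.1 = v
  · rw [List.filterMap_cons_some (b := x.2) (by simp [h])]
    simp [h]
  · rw [List.filterMap_cons_none (by simp [h])]
    simp [h]

theorem logVal_append (δ : ℝ) (L L' : Log) (v : ℕ × Bool) :
    logVal δ (L ++ L') v = logVal δ L v + logVal δ L' v := by
  simp [logVal, collect]

/-- The effect of an edge on a log, given an oracle for positivity. -/
def logStep (pos : SignedSum → Bool) (L : Log) (e : Edge) : Log :=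
  bif e.2.1.2 && !pos (collect L e.2.1) then L else
    L ++ (collect L e.2.1).map fun m => ((e.2.2, true), (m.1 == e.1, m.2 + 1))

theorem logVal_map (δ : ℝ) (l : SignedSum) (b : Bool) (w v : ℕ × Bool) :
    logVal δ (l.map fun m => (w, (m.1 == b, m.2 + 1))) v =
      if v = w then sgn b * (δ * SignedSum.val δ l) else 0 := by
  induction l with
  | nil => simp [logVal, collect]
  | cons x l ih =>
    rw [List.map_cons, logVal_cons, ih, SignedSum.val_cons, sgn_beq]
    by_cases h : v = w
    · subst h; simp; ring
    · simp [h, Ne.symm h]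

/-- A rectified source with value at most zero contributes nothing, so the log stays as it is; any
other source contributes its monomials times `±δ`. -/
theorem logVal_logStep {δ : ℝ} {pos : SignedSum → Bool}
    (hpos : ∀ l, pos l = true ↔ 0 < SignedSum.val δ l) (L : Log) (e : Edge) :
    logVal δ (logStep pos L e) = edgeStep δ (logVal δ L) e := by
  funext v
  unfold logStep edgeStep act
  cases h1 : e.2.1.2 with
  | false => simp only [Bool.false_and, cond_false, logVal_append, logVal_map]; simp [logVal]
  | true =>
    cases h2 : pos (collect L e.2.1) with
    | true =>
      have h3 : 0 < logVal δ L e.2.1 := (hpos _).1 h2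
      simp only [Bool.not_true, Bool.and_false, cond_false, logVal_append, logVal_map, if_true,
        max_eq_left h3.le]
      simp [logVal]
    | false =>
      have h3 : logVal δ L e.2.1 ≤ 0 := by
        by_contra h
        rw [(hpos _).2 (not_le.1 h)] at h2
        exact Bool.noConfusion h2
      simp [max_eq_right h3]

/-- The log at the end of a cycle. -/
def logNext (L : Log) : Log :=
  ((0, false), (true, 0)) :: L.filterMap fun x =>
    if x.1.2 = true ∧ x.1.1 ≠ 0 then some ((x.1.1, false), x.2) else none

theorem logVal_logNext (δ : ℝ) (L : Log) : logVal δ (logNext L) = nextState (logVal δ L) := by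
  funext ⟨i, b⟩
  have key : ∀ L : Log, logVal δ (L.filterMap fun x =>
      if x.1.2 = true ∧ x.1.1 ≠ 0 then some ((x.1.1, false), x.2) else none) (i, b) =
      if b then 0 else if i = 0 then 0 else logVal δ L (i, true) := by
    intro L
    induction L with
    | nil => cases b <;> simp [logVal, collect]
    | cons x L ih =>
      obtain ⟨⟨k, c⟩, m⟩ := x
      by_cases h : c = true ∧ k ≠ 0
      · rw [List.filterMap_cons_some (b := ((k, false), m)) (by simp [h]), logVal_cons, ih,
          logVal_cons]
        obtain ⟨rfl, hk⟩ := h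
        cases b
        · by_cases hi : i = 0
          · subst hi; simp [hk]
          · simp [hi]
        · simp
      · rw [List.filterMap_cons_none (by simp only [ite_eq_right_iff]; intro h'; exact absurd h' h),
          ih, logVal_cons]
        cases b
        · by_cases hi : i = 0
          · simp [hi]
          · have : ((k, c) : ℕ × Bool) ≠ (i, true) := by
              rintro h'
              simp only [Prod.mk.injEq] at h'
              exact h ⟨h'.2, h'.1 ▸ hi⟩
            simp [hi, this]
        · simp
  rw [logNext, logVal_cons, key]
  unfold nextState
  cases b
  · by_cases hi : i = 0
    · simp [hi, sgn]
    · simp [hi, Ne.symm hi]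
  · simp

/-- The log after `t` cycles. -/
def logAt (pos : SignedSum → Bool) (E : List Edge) : ℕ → Log
  | 0 => [((0, false), (true, 0))]
  | t + 1 => logNext (E.foldl (logStep pos) (logAt pos E t))

theorem logVal_logAt {δ : ℝ} {pos : SignedSum → Bool}
    (hpos : ∀ l, pos l = true ↔ 0 < SignedSum.val δ l) (E : List Edge) (t : ℕ) :
    logVal δ (logAt pos E t) = sparseState δ E t := by
  have hfold : ∀ (E : List Edge) (L : Log),
      logVal δ (E.foldl (logStep pos) L) = E.foldl (edgeStep δ) (logVal δ L) := by
    intro E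
    induction E with
    | nil => intro L; rfl
    | cons e E ih => intro L; rw [List.foldl_cons, List.foldl_cons, ih, logVal_logStep hpos]
  induction t with
  | zero =>
    funext v
    rw [logAt, logVal_cons, sparseState, startState]
    by_cases h : v = (0, false)
    · subst h; simp [logVal, collect, sgn]
    · simp [logVal, collect, h, Ne.symm h]
  | succ t ih => rw [logAt, logVal_logNext, hfold, ih, sparseState]

/-- The output of a sparse program: the variables `1`, `2`, `3` are the channels. -/
def sparseOutputs (δ : ℝ) (E : List Edge) (s : List Bool) : Prop :=
  HaltsWith (fun t => sparseState δ E t (1, false)) (fun t => sparseState δ E t (2, false))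
    (fun t => sparseState δ E t (3, false)) 1 s

/-! ### Running sparse programs -/

/-- The step calls the sign oracle and is only computable. The fold is a recursion on the number of
entries already consumed. -/
theorem computable_list_foldl {α β σ : Type*} [Primcodable α] [Primcodable β] [Primcodable σ]
    {f : α → List β} {g : α → σ} {h : α → σ × β → σ} (hf : Computable f) (hg : Computable g)
    (hh : Computable₂ h) : Computable fun a => (f a).foldl (fun s b => h a (s, b)) (g a) := by
  have hstep : Computable₂ fun (a : α) (p : ℕ × σ) =>
      (((f a)[p.1]?).map fun b => h a (p.2, b)).getD p.2 := by
    refine Computable.option_getD (Computable.option_map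
      (Computable.list_getElem?.comp (hf.comp Computable.fst)
        (Computable.fst.comp Computable.snd)) ?_) (Computable.snd.comp Computable.snd)
    exact hh.comp (Computable.fst.comp Computable.fst)
      ((Computable.snd.comp (Computable.snd.comp Computable.fst)).pair Computable.snd)
  refine (Computable.nat_rec (Computable.list_length.comp hf) hg hstep).of_eq fun a => ?_
  have key : ∀ n ≤ (f a).length, (Nat.rec (g a) (fun y IH =>
      (((f a)[y]?).map fun b => h a (IH, b)).getD IH) n : σ) =
      ((f a).take n).foldl (fun s b => h a (s, b)) (g a) := by
    intro n
    induction n with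
    | zero => intro _; simp
    | succ n ih =>
      intro hn
      simp only
      rw [ih (by omega), List.take_succ_eq_append_getElem (by omega), List.foldl_append,
        List.getElem?_eq_getElem (by omega)]
      rfl
  simpa using key _ le_rfl

theorem primrec_collect : Primrec₂ collect := by
  refine Primrec.listFilterMap (f := fun x : Log × (ℕ × Bool) => x.1)
    (g := fun x y => if y.1 = x.2 then some y.2 else none) Primrec.fst ?_
  exact (Primrec.ite (Primrec.eq.comp (Primrec.fst.comp Primrec.snd) (Primrec.snd.comp Primrec.fst))
    (Primrec.option_some.comp (Primrec.snd.comp Primrec.snd)) (Primrec.const none)).to₂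

theorem computable_logStep {pos : SignedSum → Bool} (hpos : Computable pos) :
    Computable₂ (logStep pos) := by
  have hsrc : Primrec fun x : Log × Edge => x.2.2.1 :=
    Primrec.fst.comp (Primrec.snd.comp Primrec.snd)
  have hcol : Primrec fun x : Log × Edge => collect x.1 x.2.2.1 :=
    primrec_collect.comp Primrec.fst hsrc
  have hc : Computable fun x : Log × Edge => x.2.2.1.2 && !pos (collect x.1 x.2.2.1) :=
    Primrec.and.to_comp.comp (Primrec.snd.comp hsrc).to_comp
      (Primrec.not.to_comp.comp (hpos.comp hcol.to_comp))
  have hm : Primrec₂ fun (x : Log × Edge) (m : Bool × ℕ) =>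
      (((x.2.2.2, true), (m.1 == x.2.1, m.2 + 1)) : (ℕ × Bool) × Bool × ℕ) := by
    refine Primrec.pair (Primrec.pair (Primrec.snd.comp (Primrec.snd.comp
      (Primrec.snd.comp Primrec.fst))) (Primrec.const true)) (Primrec.pair ?_
      (Primrec.succ.comp (Primrec.snd.comp Primrec.snd)))
    exact (Primrec.dom_finite (fun x : Bool × Bool => x.1 == x.2)).comp
      ((Primrec.fst.comp Primrec.snd).pair (Primrec.fst.comp (Primrec.snd.comp Primrec.fst)))
  exact Computable.cond hc Computable.fst
    (Primrec.list_append.comp Primrec.fst (Primrec.list_map hcol hm)).to_comp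

theorem primrec_logNext : Primrec logNext := by
  refine Primrec.list_cons.comp (Primrec.const _) (Primrec.listFilterMap Primrec.id ?_)
  have h1 : PrimrecPred fun x : Log × (ℕ × Bool) × Bool × ℕ => x.2.1.2 = true :=
    Primrec.eq.comp (Primrec.snd.comp (Primrec.fst.comp Primrec.snd)) (Primrec.const true)
  have h2 : PrimrecPred fun x : Log × (ℕ × Bool) × Bool × ℕ => x.2.1.1 ≠ 0 :=
    (Primrec.eq.comp (Primrec.fst.comp (Primrec.fst.comp Primrec.snd)) (Primrec.const 0)).not
  exact (Primrec.ite (h1.and h2) (Primrec.option_some.comp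
    (((Primrec.fst.comp (Primrec.fst.comp Primrec.snd)).pair (Primrec.const false)).pair
      (Primrec.snd.comp Primrec.snd))) (Primrec.const none)).to₂

theorem computable_logAt {pos : SignedSum → Bool} (hpos : Computable pos) :
    Computable₂ (logAt pos) := by
  have hstep : Computable₂ fun (x : List Edge × ℕ) (p : ℕ × Log) =>
      logNext (x.1.foldl (logStep pos) p.2) := by
    refine primrec_logNext.to_comp.comp ?_
    exact computable_list_foldl (f := fun z : (List Edge × ℕ) × ℕ × Log => z.1.1)
      (g := fun z => z.2.2) (h := fun _ y => logStep pos y.1 y.2)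
      (Computable.fst.comp Computable.fst) (Computable.snd.comp Computable.snd)
      ((computable_logStep hpos).comp (Computable.fst.comp Computable.snd)
        (Computable.snd.comp Computable.snd)).to₂
  refine (Computable.nat_rec (f := fun x : List Edge × ℕ => x.2)
    (g := fun _ => [((0, false), (true, 0))]) Computable.snd (Computable.const _)
      hstep).of_eq fun x => ?_
  obtain ⟨E, t⟩ := x
  induction t with
  | zero => rfl
  | succ t ih => simp only at ih ⊢; rw [ih]; rfl

/-- The bits emitted in the cycles `1, …, t`. -/
def bitsUpto (pos : SignedSum → Bool) (E : List Edge) : ℕ → List Bool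
  | 0 => []
  | t + 1 => bitsUpto pos E t ++
    bif pos (collect (logAt pos E (t + 1)) (2, false)) then
      [pos (collect (logAt pos E (t + 1)) (3, false))] else []

theorem computable_bitsUpto {pos : SignedSum → Bool} (hpos : Computable pos) :
    Computable₂ (bitsUpto pos) := by
  have hv : ∀ i : ℕ, Computable₂ fun (x : List Edge × ℕ) (p : ℕ × List Bool) =>
      pos (collect (logAt pos x.1 (p.1 + 1)) (i, false)) := fun i =>
    hpos.comp (primrec_collect.to_comp.comp ((computable_logAt hpos).comp
      (Computable.fst.comp Computable.fst) (Computable.succ.comp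
        (Computable.fst.comp Computable.snd))) (Computable.const _))
  have hstep : Computable₂ fun (x : List Edge × ℕ) (p : ℕ × List Bool) =>
      p.2 ++ bif pos (collect (logAt pos x.1 (p.1 + 1)) (2, false)) then
        [pos (collect (logAt pos x.1 (p.1 + 1)) (3, false))] else [] :=
    Computable.list_append.comp (Computable.snd.comp Computable.snd)
      (Computable.cond (hv 2) (Computable.list_cons.comp (hv 3) (Computable.const []))
        (Computable.const []))
  refine (Computable.nat_rec (f := fun x : List Edge × ℕ => x.2)
    (g := fun _ => []) Computable.snd (Computable.const _) hstep).of_eq fun x => ?_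
  obtain ⟨E, t⟩ := x
  induction t with
  | zero => rfl
  | succ t ih => simp only at ih ⊢; rw [ih]; rfl

/-- Sparse programs can be run by a partial computable function. -/
theorem exists_partrec_run {δ : ℝ} (hδ : 0 < δ) (hc : IsComputableReal δ) :
    ∃ run : List Edge →. List Bool, Partrec run ∧
      ∀ E s, sparseOutputs δ E s → s ∈ run E := by
  obtain ⟨pos, hcomp, hpos⟩ := SignedSum.exists_computable_pos hδ hc
  have hhalt : Computable₂ fun (E : List Edge) (t : ℕ) =>
      pos (collect (logAt pos E (t + 1)) (1, false)) :=
    hcomp.comp (primrec_collect.to_comp.comp ((computable_logAt hcomp).comp Computable.fst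
      (Computable.succ.comp Computable.snd)) (Computable.const _))
  -- Cycle 0 is not observed, so the search tests cycle `t + 1`; on halting there the output
  -- consists of the bits of cycles `1, …, t`.
  refine ⟨fun E => (Nat.rfind fun t => Part.some
      (pos (collect (logAt pos E (t + 1)) (1, false)))).map fun t => bitsUpto pos E t,
    (Partrec.rfind hhalt.partrec₂).map (computable_bitsUpto hcomp), ?_⟩
  have hpos' : ∀ E t i, pos (collect (logAt pos E t) (i, false)) = true ↔
      0 < sparseState δ E t (i, false) := fun E t i => by
    rw [← logVal_logAt hpos]; exact hpos _
  rintro E s ⟨τ, h1, h2, h3, rfl⟩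
  obtain ⟨t, rfl⟩ : ∃ t, τ = t + 1 := ⟨τ - 1, by omega⟩
  refine (Part.mem_map_iff _).2 ⟨t, Nat.mem_rfind.2 ⟨?_, fun {m} hm => ?_⟩, ?_⟩
  · exact Part.mem_some_iff.2 ((hpos' _ _ _).2 h2).symm
  · refine Part.mem_some_iff.2 (Eq.symm (Bool.eq_false_iff.2 fun h => ?_))
    exact h3 (m + 1) (by omega) (by omega) ((hpos' _ _ _).1 h)
  · clear h1 h2 h3
    simp only [Nat.add_sub_cancel]
    induction t with
    | zero => rfl
    | succ t ih =>
      rw [bitsUpto, ih, List.range'_concat, List.flatMap_append]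
      congr 1
      simp only [List.flatMap_cons, List.flatMap_nil, List.append_nil, emittedAt, one_mul]
      rw [add_comm 1 t]
      by_cases h : 0 < sparseState δ E (t + 1) (2, false)
      · rw [if_pos h, (hpos' _ _ _).2 h, cond_true]
        congr 1
        rw [Bool.eq_iff_iff, hpos', decide_eq_true_iff]
      · rw [if_neg h, Bool.eq_false_iff.2 fun h' => h ((hpos' _ _ _).1 h'), cond_false]

end LoopedReLU
end

noncomputable section
namespace LoopedReLU

/-! ### Sparse programs from networks -/

/-- The contribution of an edge to a variable. -/
def contribution (δ : ℝ) (Y : ℕ × Bool → ℝ) (v : ℕ × Bool) (e : Edge) : ℝ :=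
  if v = (e.2.2, true) then sgn e.1 * (δ * act e.2.1.2 (Y e.2.1)) else 0

theorem edgeStep_apply (δ : ℝ) (Y : ℕ × Bool → ℝ) (e : Edge) (v : ℕ × Bool) :
    edgeStep δ Y e v = Y v + contribution δ Y v e := rfl

/-- If no edge reads a variable that is written, the edges act independently. -/
theorem foldl_edgeStep {δ : ℝ} (E : List Edge) (Y : ℕ × Bool → ℝ)
    (h : ∀ e ∈ E, ∀ e' ∈ E, e.2.1 ≠ (e'.2.2, true)) (v : ℕ × Bool) :
    E.foldl (edgeStep δ) Y v = Y v + (E.map (contribution δ Y v)).sum := by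
  induction E generalizing Y with
  | nil => simp
  | cons e E ih =>
    rw [List.foldl_cons, ih _ fun a ha b hb => h a (List.mem_cons_of_mem _ ha) b
      (List.mem_cons_of_mem _ hb), List.map_cons, List.sum_cons, edgeStep_apply, add_assoc]
    congr 3
    refine List.map_congr_left fun a ha => ?_
    have hne := h a (List.mem_cons_of_mem _ ha) e (List.mem_cons_self ..)
    simp [contribution, edgeStep, hne]

/-- The unit edges that make up a weight. -/
def weightEdges (δ w : ℝ) (src : ℕ × Bool) (tgt : ℕ) : List Edge :=
  -- Rounding recovers the integer `k` from a weight `w = δ * k`.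
  List.replicate (round (w / δ)).natAbs (decide (0 ≤ round (w / δ)), src, tgt)

theorem mem_weightEdges {δ w : ℝ} {src : ℕ × Bool} {tgt : ℕ} {e : Edge}
    (h : e ∈ weightEdges δ w src tgt) : e.2.1 = src ∧ e.2.2 = tgt := by
  obtain rfl := (List.mem_replicate.1 h).2
  exact ⟨rfl, rfl⟩

theorem round_div_of_eq {δ : ℝ} (hδ : 0 < δ) (k : ℤ) : round (δ * k / δ) = k := by
  rw [mul_div_cancel_left₀ _ hδ.ne', round_intCast]

theorem sum_contribution_weightEdges {δ w : ℝ} (hδ : 0 < δ) (hw : ∃ k : ℤ, w = δ * k)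
    (Y : ℕ × Bool → ℝ) (v src : ℕ × Bool) (tgt : ℕ) :
    ((weightEdges δ w src tgt).map (contribution δ Y v)).sum =
      if v = (tgt, true) then w * act src.2 (Y src) else 0 := by
  obtain ⟨k, rfl⟩ := hw
  rw [weightEdges, round_div_of_eq hδ, List.map_replicate, List.sum_replicate, contribution]
  split_ifs
  · have : ((k.natAbs : ℕ) : ℝ) * sgn (decide (0 ≤ k)) = k := by
      rcases le_total 0 k with h | h
      · rw [decide_eq_true h]
        have h2 : ((k.natAbs : ℕ) : ℝ) = k := by rw [Nat.cast_natAbs, abs_of_nonneg h]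
        simp [sgn, h2]
      · rcases h.eq_or_lt with rfl | h
        · simp
        · rw [decide_eq_false (not_le.2 h)]
          have h2 : ((k.natAbs : ℕ) : ℝ) = -k := by
            rw [Nat.cast_natAbs, abs_of_neg h, Int.cast_neg]
          simp [sgn, h2]
    rw [nsmul_eq_mul, ← mul_assoc, this]; ring
  · simp

theorem length_weightEdges_le {δ B w : ℝ} (hδ : 0 < δ) (hw : ∃ k : ℤ, w = δ * k) (hB : |w| ≤ B)
    (src : ℕ × Bool) (tgt : ℕ) :
    (weightEdges δ w src tgt).length ≤ ⌊B / δ⌋₊ * nonzeroCount w := by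
  obtain ⟨k, rfl⟩ := hw
  rw [weightEdges, round_div_of_eq hδ, List.length_replicate]
  by_cases hk : k = 0
  · simp [hk]
  · have h1 : δ * (k : ℝ) ≠ 0 := mul_ne_zero hδ.ne' (by exact_mod_cast hk)
    have : nonzeroCount (δ * (k : ℝ)) = 1 := by simp [nonzeroCount, h1]
    rw [this, mul_one]
    refine Nat.le_floor ?_
    rw [le_div_iff₀ hδ, Nat.cast_natAbs, Int.cast_abs, mul_comm]
    rwa [abs_mul, abs_of_pos hδ] at hB

/-- The edges of an affine layer. -/
def layerEdges (δ : ℝ) {m n : ℕ} (A : Matrix (Fin n) (Fin m) ℝ) (b : Fin n → ℝ)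
    (src : ℕ → ℕ × Bool) (tgt : ℕ → ℕ) : List Edge :=
  (List.finRange n).flatMap fun i =>
    ((List.finRange m).flatMap fun j => weightEdges δ (A i j) (src j) (tgt i)) ++
      weightEdges δ (b i) (0, false) (tgt i)

theorem mem_layerEdges {δ : ℝ} {m n : ℕ} {A : Matrix (Fin n) (Fin m) ℝ} {b : Fin n → ℝ}
    {src : ℕ → ℕ × Bool} {tgt : ℕ → ℕ} {e : Edge} (h : e ∈ layerEdges δ A b src tgt) :
    ((∃ j < m, e.2.1 = src j) ∨ e.2.1 = (0, false)) ∧ ∃ i < n, e.2.2 = tgt i := by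
  obtain ⟨i, _, h⟩ := List.mem_flatMap.1 h
  rcases List.mem_append.1 h with h | h
  · obtain ⟨j, _, h⟩ := List.mem_flatMap.1 h
    obtain ⟨h1, h2⟩ := mem_weightEdges h
    exact ⟨.inl ⟨j, j.2, h1⟩, i, i.2, h2⟩
  · obtain ⟨h1, h2⟩ := mem_weightEdges h
    exact ⟨.inr h1, i, i.2, h2⟩

theorem sum_map_flatMap {α β M : Type*} [AddCommMonoid M] (l : List α) (f : α → List β)
    (g : β → M) : ((l.flatMap f).map g).sum = (l.map fun a => ((f a).map g).sum).sum := by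
  induction l with
  | nil => simp
  | cons a l ih => simp [ih]

theorem sum_map_finRange {M : Type*} [AddCommMonoid M] (n : ℕ) (f : Fin n → M) :
    ((List.finRange n).map f).sum = ∑ i, f i := by
  rw [← List.ofFn_eq_map, List.sum_ofFn]

theorem mem_layerParams_weight {m n : ℕ} (A : Matrix (Fin n) (Fin m) ℝ) (b : Fin n → ℝ)
    (i : Fin n) (j : Fin m) : A i j ∈ layerParams A b :=
  Multiset.mem_add.2 (.inl (Multiset.mem_map.2 ⟨(i, j), Finset.mem_univ (i, j), rfl⟩))

theorem mem_layerParams_bias {m n : ℕ} (A : Matrix (Fin n) (Fin m) ℝ) (b : Fin n → ℝ)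
    (i : Fin n) : b i ∈ layerParams A b :=
  Multiset.mem_add.2 (.inr (Multiset.mem_map.2 ⟨i, Finset.mem_univ i, rfl⟩))

theorem length_layerEdges_le {δ B : ℝ} (hδ : 0 < δ) {m n : ℕ} {A : Matrix (Fin n) (Fin m) ℝ}
    {b : Fin n → ℝ} (h : ∀ w ∈ layerParams A b, (∃ k : ℤ, w = δ * k) ∧ |w| ≤ B)
    (src : ℕ → ℕ × Bool) (tgt : ℕ → ℕ) :
    (layerEdges δ A b src tgt).length ≤
      ⌊B / δ⌋₊ * ((layerParams A b).map nonzeroCount).sum := by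
  rw [sum_map_layerParams, mul_add, Finset.mul_sum, Finset.mul_sum, ← Finset.sum_add_distrib]
  have hA : ∀ i j, (∃ k : ℤ, A i j = δ * k) ∧ |A i j| ≤ B := fun i j => h _ (mem_layerParams_weight A b i j)
  have hb : ∀ i, (∃ k : ℤ, b i = δ * k) ∧ |b i| ≤ B := fun i => h _ (mem_layerParams_bias A b i)
  rw [layerEdges, List.length_flatMap, sum_map_finRange]
  refine Finset.sum_le_sum fun i _ => ?_
  rw [List.length_append, List.length_flatMap, sum_map_finRange, Finset.mul_sum]
  exact add_le_add (Finset.sum_le_sum fun j _ =>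
    length_weightEdges_le hδ (hA i j).1 (hA i j).2 _ _)
    (length_weightEdges_le hδ (hb i).1 (hb i).2 _ _)

/-- A layer adds its output to the variables of its target units. -/
theorem foldl_layerEdges {δ : ℝ} (hδ : 0 < δ) {m n : ℕ} {A : Matrix (Fin n) (Fin m) ℝ}
    {b : Fin n → ℝ} (hp : ∀ w ∈ layerParams A b, ∃ k : ℤ, w = δ * k)
    {src : ℕ → ℕ × Bool} {tgt : ℕ → ℕ} (hst : ∀ j < m, ∀ i < n, src j ≠ (tgt i, true))
    {Y : ℕ × Bool → ℝ} (h1 : Y (0, false) = 1) {x : Fin m → ℝ}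
    (hx : ∀ j : Fin m, act (src j).2 (Y (src j)) = x j) (htgt : ∀ i < n, ∀ j < n, tgt i = tgt j → i = j)
    (i : Fin n) :
    (layerEdges δ A b src tgt).foldl (edgeStep δ) Y (tgt i, true) =
      Y (tgt i, true) + (A.mulVec x + b) i := by
  have hA : ∀ i j, ∃ k : ℤ, A i j = δ * k := fun i j => hp _ (mem_layerParams_weight A b i j)
  have hb : ∀ i, ∃ k : ℤ, b i = δ * k := fun i => hp _ (mem_layerParams_bias A b i)
  rw [foldl_edgeStep]
  · congr 1
    rw [layerEdges, sum_map_flatMap, sum_map_finRange, Finset.sum_eq_single_of_mem i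
      (Finset.mem_univ _)]
    · rw [List.map_append, List.sum_append, sum_map_flatMap, sum_map_finRange,
        sum_contribution_weightEdges hδ (hb i), if_pos rfl, h1]
      simp only [sum_contribution_weightEdges hδ (hA i _), if_true, hx]
      simp [act, Matrix.mulVec, dotProduct]
    · intro k _ hk
      have hne : ((tgt i, true) : ℕ × Bool) ≠ (tgt k, true) := fun h =>
        hk (Fin.ext (htgt _ k.2 _ i.2 (Prod.mk.inj h).1.symm))
      rw [List.map_append, List.sum_append, sum_map_flatMap, sum_map_finRange,
        sum_contribution_weightEdges hδ (hb k), if_neg hne]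
      simp [sum_contribution_weightEdges hδ (hA k _), hne]
  -- The constant `(0, false)` is never written, and sources are not targets by `hst`; hence the
  -- edges of one layer act independently.
  · intro e he e' he' heq
    obtain ⟨h2, -⟩ := mem_layerEdges he
    obtain ⟨-, i', hi', h3⟩ := mem_layerEdges he'
    rw [h3] at heq
    rcases h2 with ⟨j, hj, h2⟩ | h2
    · exact hst j hj i' hi' (h2.symm.trans heq)
    · rw [h2] at heq; simp at heq

theorem foldl_edgeStep_of_forall_ne {δ : ℝ} {E : List Edge} {v : ℕ × Bool}
    (h : ∀ e ∈ E, v ≠ (e.2.2, true)) (Y : ℕ × Bool → ℝ) : E.foldl (edgeStep δ) Y v = Y v := by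
  induction E generalizing Y with
  | nil => rfl
  | cons e E ih =>
    rw [List.foldl_cons, ih fun e he => h e (List.mem_cons_of_mem _ he)]
    simp [edgeStep, h e (List.mem_cons_self ..)]

/-- The name of a hidden unit in a network with `n` outputs. -/
def hiddenName (n l i : ℕ) : ℕ := n + 1 + Nat.pair l i

/-- The edges of a feedforward network. -/
def netEdges (δ : ℝ) : {m n : ℕ} → FFN m n → (ℕ → ℕ × Bool) → ℕ → List Edge
  | _, _, .last A b, src, _ => layerEdges δ A b src (· + 1)
  | _, n, .layer A b N, src, l => layerEdges δ A b src (hiddenName n l) ++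
      netEdges δ N (fun i => (hiddenName n l i, true)) (l + 1)

theorem length_netEdges_le {δ B : ℝ} (hδ : 0 < δ) {m n : ℕ} (N : FFN m n)
    (h : ∀ w ∈ N.params, (∃ k : ℤ, w = δ * k) ∧ |w| ≤ B) (src : ℕ → ℕ × Bool) (l : ℕ) :
    (netEdges δ N src l).length ≤ ⌊B / δ⌋₊ * (N.params.map nonzeroCount).sum := by
  induction N generalizing src l with
  | last A b => exact length_layerEdges_le hδ h _ _
  | layer A b N ih =>
    rw [netEdges, List.length_append, FFN.params, Multiset.map_add, Multiset.sum_add, mul_add]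
    exact add_le_add (length_layerEdges_le hδ (fun w hw => h w (Multiset.mem_add.2 (.inl hw))) _ _)
      (ih (fun w hw => h w (Multiset.mem_add.2 (.inr hw))) _ _)

/-- Names of hidden units contain the layer index, so when a layer is evaluated its targets are
still zero and its sources are final. The ReLU is the rectification that comes with reading a
variable flagged `true`. -/
theorem foldl_netEdges {δ : ℝ} (hδ : 0 < δ) {m n : ℕ} (N : FFN m n)
    (hp : ∀ w ∈ N.params, ∃ k : ℤ, w = δ * k) (src : ℕ → ℕ × Bool) (l : ℕ)
    (hs1 : ∀ j, ∀ i < n, src j ≠ (i + 1, true))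
    (hs2 : ∀ j, ∀ l' ≥ l, ∀ i, src j ≠ (hiddenName n l' i, true))
    (Y : ℕ × Bool → ℝ) (h1 : Y (0, false) = 1) (x : Fin m → ℝ)
    (hx : ∀ j : Fin m, act (src j).2 (Y (src j)) = x j) (hY1 : ∀ i < n, Y (i + 1, true) = 0)
    (hY2 : ∀ l' ≥ l, ∀ i, Y (hiddenName n l' i, true) = 0) (i : Fin n) :
    (netEdges δ N src l).foldl (edgeStep δ) Y (i + 1, true) = N.eval x i := by
  induction N generalizing src l Y with
  | last A b =>
    rw [netEdges, FFN.eval]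
    have := foldl_layerEdges hδ hp (tgt := (· + 1)) (fun j _ => hs1 j) h1 hx
      (fun i _ j _ h => by simpa using h) i
    rw [this, hY1 _ i.2, zero_add]
  | @layer m h n A b N ih =>
    rw [netEdges, FFN.eval, List.foldl_append]
    have hout : ∀ v : ℕ × Bool, (∀ i, v ≠ (hiddenName n l i, true)) →
        (layerEdges δ A b src (hiddenName n l)).foldl (edgeStep δ) Y v = Y v := fun v hv =>
      foldl_edgeStep_of_forall_ne (fun e he => by
        obtain ⟨-, i, -, hi⟩ := mem_layerEdges he
        rw [hi]; exact hv i) _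
    refine ih (fun w hw => hp w (Multiset.mem_add.2 (.inr hw))) _ _ ?_ ?_ _ ?_ _ ?_ ?_ ?_ i
    · intro j i hi h
      simp only [hiddenName, Prod.mk.injEq, and_true] at h
      omega
    · intro j l' hl' i h
      simp only [hiddenName, Prod.mk.injEq, and_true, Nat.add_left_cancel_iff, Nat.pair_eq_pair] at h
      omega
    · rw [hout _ (by simp), h1]
    · intro j
      rw [foldl_layerEdges hδ (fun w hw => hp w (Multiset.mem_add.2 (.inl hw)))
        (fun j _ i _ => hs2 j l le_rfl i) h1 hx
        (fun i _ j _ h => by simpa [hiddenName, Nat.pair_eq_pair] using h) j,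
        hY2 l le_rfl, zero_add]
      rfl
    · intro i hi
      rw [hout _ (fun k h => by simp only [hiddenName, Prod.mk.injEq, and_true] at h; omega),
        hY1 i hi]
    · intro l' hl' i
      rw [hout _ (fun k h => by
        simp only [hiddenName, Prod.mk.injEq, and_true, Nat.add_left_cancel_iff,
          Nat.pair_eq_pair] at h
        omega), hY2 l' (by omega)]

/-- The sparse program of a looped network. -/
def LoopedNet.edges (θ : LoopedNet) (δ : ℝ) : List Edge :=
  netEdges δ θ.block (fun j => (j + 1, false)) 0

theorem LoopedNet.sparseState_edges {δ : ℝ} (hδ : 0 < δ) (θ : LoopedNet)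
    (hp : ∀ w ∈ θ.block.params, ∃ k : ℤ, w = δ * k) (t : ℕ) (i : Fin θ.n) :
    sparseState δ (θ.edges δ) t (i + 1, false) = θ.state t i := by
  have h1 : ∀ t, sparseState δ (θ.edges δ) t (0, false) = 1 := by
    rintro (_ | t) <;> simp [sparseState, startState, nextState]
  have h2 : ∀ t k, sparseState δ (θ.edges δ) t (k, true) = 0 := by
    rintro (_ | t) k <;> simp [sparseState, startState, nextState]
  induction t generalizing i with
  | zero => simp [sparseState, startState, LoopedNet.state]
  | succ t ih =>
    rw [LoopedNet.state, Function.iterate_succ_apply', sparseState, nextState]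
    simp only [Bool.false_eq_true, if_false, Nat.add_eq_zero_iff, one_ne_zero, and_false]
    exact foldl_netEdges hδ θ.block hp (fun j => (j + 1, false)) 0 (by simp) (by simp) _ (h1 t) _
      (fun j => ih j)
      (fun _ _ => h2 t _) (fun _ _ _ => h2 t _) i

theorem LoopedNet.sparseOutputs_edges {δ : ℝ} (hδ : 0 < δ) (θ : LoopedNet)
    (hp : ∀ w ∈ θ.block.params, ∃ k : ℤ, w = δ * k) {s : List Bool} (hs : θ.Outputs s) :
    sparseOutputs δ (θ.edges δ) s := by
  rw [LoopedNet.outputs_iff] at hs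
  unfold sparseOutputs
  have h3 := θ.three_le
  convert hs using 1
  · funext t; exact θ.sparseState_edges hδ hp t ⟨0, by omega⟩
  · funext t; exact θ.sparseState_edges hδ hp t ⟨1, by omega⟩
  · funext t; exact θ.sparseState_edges hδ hp t ⟨2, by omega⟩

/-! ### Renaming variables -/

/-- An edge with renamed variables. -/
def Edge.rename (ρ : ℕ → ℕ) (e : Edge) : Edge := (e.1, (ρ e.2.1.1, e.2.1.2), ρ e.2.2)

/-- The dynamics only compares names with each other and with 0, so it commutes with renamings that
are injective on the names in use and fix 0. -/
theorem sparseState_rename {δ : ℝ} {E : List Edge} {S : Finset ℕ} {ρ : ℕ → ℕ}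
    (hρ : Set.InjOn ρ S) (h0 : 0 ∈ S) (hρ0 : ρ 0 = 0)
    (hE : ∀ e ∈ E, e.2.1.1 ∈ S ∧ e.2.2 ∈ S) (t : ℕ) {i : ℕ} (hi : i ∈ S) (b : Bool) :
    sparseState δ (E.map (Edge.rename ρ)) t (ρ i, b) = sparseState δ E t (i, b) := by
  have hz : ∀ i ∈ S, ρ i = 0 ↔ i = 0 := fun i hi =>
    ⟨fun h => hρ hi h0 (h.trans hρ0.symm), fun h => h ▸ hρ0⟩
  have hfold : ∀ (E : List Edge), (∀ e ∈ E, e.2.1.1 ∈ S ∧ e.2.2 ∈ S) →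
      ∀ Y Y' : ℕ × Bool → ℝ, (∀ i ∈ S, ∀ b, Y' (ρ i, b) = Y (i, b)) →
      ∀ i ∈ S, ∀ b, (E.map (Edge.rename ρ)).foldl (edgeStep δ) Y' (ρ i, b) =
        E.foldl (edgeStep δ) Y (i, b) := by
    intro E
    induction E with
    | nil => intro _ Y Y' h; exact h
    | cons e E ih =>
      intro hE Y Y' h
      rw [List.map_cons, List.foldl_cons, List.foldl_cons]
      refine ih (fun e he => hE e (List.mem_cons_of_mem _ he)) _ _ fun i hi b => ?_
      obtain ⟨he1, he2⟩ := hE e (List.mem_cons_self ..)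
      have h3 : ((ρ i, b) : ℕ × Bool) = (ρ e.2.2, true) ↔ (i, b) = (e.2.2, true) := by
        simp only [Prod.mk.injEq]
        exact and_congr_left fun _ => ⟨fun h => hρ hi he2 h, fun h => h ▸ rfl⟩
      simp only [edgeStep, Edge.rename, h i hi, h3, h _ he1, Prod.mk.eta]
  induction t generalizing i b with
  | zero => simp [sparseState, startState, hz i hi]
  | succ t ih =>
    simp only [sparseState, nextState, hz i hi]
    rw [hfold E hE _ _ (fun i hi b => ih hi b) i hi true]

/-- The variables of a program, and the four reserved ones. -/
def names (E : List Edge) : Finset ℕ :=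
  Finset.range 4 ∪ (E.map fun e => e.2.1.1).toFinset ∪ (E.map fun e => e.2.2).toFinset

theorem card_names_le (E : List Edge) : (names E).card ≤ 2 * E.length + 4 := by
  refine (Finset.card_union_le _ _).trans ?_
  have h1 := Finset.card_union_le (Finset.range 4) (E.map fun e => e.2.1.1).toFinset
  have h2 := List.toFinset_card_le (E.map fun e => e.2.1.1)
  have h3 := List.toFinset_card_le (E.map fun e => e.2.2)
  simp only [List.length_map, Finset.card_range] at h1 h2 h3
  omega

/-- Hidden names may be arbitrarily large, as depth and widths are unrestricted. Replacing them by
numbers linear in the number of edges makes a name cost logarithmically many bits. -/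
theorem exists_rename (δ : ℝ) (E : List Edge) : ∃ E' : List Edge, E'.length = E.length ∧
    (∀ e ∈ E', e.2.1.1 < 2 * E.length + 4 ∧ e.2.2 < 2 * E.length + 4) ∧
    ∀ s, sparseOutputs δ E s → sparseOutputs δ E' s := by
  set S := names E with hS
  have h4 : ∀ i < 4, i ∈ S := fun i hi => by simp [hS, names, hi]
  have hE : ∀ e ∈ E, e.2.1.1 ∈ S ∧ e.2.2 ∈ S := fun e he => by
    constructor
    · refine Finset.mem_union_left _ (Finset.mem_union_right _ ?_)
      exact List.mem_toFinset.2 (List.mem_map.2 ⟨e, he, rfl⟩)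
    · refine Finset.mem_union_right _ ?_
      exact List.mem_toFinset.2 (List.mem_map.2 ⟨e, he, rfl⟩)
  -- The rank within `S`. It fixes `0, 1, 2, 3` because these belong to `S`, so the constant and the
  -- channels keep their places.
  set ρ : ℕ → ℕ := Nat.count (· ∈ S) with hρ
  have hinj : Set.InjOn ρ S := fun i hi j hj h => Nat.count_injective hi hj h
  have hfix : ∀ i ≤ 4, ρ i = i := by
    intro i
    induction i with
    | zero => intro _; simp [hρ]
    | succ i ih =>
      intro hi
      rw [hρ, Nat.count_succ, if_pos (h4 i (by omega))]
      rw [hρ] at ih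
      rw [ih (by omega)]
  have hlt : ∀ i ∈ S, ρ i < 2 * E.length + 4 := by
    intro i hi
    refine lt_of_lt_of_le ?_ (card_names_le E)
    rw [hρ, Nat.count_eq_card_filter_range]
    refine Finset.card_lt_card (Finset.ssubset_iff_of_subset ?_ |>.2 ⟨i, hi, by simp⟩)
    intro j hj
    exact (Finset.mem_filter.1 hj).2
  refine ⟨E.map (Edge.rename ρ), by simp, ?_, fun s hs => ?_⟩
  · intro e he
    obtain ⟨e, he', rfl⟩ := List.mem_map.1 he
    exact ⟨hlt _ (hE e he').1, hlt _ (hE e he').2⟩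
  · have key : ∀ i < 4, ∀ t, sparseState δ (E.map (Edge.rename ρ)) t (i, false) =
        sparseState δ E t (i, false) := by
      intro i hi t
      have := sparseState_rename (δ := δ) hinj (h4 0 (by omega)) (hfix 0 (by omega)) hE t (h4 i hi)
        false
      rwa [hfix i (by omega)] at this
    unfold sparseOutputs at hs ⊢
    convert hs using 1
    · funext t; exact key 1 (by omega) t
    · funext t; exact key 2 (by omega) t
    · funext t; exact key 3 (by omega) t

/-- The output of a network is computed by a sparse program that is not much larger. -/
theorem LoopedNet.exists_program {δ B : ℝ} (hδ : 0 < δ) (θ : LoopedNet) (hθ : θ.HasPrecision δ B)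
    {s : List Bool} (hs : θ.Outputs s) : ∃ E : List Edge, E.length ≤ ⌊B / δ⌋₊ * θ.l0 ∧
      (∀ e ∈ E, e.2.1.1 < 2 * E.length + 4 ∧ e.2.2 < 2 * E.length + 4) ∧ sparseOutputs δ E s := by
  obtain ⟨E, h1, h2, h3⟩ := exists_rename δ (θ.edges δ)
  refine ⟨E, ?_, h1 ▸ h2, h3 s (θ.sparseOutputs_edges hδ (fun w hw => (hθ w hw).1) hs)⟩
  rw [h1, LoopedNet.l0_eq]
  exact length_netEdges_le hδ θ.block hθ _ _

end LoopedReLU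
end

/-! ### Self-delimiting programs from networks -/

noncomputable section
namespace LoopedReLU

/-! ### Self-delimiting codes -/

/-- The number of leading ones of a word. -/
def leadingOnes (p : List Bool) : ℕ := (p.takeWhile id).length

theorem leadingOnes_append (b : ℕ) (w : List Bool) :
    leadingOnes (List.replicate b true ++ false :: w) = b := by
  induction b with
  | zero => rfl
  | succ b ih =>
    rw [List.replicate_succ, List.cons_append, leadingOnes, List.takeWhile_cons_of_pos rfl,
      List.length_cons]
    exact congrArg (· + 1) ih

/-- The hypothesis says that the zero ending the block of ones already lies in `p`. -/
theorem leadingOnes_eq_of_initial {p q : List Bool} (h : p <+: q) (hp : leadingOnes p < p.length) :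
    leadingOnes p = leadingOnes q := by
  induction p generalizing q with
  | nil => simp at hp
  | cons a p ih =>
    obtain ⟨r, rfl⟩ := h
    cases a with
    | false => rfl
    | true =>
      have h1 : ∀ l, leadingOnes (true :: l) = leadingOnes l + 1 := fun l => rfl
      rw [List.cons_append, h1, h1]
      rw [h1, List.length_cons] at hp
      rw [ih (List.prefix_append p r) (by omega)]

theorem primrec_leadingOnes : Primrec leadingOnes :=
  Primrec.list_length.comp (Primrec.list_takeWhile Primrec.id)

/-- Words `1^b 0 w`, where the length of `w` is a function of `b`, form a prefix-free set. -/
theorem exists_prefixFree {g : ℕ × List Bool →. List Bool} (hg : Partrec g) {L : ℕ → ℕ}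
    (hL : Primrec L) : ∃ φ : List Bool →. List Bool, Partrec φ ∧ IsPrefixFree φ ∧
      ∀ b w s, w.length = L b → s ∈ g (b, w) → s ∈ φ (List.replicate b true ++ false :: w) := by
  let good : List Bool → Bool := fun p => decide (p.length = leadingOnes p + 1 + L (leadingOnes p))
  have hgood : Primrec good := (Primrec.eq.comp Primrec.list_length
    (Primrec.nat_add.comp (Primrec.succ.comp primrec_leadingOnes)
      (hL.comp primrec_leadingOnes))).decide
  refine ⟨fun p => bif good p then g (leadingOnes p, p.drop (leadingOnes p + 1)) else Part.none,
    Partrec.cond hgood.to_comp (hg.comp (primrec_leadingOnes.pair (Primrec.list_drop.comp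
      (Primrec.succ.comp primrec_leadingOnes) Primrec.id)).to_comp) Partrec.none, ?_, ?_⟩
  · have hdom : ∀ p, (bif good p then g (leadingOnes p, p.drop (leadingOnes p + 1))
        else Part.none : Part (List Bool)).Dom →
        p.length = leadingOnes p + 1 + L (leadingOnes p) := by
      intro p hp
      by_contra h
      have : good p = false := decide_eq_false h
      rw [this] at hp
      exact hp
    intro p q hp hq hpq
    have h1 := hdom p hp
    have h2 := hdom q hq
    have h3 := leadingOnes_eq_of_initial hpq (by omega)
    rw [← h3] at h2
    exact hpq.eq_of_length (h1.trans h2.symm)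
  · intro b w s hw hs
    have h1 : good (List.replicate b true ++ false :: w) = true := by
      refine decide_eq_true ?_
      rw [leadingOnes_append]
      simp [hw]; omega
    have h2 : (List.replicate b true ++ false :: w).drop (b + 1) = w := by
      rw [List.drop_append]; simp
    simpa only [h1, leadingOnes_append, h2, cond_true] using hs

theorem IsUniversalPrefixMachine.exists_bound {U : List Bool →. List Bool}
    (hU : IsUniversalPrefixMachine U) {g : ℕ × List Bool →. List Bool} (hg : Partrec g) {L : ℕ → ℕ}
    (hL : Primrec L) : ∃ c : ℕ, ∀ b w s, w.length = L b → s ∈ g (b, w) →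
      ∃ q, s ∈ U q ∧ q.length ≤ b + 1 + L b + c := by
  obtain ⟨φ, h1, h2, h3⟩ := exists_prefixFree hg hL
  obtain ⟨c, hc⟩ := hU.universal φ h1 h2
  refine ⟨c, fun b w s hw hs => ?_⟩
  obtain ⟨q, hq, hq'⟩ := hc _ _ (h3 b w s hw hs)
  refine ⟨q, hq, hq'.trans ?_⟩
  simp only [List.length_append, List.length_replicate, List.length_cons]
  omega

/-- A universal machine outputs every word. -/
theorem IsUniversalPrefixMachine.exists_program {U : List Bool →. List Bool}
    (hU : IsUniversalPrefixMachine U) (s : List Bool) : ∃ q, s ∈ U q := by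
  -- With payload length 0, the unary prefix alone codes the word.
  have hg : Partrec fun x : ℕ × List Bool =>
      (Encodable.decode (α := List Bool) x.1 : Part (List Bool)) :=
    Computable.ofOption (Computable.decode.comp Computable.fst)
  obtain ⟨c, hc⟩ := hU.exists_bound hg (Primrec.const 0)
  obtain ⟨q, hq, -⟩ := hc (Encodable.encode s) [] s rfl (by simp)
  exact ⟨q, hq⟩

/-- The number with the given binary digits. -/
def bitsNum (w : List Bool) : ℕ := w.foldr (fun b n => 2 * n + b.toNat) 0

theorem exists_bitsNum (g n : ℕ) (hn : n < 2 ^ g) : ∃ w : List Bool, w.length = g ∧ bitsNum w = n := by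
  induction g generalizing n with
  | zero => exact ⟨[], rfl, by simp at hn; simp [bitsNum, hn]⟩
  | succ g ih =>
    obtain ⟨w, h1, h2⟩ := ih (n / 2) (by rw [pow_succ] at hn; omega)
    refine ⟨decide (n % 2 = 1) :: w, by simp [h1], ?_⟩
    change 2 * bitsNum w + (decide (n % 2 = 1)).toNat = n
    rw [h2]
    by_cases h : n % 2 = 1
    · simp [h]; omega
    · simp [h]; omega

theorem primrec_bitsNum : Primrec bitsNum :=
  Primrec.list_foldr (h := fun _ (x : Bool × ℕ) => 2 * x.2 + x.1.toNat) Primrec.id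
    (Primrec.const 0)
    (Primrec.nat_add.comp (Primrec.nat_mul.comp (Primrec.const 2) (Primrec.snd.comp Primrec.snd))
      ((Primrec.dom_bool Bool.toNat).comp (Primrec.fst.comp Primrec.snd))).to₂

/-! ### Coding sparse programs -/

/-- The edge with names below `2 ^ b` coded by a positive number. -/
def decodeEdge (b d : ℕ) : Option Edge :=
  if d = 0 then none else
    some (decide ((d - 1) % 2 = 1),
      ((d - 1) / 4 % 2 ^ b, decide ((d - 1) / 2 % 2 = 1)), (d - 1) / 4 / 2 ^ b)

theorem exists_decodeEdge {b : ℕ} {e : Edge} (h1 : e.2.1.1 < 2 ^ b) (h2 : e.2.2 < 2 ^ b) :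
    ∃ d < 2 ^ (2 * b + 3), decodeEdge b d = some e := by
  obtain ⟨s, ⟨i, r⟩, j⟩ := e
  simp only at h1 h2
  have hm : j * 2 ^ b + i < 2 ^ b * 2 ^ b := by
    calc j * 2 ^ b + i < j * 2 ^ b + 2 ^ b := by omega
      _ = (j + 1) * 2 ^ b := by ring
      _ ≤ 2 ^ b * 2 ^ b := Nat.mul_le_mul_right _ h2
  set m := j * 2 ^ b + i with hmdef
  have hmod : m % 2 ^ b = i := by
    rw [hmdef, add_comm, Nat.add_mul_mod_self_right, Nat.mod_eq_of_lt h1]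
  have hdiv : m / 2 ^ b = j := by
    rw [hmdef, mul_comm, Nat.mul_add_div (by positivity), Nat.div_eq_of_lt h1, add_zero]
  have hpow : 2 ^ (2 * b + 3) = 8 * (2 ^ b * 2 ^ b) := by ring
  -- Two names of `b` bits and two flags; the shift by one reserves 0 for "no edge" and costs the
  -- third extra bit.
  refine ⟨4 * m + 2 * r.toNat + s.toNat + 1, ?_, ?_⟩
  · rw [hpow]; cases r <;> cases s <;> simp <;> omega
  · have h4 : (4 * m + 2 * r.toNat + s.toNat) / 4 = m := by cases r <;> cases s <;> simp <;> omega
    have h5 : (4 * m + 2 * r.toNat + s.toNat) % 2 = s.toNat := by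
      cases r <;> cases s <;> simp <;> omega
    have h6 : (4 * m + 2 * r.toNat + s.toNat) / 2 % 2 = r.toNat := by
      cases r <;> cases s <;> simp <;> omega
    rw [decodeEdge, if_neg (by omega), Nat.add_sub_cancel, h4, h5, h6, hmod, hdiv]
    cases r <;> cases s <;> rfl

/-- The program with names below `2 ^ b` and at most `2 ^ b` edges coded by a number. -/
def decodeEdges (b n : ℕ) : List Edge :=
  (List.range (2 ^ b)).filterMap fun i =>
    decodeEdge b (n / (2 ^ (2 * b + 3)) ^ i % 2 ^ (2 * b + 3))

theorem ofDigits_div_pow_mod {B : ℕ} (hB : 0 < B) (D : List ℕ) (hD : ∀ d ∈ D, d < B) (i : ℕ) :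
    Nat.ofDigits B D / B ^ i % B = D.getD i 0 := by
  induction D generalizing i with
  | nil => simp
  | cons d D ih =>
    have hd : d < B := hD d (List.mem_cons_self ..)
    rw [Nat.ofDigits_cons]
    cases i with
    | zero => simp [Nat.mod_eq_of_lt hd]
    | succ i =>
      rw [pow_succ', ← Nat.div_div_eq_div_mul, Nat.add_mul_div_left _ _ hB, Nat.div_eq_of_lt hd,
        zero_add, ih fun d hd => hD d (List.mem_cons_of_mem _ hd)]
      simp

theorem filterMap_range_getD {α : Type*} (f : ℕ → Option α) (hf : f 0 = none) (D : List ℕ) (N : ℕ)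
    (hN : D.length ≤ N) : (List.range N).filterMap (fun i => f (D.getD i 0)) = D.filterMap f := by
  induction D generalizing N with
  | nil => simp [hf]
  | cons d D ih =>
    obtain ⟨N, rfl⟩ : ∃ k, N = k + 1 := ⟨N - 1, by rw [List.length_cons] at hN; omega⟩
    rw [List.length_cons] at hN
    rw [List.range_succ_eq_map, List.filterMap_cons, List.filterMap_map, List.filterMap_cons,
      ← ih N (by omega)]
    rfl

/-- Missing edges correspond to digits 0, which decode to nothing. Thus the length of the code
depends on `b` only, as `exists_prefixFree` requires. -/
theorem exists_decodeEdges {b : ℕ} {E : List Edge} (hE : E.length ≤ 2 ^ b)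
    (h : ∀ e ∈ E, e.2.1.1 < 2 ^ b ∧ e.2.2 < 2 ^ b) :
    ∃ n < 2 ^ ((2 * b + 3) * 2 ^ b), decodeEdges b n = E := by
  have : ∃ D : List ℕ, D.length = E.length ∧ (∀ d ∈ D, d < 2 ^ (2 * b + 3)) ∧
      D.filterMap (decodeEdge b) = E := by
    clear hE
    induction E with
    | nil => exact ⟨[], rfl, by simp, rfl⟩
    | cons e E ih =>
      obtain ⟨D, h1, h2, h3⟩ := ih fun e he => h e (List.mem_cons_of_mem _ he)
      obtain ⟨he1, he2⟩ := h e (List.mem_cons_self ..)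
      obtain ⟨d, hd, hd'⟩ := exists_decodeEdge he1 he2
      refine ⟨d :: D, by simp [h1], ?_, ?_⟩
      · intro x hx
        rcases List.mem_cons.1 hx with rfl | hx
        exacts [hd, h2 x hx]
      · rw [List.filterMap_cons_some hd', h3]
  obtain ⟨D, h1, h2, h3⟩ := this
  have hB : 1 < 2 ^ (2 * b + 3) := Nat.one_lt_two_pow (by omega)
  refine ⟨Nat.ofDigits (2 ^ (2 * b + 3)) D, ?_, ?_⟩
  · rw [pow_mul]
    exact (Nat.ofDigits_lt_base_pow_length hB h2).trans_le
      (Nat.pow_le_pow_right (by omega) (h1.trans_le hE))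
  · unfold decodeEdges
    simp only [ofDigits_div_pow_mod (by omega) D h2]
    rw [filterMap_range_getD _ (by simp [decodeEdge]) _ _ (h1.trans_le hE), h3]

theorem primrec_decodeEdge : Primrec₂ decodeEdge := by
  have hd : Primrec fun x : ℕ × ℕ => x.2 - 1 := Primrec.pred.comp Primrec.snd
  have hp : Primrec fun x : ℕ × ℕ => 2 ^ x.1 := primrec_nat_pow.comp (Primrec.const 2) Primrec.fst
  have h4 : Primrec fun x : ℕ × ℕ => (x.2 - 1) / 4 := Primrec.nat_div.comp hd (Primrec.const 4)
  have h2 : Primrec fun x : ℕ × ℕ => (x.2 - 1) / 2 := Primrec.nat_div.comp hd (Primrec.const 2)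
  have hbit : ∀ {f : ℕ × ℕ → ℕ}, Primrec f → Primrec fun x => decide (f x % 2 = 1) := fun hf =>
    (Primrec.eq.comp (Primrec.nat_mod.comp hf (Primrec.const 2)) (Primrec.const 1)).decide
  exact Primrec.ite (Primrec.eq.comp Primrec.snd (Primrec.const 0)) (Primrec.const none)
    (Primrec.option_some.comp ((hbit hd).pair (((Primrec.nat_mod.comp h4 hp).pair (hbit h2)).pair
      (Primrec.nat_div.comp h4 hp))))

theorem primrec_decodeEdges : Primrec₂ decodeEdges := by
  have hb : Primrec fun z : (ℕ × ℕ) × ℕ => z.1.1 := Primrec.fst.comp Primrec.fst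
  have hB : Primrec fun z : (ℕ × ℕ) × ℕ => 2 ^ (2 * z.1.1 + 3) :=
    primrec_nat_pow.comp (Primrec.const 2)
      (Primrec.nat_add.comp (Primrec.nat_mul.comp (Primrec.const 2) hb) (Primrec.const 3))
  refine Primrec.listFilterMap (f := fun x : ℕ × ℕ => List.range (2 ^ x.1))
    (Primrec.list_range.comp (primrec_nat_pow.comp (Primrec.const 2) Primrec.fst)) ?_
  exact primrec_decodeEdge.comp hb (Primrec.nat_mod.comp (Primrec.nat_div.comp
    (Primrec.snd.comp Primrec.fst) (primrec_nat_pow.comp hB Primrec.snd)) hB)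

/-- The output of a network has a program whose length is bounded in terms of the number of
parameters. -/
theorem exists_program_of_net {δ B : ℝ} (hδ : 0 < δ) (hc : IsComputableReal δ)
    {U : List Bool →. List Bool} (hU : IsUniversalPrefixMachine U) :
    ∃ c : ℕ, ∀ (θ : LoopedNet) (s : List Bool), θ.HasPrecision δ B → θ.Outputs s →
      ∀ b : ℕ, 2 * (⌊B / δ⌋₊ * θ.l0) + 4 ≤ 2 ^ b →
        ∃ q, s ∈ U q ∧ q.length ≤ b + 1 + (2 * b + 3) * 2 ^ b + c := by
  obtain ⟨run, hrun, hspec⟩ := exists_partrec_run hδ hc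
  have hg : Partrec fun x : ℕ × List Bool => run (decodeEdges x.1 (bitsNum x.2)) :=
    hrun.comp (primrec_decodeEdges.comp Primrec.fst (primrec_bitsNum.comp Primrec.snd)).to_comp
  have hL : Primrec fun b : ℕ => (2 * b + 3) * 2 ^ b :=
    Primrec.nat_mul.comp (Primrec.nat_add.comp (Primrec.nat_mul.comp (Primrec.const 2) Primrec.id)
      (Primrec.const 3)) (primrec_nat_pow.comp (Primrec.const 2) Primrec.id)
  obtain ⟨c, hc⟩ := hU.exists_bound hg hL
  refine ⟨c, fun θ s hθ hs b hb => ?_⟩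
  obtain ⟨E, h1, h2, h3⟩ := θ.exists_program hδ hθ hs
  obtain ⟨n, hn, rfl⟩ := exists_decodeEdges (b := b) (E := E) (by omega) fun e he => by
    have := h2 e he
    omega
  obtain ⟨w, hw, rfl⟩ := exists_bitsNum _ n hn
  exact hc b w s hw (hspec _ _ h3)

end LoopedReLU
end

noncomputable section
namespace LoopedReLU

/-! ### Norms of the parameter vector -/

/-- Entry by entry: a non-zero multiple of `δ` has absolute value at least `δ`, and zero entries
contribute nothing on either side. -/
theorem LoopedNet.lpPow_bounds {δ B : ℝ} (hδ : 0 < δ) {θ : LoopedNet} (hθ : θ.HasPrecision δ B)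
    {p : ℝ} (hp : 1 ≤ p) : δ ^ p * (θ.l0 : ℝ) ≤ θ.lpPow p ∧ θ.lpPow p ≤ B ^ p * (θ.l0 : ℝ) := by
  have hl0 : (θ.l0 : ℝ) = (θ.block.params.map fun w => (nonzeroCount w : ℝ)).sum := by
    rw [LoopedNet.l0_eq, Nat.cast_multiset_sum, Multiset.map_map]
    rfl
  rw [hl0, ← Multiset.sum_map_mul_left, ← Multiset.sum_map_mul_left, LoopedNet.lpPow]
  constructor <;> refine Multiset.sum_map_le_sum_map _ _ fun w hw => ?_
  · by_cases h0 : w = 0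
    · simp [h0, nonzeroCount, Real.zero_rpow (by linarith : p ≠ 0)]
    · obtain ⟨⟨k, rfl⟩, -⟩ := hθ w hw
      have hk : (1 : ℝ) ≤ |(k : ℝ)| := by
        have : k ≠ 0 := fun h => h0 (by simp [h])
        exact_mod_cast Int.one_le_abs this
      have h1 : nonzeroCount (δ * k) = 1 := by simp only [nonzeroCount, h0, if_false]
      rw [h1, Nat.cast_one, mul_one]
      refine Real.rpow_le_rpow hδ.le ?_ (by linarith)
      rw [abs_mul, abs_of_pos hδ]
      exact le_mul_of_one_le_right hδ.le hk
  · by_cases h0 : w = 0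
    · simp [h0, nonzeroCount, Real.zero_rpow (by linarith : p ≠ 0)]
    · have h1 : nonzeroCount w = 1 := by simp only [nonzeroCount, h0, if_false]
      rw [h1, Nat.cast_one, mul_one]
      exact Real.rpow_le_rpow (abs_nonneg _) (hθ w hw).2 (by linarith)

theorem LoopedNet.lpPow_nonneg (θ : LoopedNet) (p : ℝ) : 0 ≤ θ.lpPow p :=
  Multiset.sum_nonneg fun x hx => by
    obtain ⟨w, -, rfl⟩ := Multiset.mem_map.1 hx
    positivity

theorem LoopedNet.lpNorm_nonneg (θ : LoopedNet) (p : ℝ) : 0 ≤ θ.lpNorm p :=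
  Real.rpow_nonneg (θ.lpPow_nonneg p) _

theorem LoopedNet.lpNorm_rpow (θ : LoopedNet) {p : ℝ} (hp : 1 ≤ p) :
    θ.lpNorm p ^ p = θ.lpPow p := by
  rw [LoopedNet.lpNorm, ← Real.rpow_mul (θ.lpPow_nonneg p), one_div,
    inv_mul_cancel₀ (by linarith), Real.rpow_one]

theorem FFN.eval_eq_zero {m n : ℕ} (N : FFN m n) (h : ∀ w ∈ N.params, w = 0) (x : Fin m → ℝ) :
    N.eval x = 0 := by
  induction N with
  | last A b =>
    have hA : A = 0 := by ext i j; exact h _ (mem_layerParams_weight A b i j)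
    have hb : b = 0 := by ext i; exact h _ (mem_layerParams_bias A b i)
    simp [FFN.eval, hA, hb]
  | layer A b N ih => exact ih (fun w hw => h w (Multiset.mem_add.2 (.inr hw))) _

/-- The all-zero network stays at the origin and never halts. Hence `N ≥ 1`, where `N log N` is
non-negative and monotone. -/
theorem LoopedNet.one_le_l0 {θ : LoopedNet} {s : List Bool} (hs : θ.Outputs s) : 1 ≤ θ.l0 := by
  by_contra h
  have h0 : θ.l0 = 0 := by omega
  have hw : ∀ w ∈ θ.block.params, w = 0 := by
    intro w hw
    by_contra hne
    rw [LoopedNet.l0, Multiset.card_eq_zero, Multiset.filter_eq_nil] at h0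
    exact h0 w hw hne
  obtain ⟨τ, h1, h2, -⟩ := hs
  obtain ⟨t, rfl⟩ : ∃ t, τ = t + 1 := ⟨τ - 1, by omega⟩
  rw [LoopedNet.haltCh, LoopedNet.state, Function.iterate_succ_apply',
    FFN.eval_eq_zero _ hw] at h2
  simp at h2

/-! ### Attained minima -/

theorem exists_iInf_nat_eq {α : Type*} (P : α → Prop) (f : α → ℕ) (h : ∃ a, P a) :
    ∃ a, P a ∧ (⨅ (a : α) (_ : P a), (f a : ℕ∞)) = (f a : ℕ∞) ∧ ∀ b, P b → f a ≤ f b := by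
  have hne : {n | ∃ a, P a ∧ f a = n}.Nonempty := by
    obtain ⟨a, ha⟩ := h
    exact ⟨f a, a, ha, rfl⟩
  obtain ⟨a, ha, hfa⟩ := Nat.sInf_mem hne
  have hmin : ∀ b, P b → f a ≤ f b := fun b hb => by
    rw [hfa]; exact Nat.sInf_le ⟨b, hb, rfl⟩
  exact ⟨a, ha, le_antisymm (iInf₂_le a ha) (le_iInf₂ fun b hb => by exact_mod_cast hmin b hb), hmin⟩

/-- The length of the code of a program with `C * N` edges. -/
theorem exists_code_bound (C c : ℕ) : ∃ A : ℝ, 0 ≤ A ∧ ∀ N : ℕ, 1 ≤ N → ∃ b : ℕ,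
    2 * (C * N) + 4 ≤ 2 ^ b ∧
      ((b + 1 + (2 * b + 3) * 2 ^ b + c : ℕ) : ℝ) ≤ A * (N * Real.logb 2 N) + A := by
  set X : ℝ := 2 * C + 4 with hX
  have hX1 : 1 ≤ X := by
    have : (0 : ℝ) ≤ C := by positivity
    linarith
  set l : ℝ := Real.logb 2 X with hl
  have hl0 : 0 ≤ l := Real.logb_nonneg (by norm_num) hX1
  refine ⟨(8 + 2 * l) * (2 * X) + 4 * X + 1 + c, by positivity, fun N hN => ?_⟩
  have hN' : (1 : ℝ) ≤ N := by exact_mod_cast hN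
  -- The least admissible `b`, so that `2 ^ b` is at most twice the required size.
  set b := Nat.clog 2 (2 * (C * N) + 4) with hb
  refine ⟨b, Nat.le_pow_clog (by norm_num) _, ?_⟩
  set g : ℝ := Real.logb 2 N with hg
  have hg0 : 0 ≤ g := Real.logb_nonneg (by norm_num) hN'
  have h2b : (2 : ℝ) ^ b ≤ 2 * (X * N) := by
    have h1 : 2 ^ (b - 1) < 2 * (C * N) + 4 :=
      Nat.pow_pred_clog_lt_self (b := 2) (x := 2 * (C * N) + 4) (by norm_num) (by omega)
    have hb1 : 1 ≤ b := Nat.clog_pos (by norm_num) (by omega)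
    have h2 : (2 : ℝ) ^ b = 2 * 2 ^ (b - 1) := by rw [← pow_succ', Nat.sub_add_cancel hb1]
    have h3 : (2 : ℝ) ^ (b - 1) ≤ 2 * (C * N) + 4 := by exact_mod_cast h1.le
    rw [h2, hX]
    nlinarith
  have hbl : (b : ℝ) ≤ 1 + l + g := by
    have h1 : (b : ℝ) = Real.logb 2 (2 ^ b) := by
      rw [← Real.rpow_natCast, Real.logb_rpow (by norm_num) (by norm_num)]
    have h2 : Real.logb 2 (2 * (X * N)) = 1 + l + g := by
      rw [Real.logb_mul (by norm_num) (by positivity), Real.logb_mul (by positivity) (by positivity),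
        Real.logb_self_eq_one (by norm_num)]
      ring
    rw [h1, ← h2]
    exact Real.logb_le_logb_of_le (by norm_num) (by positivity) h2b
  -- Absorbs the linear terms into `N log N`; the additive one is needed only for `N = 1`, where the
  -- logarithm vanishes.
  have hNg : (N : ℝ) ≤ N * g + 1 := by
    rcases hN.eq_or_lt with h | h
    · rw [← h]; simp only [Nat.cast_one, one_mul]; linarith
    · have : 1 ≤ g := by
        rw [hg, Real.le_logb_iff_rpow_le (by norm_num) (by positivity), Real.rpow_one]
        exact_mod_cast h
      nlinarith
  have hNg0 : 0 ≤ N * g := by positivity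
  push_cast
  have hbb : (b : ℝ) ≤ 2 ^ b := by exact_mod_cast (Nat.lt_two_pow_self (n := b)).le
  have h5 : (b : ℝ) + 1 + (2 * b + 3) * 2 ^ b + c ≤ (6 + 2 * l + 2 * g) * (2 * (X * N)) + 1 + c := by
    have h6 : (6 + 2 * (b : ℝ) - 2) * 2 ^ b ≤ (6 + 2 * l + 2 * g) * (2 * (X * N)) := by
      refine mul_le_mul (by linarith) h2b (by positivity) (by positivity)
    nlinarith
  refine h5.trans ?_
  have h7 : (6 + 2 * l + 2 * g) * (2 * (X * N)) =
      (6 + 2 * l) * (2 * X) * N + 4 * X * (N * g) := by ring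
  have h8 : (6 + 2 * l) * (2 * X) * N ≤ (6 + 2 * l) * (2 * X) * (N * g + 1) :=
    mul_le_mul_of_nonneg_left hNg (by positivity)
  rw [h7]
  have h9 : 0 ≤ (2 * (2 * X) + 1 + c) * (N * g) := by positivity
  have h10 : 0 ≤ 4 * X := by positivity
  nlinarith

theorem mul_logb_le_mul_logb {x y : ℝ} (hx : 1 ≤ x) (hxy : x ≤ y) :
    x * Real.logb 2 x ≤ y * Real.logb 2 y :=
  mul_le_mul hxy (Real.logb_le_logb_of_le (by norm_num) (by linarith) hxy)
    (Real.logb_nonneg (by norm_num) hx) (by linarith)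

/-! ### Infima of the norms -/

theorem lpComplexity_nonneg (δ B p : ℝ) (s : List Bool) : 0 ≤ lpComplexity δ B p s :=
  Real.sInf_nonneg (by rintro _ ⟨θ, -, -, rfl⟩; exact θ.lpNorm_nonneg p)

theorem lpComplexity_rpow_le {δ B p : ℝ} (hδ : 0 < δ) (hp : 1 ≤ p) {s : List Bool} {θ : LoopedNet}
    (h1 : θ.HasPrecision δ B) (h2 : θ.Outputs s) :
    lpComplexity δ B p s ^ p ≤ B ^ p * (θ.l0 : ℝ) := by
  refine le_trans ?_ (θ.lpPow_bounds hδ h1 hp).2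
  rw [← θ.lpNorm_rpow hp]
  refine Real.rpow_le_rpow (lpComplexity_nonneg ..) (csInf_le ⟨0, ?_⟩ ⟨θ, h1, h2, rfl⟩)
    (by linarith)
  rintro _ ⟨θ, -, -, rfl⟩
  exact θ.lpNorm_nonneg p

/-- The infimum need not be known to be attained: the bound holds for each competing network and
passes to the infimum, which is over a non-empty set. -/
theorem le_lpComplexity_rpow {δ B p : ℝ} (hδ : 0 < δ) (hp : 1 ≤ p) {s : List Bool} {N : ℕ}
    (hne : ∃ θ : LoopedNet, θ.HasPrecision δ B ∧ θ.Outputs s)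
    (h : ∀ θ : LoopedNet, θ.HasPrecision δ B ∧ θ.Outputs s → N ≤ θ.l0) :
    δ ^ p * N ≤ lpComplexity δ B p s ^ p := by
  have hp0 : 0 < p := by linarith
  have h0 : 0 ≤ δ ^ p * (N : ℝ) := by positivity
  rw [← Real.rpow_inv_le_iff_of_pos h0 (lpComplexity_nonneg ..) hp0]
  obtain ⟨θ, h1, h2⟩ := hne
  refine le_csInf ⟨_, θ, h1, h2, rfl⟩ ?_
  rintro _ ⟨θ, h1, h2, rfl⟩
  rw [LoopedNet.lpNorm, one_div]
  refine Real.rpow_le_rpow h0 (le_trans ?_ (θ.lpPow_bounds hδ h1 hp).1) (by positivity)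
  exact mul_le_mul_of_nonneg_left (by exact_mod_cast h θ ⟨h1, h2⟩) (by positivity)

end LoopedReLU
end

/-! ### Assembly of the theorem -/

theorem theorem1 (δ M : ℝ) (hδ : 0 < δ) (hδM : δ ≤ M)
    (hδc : LoopedReLU.IsComputableReal δ)
    (U : List Bool →. List Bool) (hU : LoopedReLU.IsUniversalPrefixMachine U) :
    (∀ θ : LoopedReLU.LoopedNet, θ.HasPrecision δ M → ∀ p : ℝ, 1 ≤ p →
      δ ^ p * (θ.l0 : ℝ) ≤ θ.lpPow p ∧ θ.lpPow p ≤ M ^ p * (θ.l0 : ℝ)) ∧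
    ∃ c_U c_d : ℝ, 0 ≤ c_U ∧ 0 ≤ c_d ∧ ∀ s : List Bool,
      ∃ K N : ℕ, LoopedReLU.kolmogorov U s = (K : ℕ∞) ∧
        LoopedReLU.neuralComplexity δ M s = (N : ℕ∞) ∧
        (N : ℝ) ≤ K + c_U ∧
        (K : ℝ) ≤ c_d * (N * Real.logb 2 N) + c_d ∧
        ∀ p : ℝ, 1 ≤ p →
          LoopedReLU.lpComplexity δ M p s ^ p ≤ M ^ p * (K + c_U) ∧
          (K : ℝ) ≤ c_d / δ ^ p * (LoopedReLU.lpComplexity δ M p s ^ p *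
            Real.logb 2 (LoopedReLU.lpComplexity δ M p s ^ p / δ ^ p)) + c_d := by
  classical
  refine ⟨fun θ hθ p hp => θ.lpPow_bounds hδ hθ hp, ?_⟩
  obtain ⟨c₁, hc₁⟩ := LoopedReLU.exists_net_of_program hδ hδM U hU.partrec
  obtain ⟨c₂, hc₂⟩ := LoopedReLU.exists_program_of_net (B := M) hδ hδc hU
  obtain ⟨A, hA, hbound⟩ := LoopedReLU.exists_code_bound ⌊M / δ⌋₊ c₂
  refine ⟨c₁, A, by positivity, hA, fun s => ?_⟩
  obtain ⟨q, hq, hK, hqmin⟩ := LoopedReLU.exists_iInf_nat_eq (fun q => s ∈ U q) List.length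
    (hU.exists_program s)
  obtain ⟨θ₁, hθ₁, hs₁, hl₁⟩ := hc₁ q s hq
  obtain ⟨θ, ⟨hθ, hs⟩, hN, hθmin⟩ := LoopedReLU.exists_iInf_nat_eq
    (fun θ : LoopedReLU.LoopedNet => θ.HasPrecision δ M ∧ θ.Outputs s) LoopedReLU.LoopedNet.l0
    ⟨θ₁, hθ₁, hs₁⟩
  have hN1 : 1 ≤ θ.l0 := LoopedReLU.LoopedNet.one_le_l0 hs
  have hNK : (θ.l0 : ℝ) ≤ q.length + c₁ := by
    exact_mod_cast (hθmin θ₁ ⟨hθ₁, hs₁⟩).trans hl₁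
  have hKN : (q.length : ℝ) ≤ A * (θ.l0 * Real.logb 2 θ.l0) + A := by
    obtain ⟨b, hb, hb'⟩ := hbound θ.l0 hN1
    obtain ⟨r, hr, hr'⟩ := hc₂ θ s hθ hs b hb
    exact le_trans (by exact_mod_cast (hqmin r hr).trans hr') hb'
  refine ⟨q.length, θ.l0, hK, hN, hNK, hKN, fun p hp => ⟨?_, ?_⟩⟩
  -- The network that minimises `‖θ‖₀` also competes for the smallest `L_p` norm.
  · refine (LoopedReLU.lpComplexity_rpow_le hδ hp hθ hs).trans ?_
    exact mul_le_mul_of_nonneg_left hNK (Real.rpow_nonneg (hδ.le.trans hδM) _)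
  · have hδp : 0 < δ ^ p := Real.rpow_pos_of_pos hδ p
    have hx : (θ.l0 : ℝ) ≤ LoopedReLU.lpComplexity δ M p s ^ p / δ ^ p := by
      rw [le_div_iff₀ hδp, mul_comm]
      exact LoopedReLU.le_lpComplexity_rpow hδ hp ⟨θ, hθ, hs⟩ hθmin
    -- `hx` carries `N` over to the normalised norm, and `x log x` is monotone from `N ≥ 1` on.
    have hmono := LoopedReLU.mul_logb_le_mul_logb (by exact_mod_cast hN1) hx
    calc (q.length : ℝ) ≤ A * (θ.l0 * Real.logb 2 θ.l0) + A := hKN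
      _ ≤ A * (LoopedReLU.lpComplexity δ M p s ^ p / δ ^ p *
          Real.logb 2 (LoopedReLU.lpComplexity δ M p s ^ p / δ ^ p)) + A := by gcongr
      _ = _ := by ring
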